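/- Let $m,k\ge 1$ be integers, $\alpha>0$, $R>0$, $N=m+k$, and write points of $\mathbb R^N=\mathbb R^m\times\mathbb R^k$ as $(z,t)$. Let $X_j=\partial_{z_j}$ for $1\le j\le m$ and $X_{m+j}=\frac{|z|^\alpha}{2}\partial_{t_j}$ for $1\le j\le k$, and let $\mathcal B_\alpha=\sum_{j=1}^N X_j^2=\Delta_z+\frac{|z|^{2\alpha}}{4}\Delta_t$, $|\nabla_\alpha f|^2=\sum_{j=1}^N (X_jf)^2$, $Z_\alpha=\sum_i z_i\partial_{z_i}+(\alpha+1)\sum_j t_j\partial_{t_j}$, $Q=m+(\alpha+1)k$, $$\rho_\alpha(z,t)=\big(|z|^{2(\alpha+1)}+4(\alpha+1)^2|t|^2\big)^{\frac1{2(\alpha+1)}},\quad \psi_\alpha=|\nabla_\alpha\rho_\alpha|^2,\quad B_r=\{\rho_\alpha<r\},\quad S_r=\partial B_r .$$ For an open set $\Omega$, $\Gamma^1_\alpha(\Omega)$ is the class of $f\in C(\Omega)$ whose weak derivatives $X_jf$ are continuous in $\Omega$ for all $j$, and $\Gamma^2_\alpha(\Omega)$ is the class of $f\in\Gamma^1_\alpha(\Omega)$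 with $X_jf\in\Gamma^1_\alpha(\Omega)$ for all $j$. A solution of $\mathcal B_\alpha f=0$ in $\Omega$ is a function $f\in\Gamma^2_\alpha(\Omega)$ satisfying the equation in $\Omega$. With $H_{N-1}$ the $(N-1)$-dimensional Hausdorff measure and $\nabla$ the Euclidean gradient, put, for $0<r<R$, $$D(u,r)=\int_{B_r}|\nabla_\alpha u|^2\,dz\,dt,\quad H(u,r)=\int_{S_r}u^2\frac{\psi_\alpha}{|\nabla\rho_\alpha|}\,dH_{N-1},\quad N(u,r)=\frac{rD(u,r)}{H(u,r)},$$ $$\mathcal W_\kappa(u,r)=\frac{1}{r^{Q-2+2\kappa}}D(u,r)-\frac{\kappa}{r^{Q-1+2\kappa}}H(u,r).$$ Theorem. Let $u$ be a solution of $\mathcal B_\alpha u=0$ in $B_R$ that does not vanish identically in $B_R$. Then $H(u,r)>0$ for all $0<r<R$, and the limit $\kappa=N(u,0^+)=\lim_{r\to0^+}N(u,r)$ exists and is finite. Moreover, let $P_\kappa\in\Gamma^2_\alpha(B_R)$ be such that $\mathcal B_\alpha P_\kappa=0$ and $Z_\alpha P_\kappa=\kappa P_\kappa$ in $B_R$ (the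 latter in the sense of weak derivatives), and let $$\mathcal M_\kappa(u,P_\kappa,r)=\frac{1}{r^{Q-1+2\kappa}}\int_{S_r}(u-P_\kappa)^2\frac{\psi_\alpha}{|\nabla\rho_\alpha|}\,dH_{N-1}.$$ Then for every $0<r<R$ the function $\mathcal M_\kappa(u,P_\kappa,\cdot)$ is differentiable at $r$ and $$\frac{d}{dr}\mathcal M_\kappa(u,P_\kappa,r)=\frac2r\,\mathcal W_\kappa(u,r)\ge0,$$ and $r\mapsto\mathcal M_\kappa(u,P_\kappa,r)$ is nondecreasing on $(0,R)$. -/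

import Mathlib

open MeasureTheory Set Filter Topology
open scoped ContDiff

noncomputable section

namespace Baouendi

/-- `ℝ^N = ℝ^m × ℝ^k` with its Euclidean structure: the coordinates of a point `x = (z, t)` are
`z_i = x (Sum.inl i)` and `t_j = x (Sum.inr j)`. -/
abbrev Space (m k : ℕ) : Type := EuclideanSpace ℝ (Fin m ⊕ Fin k)

variable {m k : ℕ}

/-- The Euclidean length `|z|`. -/
def normZ (x : Space m k) : ℝ := Real.sqrt (∑ i : Fin m, x (Sum.inl i) ^ 2)

/-- The Euclidean length `|t|`. -/
def normT (x : Space m k) : ℝ := Real.sqrt (∑ j : Fin k, x (Sum.inr j) ^ 2)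

/-- The homogeneous dimension `Q = m + (α + 1) k`. -/
def homDim (m k : ℕ) (α : ℝ) : ℝ := m + (α + 1) * k

/-- The pseudo-gauge `ρ_α(z,t) = (|z|^{2(α+1)} + 4 (α+1)² |t|²)^{1/(2(α+1))}`. -/
def rho (α : ℝ) (x : Space m k) : ℝ :=
  (normZ x ^ (2 * (α + 1)) + 4 * (α + 1) ^ 2 * normT x ^ 2) ^ (1 / (2 * (α + 1)))

/-- The pseudo-ball `B_r = {ρ_α < r}`. -/
def ball (α r : ℝ) : Set (Space m k) := {x | rho α x < r}

/-- The pseudo-sphere `S_r = ∂ B_r`. -/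
def sphere (α r : ℝ) : Set (Space m k) := frontier (ball α r)

/-- The vector fields `X_i = ∂_{z_i}` and `X_{m+j} = (|z|^α / 2) ∂_{t_j}`. -/
def X (α : ℝ) : Fin m ⊕ Fin k → Space m k → Space m k
  | Sum.inl i, _ => EuclideanSpace.single (Sum.inl i) 1
  | Sum.inr j, x => (normZ x ^ α / 2) • EuclideanSpace.single (Sum.inr j) 1

/-- The generator of the dilations `(z,t) ↦ (λ z, λ^{α+1} t)`, the vector field
`Z_α = ∑ z_i ∂_{z_i} + (α+1) ∑ t_j ∂_{t_j}`. -/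
def Z (α : ℝ) (x : Space m k) : Space m k :=
  ∑ i : Fin m, x (Sum.inl i) • EuclideanSpace.single (Sum.inl i) 1
    + (α + 1) • ∑ j : Fin k, x (Sum.inr j) • EuclideanSpace.single (Sum.inr j) 1

/-- In the open set `Ω`, the function `g` is the weak (distributional) derivative of `f` along the
vector field `V`, whose divergence is the constant `c`: the formal adjoint of `V` is `-V - c`, so
this says `∫ f (V φ + c φ) = - ∫ g φ` for all test functions `φ ∈ C_c^∞(Ω)`. -/
def HasWeakDerivAlong (Ω : Set (Space m k)) (V : Space m k → Space m k) (c : ℝ)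
    (f g : Space m k → ℝ) : Prop :=
  ∀ φ : Space m k → ℝ, ContDiff ℝ ∞ φ → HasCompactSupport φ → tsupport φ ⊆ Ω →
    ∫ x in Ω, f x * (fderiv ℝ φ x (V x) + c * φ x) = - ∫ x in Ω, g x * φ x

/-- `g` is a continuous weak derivative `X_j f` in `Ω` (each `X_j` is divergence free). -/
def IsWeakX (α : ℝ) (Ω : Set (Space m k)) (j : Fin m ⊕ Fin k) (f g : Space m k → ℝ) : Prop :=
  ContinuousOn g Ω ∧ HasWeakDerivAlong Ω (X α j) 0 f g

/-- The class `Γ¹_α(Ω)`: `f` and its weak derivatives `X_j f` are continuous in `Ω`. -/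
def Gamma1 (α : ℝ) (Ω : Set (Space m k)) (f : Space m k → ℝ) : Prop :=
  ContinuousOn f Ω ∧ ∀ j, ∃ g, IsWeakX α Ω j f g

open Classical in
/-- The continuous weak derivative `X_j f` in `Ω`, if there is one (its values in the open set `Ω`
are then uniquely determined; those outside `Ω` are irrelevant). -/
def weakX (α : ℝ) (Ω : Set (Space m k)) (j : Fin m ⊕ Fin k) (f : Space m k → ℝ) :
    Space m k → ℝ :=
  if h : ∃ g, IsWeakX α Ω j f g then h.choose else 0

/-- The class `Γ²_α(Ω)`: `f` and all `X_j f` belong to `Γ¹_α(Ω)`. -/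
def Gamma2 (α : ℝ) (Ω : Set (Space m k)) (f : Space m k → ℝ) : Prop :=
  Gamma1 α Ω f ∧ ∀ j, Gamma1 α Ω (weakX α Ω j f)

/-- The operator `𝓑_α f = ∑_j X_j (X_j f) = Δ_z f + (|z|^{2α}/4) Δ_t f` in `Ω`. -/
def baouendi (α : ℝ) (Ω : Set (Space m k)) (f : Space m k → ℝ) (x : Space m k) : ℝ :=
  ∑ j, weakX α Ω j (weakX α Ω j f) x

/-- `f` is a solution of `𝓑_α f = 0` in `Ω`, in the class `Γ²_α(Ω)`. -/
def IsSolution (α : ℝ) (Ω : Set (Space m k)) (f : Space m k → ℝ) : Prop :=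
  Gamma2 α Ω f ∧ ∀ x ∈ Ω, baouendi α Ω f x = 0

/-- `Z_α f = κ f` in `Ω`, in the sense of weak derivatives (`Z_α` has divergence `Q`). -/
def IsHomogeneous (α κ : ℝ) (Ω : Set (Space m k)) (f : Space m k → ℝ) : Prop :=
  HasWeakDerivAlong Ω (Z α) (homDim m k α) f (fun x => κ * f x)

/-- `ψ_α = |∇_α ρ_α|² = ∑_j (X_j ρ_α)²`. -/
def psi (α : ℝ) (x : Space m k) : ℝ := ∑ j, (fderiv ℝ (rho α) x (X α j x)) ^ 2

/-- The height `H(u,r) = ∫_{S_r} u² ψ_α / |∇ρ_α| dH_{N-1}`, where `∇` is the Euclidean gradient and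
`H_{N-1}` the Hausdorff measure of dimension `N - 1 = m + k - 1`, with the usual normalization. -/
def height (α : ℝ) (u : Space m k → ℝ) (r : ℝ) : ℝ :=
  ∫ x in sphere α r, u x ^ 2 * (psi α x / ‖gradient (rho α) x‖) ∂(μHE[m + k - 1])

/-- The Dirichlet integral `D(u,r) = ∫_{B_r} |∇_α u|² dz dt`, where `|∇_α u|² = ∑_j (X_j u)²`,
of a function `u` in `Γ¹_α(B_R)`, for `0 < r < R`. -/
def energy (α R : ℝ) (u : Space m k → ℝ) (r : ℝ) : ℝ :=
  ∫ x in ball α r, ∑ j, weakX α (ball α R) j u x ^ 2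

/-- The frequency `N(u,r) = r D(u,r) / H(u,r)`. -/
def frequency (α R : ℝ) (u : Space m k → ℝ) (r : ℝ) : ℝ :=
  r * energy α R u r / height α u r

/-- The Weiss type functional
`W_κ(u,r) = r^{-(Q-2+2κ)} D(u,r) - κ r^{-(Q-1+2κ)} H(u,r)`. -/
def weiss (α R κ : ℝ) (u : Space m k → ℝ) (r : ℝ) : ℝ :=
  1 / r ^ (homDim m k α - 2 + 2 * κ) * energy α R u r
    - κ / r ^ (homDim m k α - 1 + 2 * κ) * height α u r

/-- The Monneau type functional
`M_κ(u,P,r) = r^{-(Q-1+2κ)} ∫_{S_r} (u - P)² ψ_α / |∇ρ_α| dH_{N-1}`. -/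
def monneau (α κ : ℝ) (u P : Space m k → ℝ) (r : ℝ) : ℝ :=
  1 / r ^ (homDim m k α - 1 + 2 * κ) *
    ∫ x in sphere α r, (u x - P x) ^ 2 * (psi α x / ‖gradient (rho α) x‖) ∂(μHE[m + k - 1])

end Baouendi

end

noncomputable section

namespace Baouendi

/-! ### Comparison of measures, and linear algebra of hyperplanes in coordinates. -/

section

open scoped ENNReal NNReal

section Comparison

variable {E : Type*} [TopologicalSpace E] [SecondCountableTopology E] [MeasurableSpace E]
  [OpensMeasurableSpace E]

/-! Let δ_r be the anisotropic dilations, λ the measure |∇ρ|⁻¹ dH_{N-1} on S_1 (`leray`), and for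
two functions put F(a,b) = ∫ ψ(y) u(δ_a y) v(δ_b y) dλ(y) (`pairing`). Since ψ is invariant under
δ_r and the measure on S_r is r^{Q-1} times the image of λ, H(u,r) = r^{Q-1} φ(r) with φ(r) = F(r,r)
for v = u.

The central fact is that F(a,b), for two solutions, depends only on the product ab
(`IsWeakSol.pairing_eq`). The conormal density ∑_j (X_j u)(X_j ρ) on a pseudo-sphere is ψ times the
derivative of u along r ↦ δ_r y, so ∂_a F and ∂_b F are flux integrals. Dilates of solutions are
solutions, and Green's identity on B_1 for u∘δ_a and v∘δ_b, used in both orders, gives a ∂_a F = b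
∂_b F.

Everything else follows from this. If c² = ab, then φ(c) = F(a,b), and Cauchy-Schwarz gives the
three-spheres inequality φ(c)² ≤ φ(a) φ(b). Green's identity with v = u gives φ' = 2 r^{1-Q} D ≥ 0.
Hence a zero of φ spreads inwards by monotonicity and outwards by the three-spheres inequality, so φ
> 0 unless u = 0. Then s ↦ log φ(e^s) is convex with derivative 2N(u,e^s), so N is nondecreasing,
its limit κ at 0 is its infimum, and W_κ ≥ 0 because it is a positive multiple of N - κ. For P
homogeneous of degree κ, the pairing at (r,r) equals the one at (s, r²/s), which is (r/s)^{2κ} times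
the one at (s,s). So r^{-2κ} times the pairings of u with P and of P with P are constant, and M_κ
differs from r^{-2κ} φ(r) by a constant, whose derivative is (2/r) W_κ.

The remaining work is foundational. The surface integrals are taken against Hausdorff measure, so
area and coarea formulas for level sets of ρ and polar coordinates are proved by graph charts
(`volume_dropCoord_image`, `volume_eq_map_polar`). The derivatives X_j are only weak and continuous,
so an anisotropic mollification (`HasWeakGrad.exists_smooth_approx`) justifies testing the equation
with such functions. Green's identity (`IsWeakSol.green`) comes from radial cutoffs as test
functions, and weak homogeneity of P is upgraded to a pointwise one (`IsHomogeneous.apply_dil`). -/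

theorem measure_le_of_locally_le {μ ν : Measure E} {S : Set E}
    (h : ∀ p ∈ S, ∃ V ∈ 𝓝 p, ∀ A ⊆ S ∩ V, MeasurableSet A → μ A ≤ ν A)
    {A : Set E} (hA : MeasurableSet A) (hAS : A ⊆ S) : μ A ≤ ν A := by
  choose! V hV hVA using h
  have hV' : ∀ p ∈ S, interior (V p) ∈ 𝓝[S] p := fun p hp =>
    mem_nhdsWithin_of_mem_nhds (interior_mem_nhds.2 (hV p hp))
  -- A countable subcover exists by second countability. Made disjoint, it lets both measures of `A`
  -- be summed piece by piece.
  obtain ⟨t, htS, htc, hcov⟩ := TopologicalSpace.countable_cover_nhdsWithin hV'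
  rcases t.eq_empty_or_nonempty with rfl | hne
  · have : A = ∅ := by
      apply eq_empty_of_subset_empty
      exact hAS.trans (by simpa using hcov)
    simp [this]
  obtain ⟨f, hf⟩ := htc.exists_eq_range hne
  set D := disjointed (fun n => interior (V (f n)))
  have hDm : ∀ n, MeasurableSet (D n) :=
    fun n => MeasurableSet.disjointed (fun n => isOpen_interior.measurableSet) n
  have hDd : Pairwise (Function.onFun Disjoint D) := disjoint_disjointed _
  have hDU : A ⊆ ⋃ n, D n := by
    rw [iUnion_disjointed]
    refine hAS.trans (hcov.trans ?_)
    rw [hf, biUnion_range]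
  have hd (κ : Measure E) : κ A = ∑' n, κ (A ∩ D n) := by
    rw [← measure_iUnion, ← inter_iUnion, inter_eq_left.2 hDU]
    · intro i j hij
      exact (hDd hij).mono inter_subset_right inter_subset_right
    · exact fun n => hA.inter (hDm n)
  rw [hd μ, hd ν]
  refine ENNReal.tsum_le_tsum fun n => ?_
  refine hVA (f n) (htS (hf ▸ mem_range_self n)) _ ?_ (hA.inter (hDm n))
  exact inter_subset_inter hAS ((disjointed_subset _ n).trans interior_subset)

/-- The local comparison with constant c becomes global by countable additivity, and then c tends to
1. In this form, metric distortions that are small only near each point give exact equality of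
measures. -/
theorem measure_eq_of_locally_comparable {μ ν : Measure E} {S : Set E}
    (h : ∀ p ∈ S, ∀ c : ℝ≥0, 1 < c → ∃ V ∈ 𝓝 p, ∀ A ⊆ S ∩ V, MeasurableSet A →
      μ A ≤ c * ν A ∧ ν A ≤ c * μ A)
    {A : Set E} (hA : MeasurableSet A) (hAS : A ⊆ S) : μ A = ν A := by
  have key : ∀ c : ℝ≥0, 1 < c → μ A ≤ c * ν A ∧ ν A ≤ c * μ A := by
    intro c hc
    constructor
    · have := measure_le_of_locally_le (μ := μ) (ν := (c : ℝ≥0∞) • ν) (fun p hp => by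
        obtain ⟨V, hV, h'⟩ := h p hp c hc
        exact ⟨V, hV, fun A h1 h2 => by simpa only [Measure.smul_apply, smul_eq_mul] using (h' A h1 h2).1⟩) hA hAS
      simpa only [Measure.smul_apply, smul_eq_mul] using this
    · have := measure_le_of_locally_le (μ := ν) (ν := (c : ℝ≥0∞) • μ) (fun p hp => by
        obtain ⟨V, hV, h'⟩ := h p hp c hc
        exact ⟨V, hV, fun A h1 h2 => by simpa only [Measure.smul_apply, smul_eq_mul] using (h' A h1 h2).2⟩) hA hAS
      simpa only [Measure.smul_apply, smul_eq_mul] using this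
  have le_of : ∀ a b : ℝ≥0∞, (∀ c : ℝ≥0, 1 < c → a ≤ c * b) → a ≤ b := by
    intro a b hab
    have ht : Tendsto (fun c : ℝ≥0 => (c : ℝ≥0∞) * b) (𝓝[>] 1) (𝓝 (((1 : ℝ≥0) : ℝ≥0∞) * b)) := by
      refine ENNReal.Tendsto.mul_const ?_ (Or.inl (by simp))
      exact (ENNReal.continuous_coe.tendsto 1).mono_left nhdsWithin_le_nhds
    have := ge_of_tendsto ht (b := a) (by
      filter_upwards [self_mem_nhdsWithin] with c hc using hab c hc)
    simpa using this
  exact le_antisymm (le_of _ _ fun c hc => (key c hc).1) (le_of _ _ fun c hc => (key c hc).2)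

end Comparison

section Coordinates

variable {ι : Type*}

/-- The coordinate projection forgetting the `i`-th coordinate. -/
def dropCoord (i : ι) : EuclideanSpace ℝ ι →L[ℝ] EuclideanSpace ℝ {j // j ≠ i} :=
  (EuclideanSpace.equiv {j // j ≠ i} ℝ).symm.toContinuousLinearMap ∘L
    ContinuousLinearMap.pi fun j => EuclideanSpace.proj (j : ι)

@[simp] theorem dropCoord_apply (i : ι) (x : EuclideanSpace ℝ ι) (j : {j // j ≠ i}) :
    dropCoord i x j = x j := rfl

variable [DecidableEq ι]

/-- Extension of a vector by zero in the `i`-th coordinate. -/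
def extendZero (i : ι) : EuclideanSpace ℝ {j // j ≠ i} →L[ℝ] EuclideanSpace ℝ ι :=
  (EuclideanSpace.equiv ι ℝ).symm.toContinuousLinearMap ∘L
    ContinuousLinearMap.pi fun j => if h : j ≠ i then EuclideanSpace.proj ⟨j, h⟩ else 0

theorem extendZero_apply_of_ne (i : ι) (y : EuclideanSpace ℝ {j // j ≠ i}) {j : ι} (h : j ≠ i) :
    extendZero i y j = y ⟨j, h⟩ := by
  simp [extendZero, h]

@[simp] theorem extendZero_apply_self (i : ι) (y : EuclideanSpace ℝ {j // j ≠ i}) :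
    extendZero i y i = 0 := by
  simp [extendZero]

theorem extendZero_dropCoord (i : ι) (x : EuclideanSpace ℝ ι) :
    extendZero i (dropCoord i x) = x - x i • EuclideanSpace.single i 1 := by
  ext j
  by_cases h : j = i
  · subst h; simp
  · simp [extendZero_apply_of_ne i _ h, h]

variable [Fintype ι]

theorem sum_eq_add_sum_ne (i : ι) (f : ι → ℝ) : ∑ j, f j = f i + ∑ j : {j // j ≠ i}, f j := by
  rw [Fintype.sum_eq_add_sum_compl i f, Finset.sum_subtype (p := (· ≠ i)) {i}ᶜ (by simp) f]

theorem inner_eq_dropCoord (i : ι) (v w : EuclideanSpace ℝ ι) :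
    inner ℝ v w = v i * w i + inner ℝ (dropCoord i v) (dropCoord i w) := by
  simp only [PiLp.inner_apply]
  rw [sum_eq_add_sum_ne i]
  simp [mul_comm]

/-- The parametrization of the hyperplane orthogonal to `v` by the coordinates other than the
`i`-th. -/
def hyperplaneLift (i : ι) (v : EuclideanSpace ℝ ι) :
    EuclideanSpace ℝ {j // j ≠ i} →L[ℝ] EuclideanSpace ℝ ι :=
  extendZero i - ((v i)⁻¹ • (innerSL ℝ (dropCoord i v))).smulRight (EuclideanSpace.single i 1)

theorem hyperplaneLift_apply (i : ι) (v : EuclideanSpace ℝ ι) (y) :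
    hyperplaneLift i v y =
      extendZero i y - ((v i)⁻¹ * inner ℝ (dropCoord i v) y) • EuclideanSpace.single i 1 := by
  simp [hyperplaneLift]

theorem hyperplaneLift_dropCoord (i : ι) {v : EuclideanSpace ℝ ι} (hv : v i ≠ 0)
    (x : EuclideanSpace ℝ ι) :
    hyperplaneLift i v (dropCoord i x) =
      x - ((v i)⁻¹ * inner ℝ v x) • EuclideanSpace.single i 1 := by
  rw [hyperplaneLift_apply, extendZero_dropCoord, sub_sub, ← add_smul, inner_eq_dropCoord i v x]
  congr 2
  field_simp

/-- With c = v'/v_i, where v' consists of the other coordinates of v, the Gram operator L*L is the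
identity plus the rank one map y ↦ ⟨c,y⟩ c. Its determinant is 1 + |c|² = |v|²/v_i². -/
theorem normDet_hyperplaneLift (i : ι) {v : EuclideanSpace ℝ ι} (hv : v i ≠ 0) :
    (hyperplaneLift i v).toLinearMap.normDet = ‖v‖ / |v i| := by
  set L := (hyperplaneLift i v).toLinearMap
  set c : EuclideanSpace ℝ {j // j ≠ i} := (v i)⁻¹ • dropCoord i v
  have hL : ∀ y, L y = extendZero i y - inner ℝ c y • EuclideanSpace.single i 1 := by
    intro y
    simp [L, hyperplaneLift_apply, c, inner_smul_left]
  have hcomp : L.adjoint ∘ₗ L = LinearMap.transvection (innerSL ℝ c).toLinearMap c := by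
    ext1 x
    refine ext_inner_right ℝ fun y => ?_
    rw [LinearMap.comp_apply, LinearMap.adjoint_inner_left, inner_eq_dropCoord i, hL, hL]
    have hd : ∀ y, dropCoord i (extendZero i y - inner ℝ c y • EuclideanSpace.single i 1) = y := by
      intro y
      ext j
      simp [extendZero_apply_of_ne i _ j.2, j.2]
    rw [hd, hd]
    simp [LinearMap.transvection, inner_add_left, inner_smul_left]
    ring
  have hsq := L.normDet_sq
  rw [hcomp, LinearMap.transvection.det] at hsq
  have h1 : L.normDet ^ 2 = (‖v‖ / |v i|) ^ 2 := by
    have : ((L.normDet ^ 2 : ℝ) : ℝ) = _ := hsq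
    rw [this]
    have h2 : ‖v‖ ^ 2 = v i * v i + inner ℝ (dropCoord i v) (dropCoord i v) := by
      rw [← real_inner_self_eq_norm_sq, inner_eq_dropCoord i]
    rw [div_pow, sq_abs, h2]
    simp only [ContinuousLinearMap.coe_coe, innerSL_apply_apply, c, inner_smul_left, inner_smul_right]
    simp
    field_simp
  exact (sq_eq_sq₀ L.normDet_nonneg (by positivity)).1 h1

end Coordinates

end

/-! ### Hausdorff measure and the area formula on level sets. -/

section

open scoped ENNReal NNReal

section Lipschitz

variable {X Y : Type*} [MetricSpace X] [MeasurableSpace X] [BorelSpace X] [MetricSpace Y]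
  [MeasurableSpace Y] [BorelSpace Y]

theorem euclideanHausdorffMeasure_image_le {f : X → Y} {A : Set X} {K : ℝ≥0} (n : ℕ)
    (h : ∀ x ∈ A, ∀ y ∈ A, dist (f x) (f y) ≤ K * dist x y) :
    μHE[n] (f '' A) ≤ (K : ℝ≥0∞) ^ n * μHE[n] A := by
  have hL : LipschitzOnWith K f A := LipschitzOnWith.of_dist_le_mul h
  have := hL.hausdorffMeasure_image_le (d := n) (by positivity)
  simp only [Measure.euclideanHausdorffMeasure_def, Measure.smul_apply, ENNReal.smul_def,
    smul_eq_mul]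
  rw [mul_left_comm]
  gcongr
  simpa using this

theorem euclideanHausdorffMeasure_le_image {f : X → Y} {A : Set X} {K : ℝ≥0} (n : ℕ)
    (h : ∀ x ∈ A, ∀ y ∈ A, dist x y ≤ K * dist (f x) (f y)) :
    μHE[n] A ≤ (K : ℝ≥0∞) ^ n * μHE[n] (f '' A) := by
  rcases A.eq_empty_or_nonempty with rfl | ⟨x₀, hx₀⟩
  · simp
  have : Nonempty X := ⟨x₀⟩
  have hinj : InjOn f A := by
    intro x hx y hy hxy
    have := h x hx y hy
    rw [hxy, dist_self, mul_zero] at this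
    exact dist_le_zero.1 this
  have himg : Function.invFunOn f A '' (f '' A) = A := hinj.invFunOn_image Subset.rfl
  conv_lhs => rw [← himg]
  refine euclideanHausdorffMeasure_image_le n ?_
  rintro _ ⟨x, hx, rfl⟩ _ ⟨y, hy, rfl⟩
  rw [hinj.leftInvOn_invFunOn hx, hinj.leftInvOn_invFunOn hy]
  exact h x hx y hy

end Lipschitz

theorem exists_one_lt_pow_le {c : ℝ≥0} (hc : 1 < c) (n : ℕ) : ∃ d : ℝ≥0, 1 < d ∧ d ^ n ≤ c := by
  have ht : Tendsto (fun d : ℝ≥0 => d ^ n) (𝓝[>] 1) (𝓝 (1 ^ n)) :=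
    ((continuous_pow n).tendsto 1).mono_left nhdsWithin_le_nhds
  rw [one_pow] at ht
  obtain ⟨d, h1, h2⟩ := ((ht.eventually (gt_mem_nhds hc)).and self_mem_nhdsWithin).exists
  exact ⟨d, h2, h1.le⟩

theorem continuousAt_gradient {F : Type*} [NormedAddCommGroup F] [InnerProductSpace ℝ F]
    [CompleteSpace F] {f : F → ℝ} {p : F} (h : ContDiffAt ℝ 1 f p) :
    ContinuousAt (gradient f) p := by
  have : ContinuousAt (fderiv ℝ f) p := (h.fderiv_right (m := 0) (by norm_num)).continuousAt
  exact (InnerProductSpace.toDual ℝ F).symm.continuous.continuousAt.comp this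

theorem inner_gradient {F : Type*} [NormedAddCommGroup F] [InnerProductSpace ℝ F]
    [CompleteSpace F] (f : F → ℝ) (p x : F) : inner ℝ (gradient f p) x = fderiv ℝ f p x := by
  simp [gradient]

section Area

variable {ι : Type*} [Fintype ι] [DecidableEq ι]

/-- Near a regular point of a level set, the projection that forgets a coordinate transverse to the
level set, followed by the lift to the tangent hyperplane, is almost isometric. -/
theorem exists_nhds_levelSet_almost_isometric {i : ι} {f : EuclideanSpace ℝ ι → ℝ}
    {S : Set (EuclideanSpace ℝ ι)} (hconst : ∀ x ∈ S, ∀ y ∈ S, f x = f y)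
    {p : EuclideanSpace ℝ ι} (hf : ContDiffAt ℝ 1 f p) (hi : gradient f p i ≠ 0) {d : ℝ≥0}
    (hd : 1 < d) :
    ∃ V ∈ 𝓝 p, ∀ x ∈ S ∩ V, ∀ y ∈ S ∩ V,
      dist (hyperplaneLift i (gradient f p) (dropCoord i x))
        (hyperplaneLift i (gradient f p) (dropCoord i y)) ≤ d * dist x y ∧
      dist x y ≤ d * dist (hyperplaneLift i (gradient f p) (dropCoord i x))
        (hyperplaneLift i (gradient f p) (dropCoord i y)) := by
  set v := gradient f p
  have hd' : (1 : ℝ) < d := by exact_mod_cast hd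
  -- With this ε one has 1 - ε = 1/d, and 1 + ε ≤ d because d + 1/d ≥ 2. These are the two
  -- distortion bounds needed.
  set ε : ℝ := 1 - (d : ℝ)⁻¹
  have hε : 0 < ε := sub_pos.2 (inv_lt_one_of_one_lt₀ hd')
  set η : ℝ≥0 := ⟨ε * |v i|, by positivity⟩
  have hη : 0 < η := by
    have : 0 < ε * |v i| := by positivity
    exact_mod_cast this
  obtain ⟨V, hV, hVa⟩ := (hf.hasStrictFDerivAt (by norm_num)).approximates_deriv_on_nhds
    (c := η) (Or.inr hη)
  refine ⟨V, hV, fun x hx y hy => ?_⟩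
  -- On the level set the increment of `f` vanishes, so strict differentiability says that chords
  -- are almost orthogonal to the gradient at `p`.
  have h1 : |inner ℝ v (x - y)| ≤ ε * |v i| * ‖x - y‖ := by
    have := hVa x hx.2 y hy.2
    rw [hconst x hx.1 y hy.1, sub_self, zero_sub, norm_neg] at this
    rw [inner_gradient]
    exact this
  rw [dist_eq_norm, dist_eq_norm, ← map_sub, ← map_sub, hyperplaneLift_dropCoord i hi]
  set w := x - y
  have h2 : ‖((v i)⁻¹ * inner ℝ v w) • EuclideanSpace.single i (1 : ℝ)‖ ≤ ε * ‖w‖ := by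
    rw [norm_smul, PiLp.norm_single, norm_one, mul_one, norm_mul, norm_inv,
      Real.norm_eq_abs, Real.norm_eq_abs, inv_mul_le_iff₀ (by positivity)]
    linarith
  have h3 : (d : ℝ)⁻¹ + d ≥ 2 := by
    have h0 : (0 : ℝ) < d := by linarith
    have : (d : ℝ)⁻¹ + d - 2 = (d - 1) ^ 2 / d := by field_simp; ring
    have : 0 ≤ (d : ℝ)⁻¹ + d - 2 := by rw [this]; positivity
    linarith
  constructor
  · refine (norm_sub_le _ _).trans ?_
    nlinarith [norm_nonneg w]
  · have h4 := norm_sub_norm_le w (((v i)⁻¹ * inner ℝ v w) • EuclideanSpace.single i (1 : ℝ))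
    have h5 : (d : ℝ)⁻¹ * ‖w‖ ≤ ‖w - ((v i)⁻¹ * inner ℝ v w) • EuclideanSpace.single i (1 : ℝ)‖ := by
      simp only [ε] at h2
      linarith
    rwa [inv_mul_le_iff₀ (by linarith)] at h5

/-- The area formula for a level set that is a graph over the coordinates other than the `i`-th. -/
theorem volume_dropCoord_image {i : ι} {n : ℕ} (hn : Fintype.card ι = n + 1)
    {f : EuclideanSpace ℝ ι → ℝ} {S : Set (EuclideanSpace ℝ ι)} (hS : MeasurableSet S)
    (hconst : ∀ x ∈ S, ∀ y ∈ S, f x = f y) (hf : ∀ x ∈ S, ContDiffAt ℝ 1 f x)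
    (hi : ∀ x ∈ S, gradient f x i ≠ 0) (hinj : InjOn (dropCoord i) S)
    {A : Set (EuclideanSpace ℝ ι)} (hA : MeasurableSet A) (hAS : A ⊆ S) :
    volume (dropCoord i '' A) =
      ∫⁻ x in A, ENNReal.ofReal (|gradient f x i| / ‖gradient f x‖) ∂μHE[n] := by
  set w : EuclideanSpace ℝ ι → ℝ := fun x => |gradient f x i| / ‖gradient f x‖
  have hcard : Module.finrank ℝ (EuclideanSpace ℝ {j // j ≠ i}) = n := by
    rw [finrank_euclideanSpace, Fintype.card_subtype_compl]
    simp [hn]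
  have hemb : MeasurableEmbedding (S.domRestrict (dropCoord i)) :=
    (dropCoord i).continuous.continuousOn.measurableEmbedding hS hinj
  -- The volume of the projection is made into a measure carried by `S`, so that it can be compared
  -- locally with the weighted Hausdorff measure.
  set ν : Measure (EuclideanSpace ℝ ι) :=
    (volume.comap (S.domRestrict (dropCoord i))).map Subtype.val
  have hν : ∀ A ⊆ S, MeasurableSet A → ν A = volume (dropCoord i '' A) := by
    intro A hAS hA
    rw [Measure.map_apply measurable_subtype_coe hA, hemb.comap_apply, image_domRestrict,
      inter_eq_left.2 hAS]
  set μ : Measure (EuclideanSpace ℝ ι) := μHE[n].withDensity fun x => ENNReal.ofReal (w x)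
  have hμ : ∀ A, MeasurableSet A → μ A = ∫⁻ x in A, ENNReal.ofReal (w x) ∂μHE[n] :=
    fun A hA => withDensity_apply _ hA
  rw [← hν A hAS hA, ← hμ A hA]
  refine measure_eq_of_locally_comparable (fun p hp c hc => ?_) hA hAS
  -- Of the n + 1 factors d, n pay for the Lipschitz distortion of n-dimensional Hausdorff measure
  -- and one for the oscillation of the density `w`.
  obtain ⟨d, hd1, hdc⟩ := exists_one_lt_pow_le hc (n + 1)
  have hd0 : (0 : ℝ) < d := by exact_mod_cast zero_lt_one.trans hd1
  obtain ⟨V₁, hV₁, hiso⟩ := exists_nhds_levelSet_almost_isometric hconst (hf p hp) (hi p hp) hd1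
  set v := gradient f p
  have hvi : v i ≠ 0 := hi p hp
  have hv : v ≠ 0 := by rintro h; simp [h] at hvi
  have hwp : 0 < w p := by
    have : 0 < ‖v‖ := norm_pos_iff.2 hv
    have : 0 < |v i| := abs_pos.2 hvi
    positivity
  have hwc : ContinuousAt w p := by
    have hg := continuousAt_gradient (hf p hp)
    have hgi : ContinuousAt (fun x => gradient f x i) p :=
      (EuclideanSpace.proj (𝕜 := ℝ) i).continuous.continuousAt.comp hg
    exact hgi.abs.div hg.norm (norm_ne_zero_iff.2 hv)
  have hd1' : (1 : ℝ) < d := by exact_mod_cast hd1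
  have hup : ∀ᶠ x in 𝓝 p, w x < d * w p :=
    hwc.eventually (gt_mem_nhds (by nlinarith))
  have hlo : ∀ᶠ x in 𝓝 p, w p / d < w x :=
    hwc.eventually (lt_mem_nhds (by rw [div_lt_iff₀ hd0]; nlinarith))
  refine ⟨V₁ ∩ {x | w x < d * w p ∧ w p / d < w x}, inter_mem hV₁ (hup.and hlo),
    fun A hAV hA => ?_⟩
  have hAS : A ⊆ S := fun x hx => (hAV hx).1
  have hAV₁ : A ⊆ S ∩ V₁ := fun x hx => ⟨(hAV hx).1, (hAV hx).2.1⟩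
  set g := fun x => hyperplaneLift i v (dropCoord i x)
  -- On the tangent hyperplane the area formula is linear, with constant factor |v|/|v_i| = 1/w(p).
  have hg : μHE[n] (g '' A) = ENNReal.ofReal (w p)⁻¹ * volume (dropCoord i '' A) := by
    have h := (hyperplaneLift i v).toLinearMap.euclideanHausdorffMeasure_image_eq_normDet_mul_volume
      (dropCoord i '' A)
    rw [hcard, normDet_hyperplaneLift i hvi, image_image] at h
    rw [show (w p)⁻¹ = ‖v‖ / |v i| by simp [w, v]]
    exact h
  have hvol : volume (dropCoord i '' A) = ENNReal.ofReal (w p) * μHE[n] (g '' A) := by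
    rw [hg, ← mul_assoc, ← ENNReal.ofReal_mul hwp.le, mul_inv_cancel₀ hwp.ne', ENNReal.ofReal_one,
      one_mul]
  have hle1 : μHE[n] (g '' A) ≤ (d : ℝ≥0∞) ^ n * μHE[n] A :=
    euclideanHausdorffMeasure_image_le n fun x hx y hy => (hiso x (hAV₁ hx) y (hAV₁ hy)).1
  have hle2 : μHE[n] A ≤ (d : ℝ≥0∞) ^ n * μHE[n] (g '' A) :=
    euclideanHausdorffMeasure_le_image n fun x hx y hy => (hiso x (hAV₁ hx) y (hAV₁ hy)).2
  have hμ1 : μ A ≤ ENNReal.ofReal (w p) * d * μHE[n] A := by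
    rw [hμ A hA, ← setLIntegral_const]
    refine setLIntegral_mono' hA fun x hx => ?_
    rw [← ENNReal.ofReal_coe_nnreal, ← ENNReal.ofReal_mul hwp.le]
    exact ENNReal.ofReal_le_ofReal (by have := (hAV hx).2.2.1; linarith)
  have hμ2 : ENNReal.ofReal (w p) * μHE[n] A ≤ d * μ A := by
    rw [hμ A hA, ← setLIntegral_const, ← lintegral_const_mul' _ _ (by simp)]
    refine setLIntegral_mono' hA fun x hx => ?_
    rw [← ENNReal.ofReal_coe_nnreal, ← ENNReal.ofReal_mul hd0.le]
    refine ENNReal.ofReal_le_ofReal ?_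
    have := (hAV hx).2.2.2
    rw [div_lt_iff₀ hd0] at this
    linarith
  have hdc' : (d : ℝ≥0∞) ^ n * d ≤ c := by
    rw [← pow_succ]
    exact_mod_cast hdc
  rw [hν A hAS hA, hvol]
  constructor
  · calc ENNReal.ofReal (w p) * μHE[n] (g '' A)
        ≤ ENNReal.ofReal (w p) * ((d : ℝ≥0∞) ^ n * μHE[n] A) := by gcongr
      _ = (d : ℝ≥0∞) ^ n * (ENNReal.ofReal (w p) * μHE[n] A) := by ring
      _ ≤ (d : ℝ≥0∞) ^ n * (d * μ A) := by gcongr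
      _ = ((d : ℝ≥0∞) ^ n * d) * μ A := by ring
      _ ≤ c * μ A := by gcongr
  · calc μ A ≤ ENNReal.ofReal (w p) * d * μHE[n] A := hμ1
      _ ≤ ENNReal.ofReal (w p) * d * ((d : ℝ≥0∞) ^ n * μHE[n] (g '' A)) := by gcongr
      _ = ((d : ℝ≥0∞) ^ n * d) * (ENNReal.ofReal (w p) * μHE[n] (g '' A)) := by ring
      _ ≤ _ := by gcongr

end Area

end

/-! ### The coarea formula in graph charts, and diagonal linear maps. -/

section

open scoped ENNReal NNReal

section Coarea

variable {ι : Type*} [DecidableEq ι]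

/-- The map that replaces the `i`-th coordinate by the value of `f`. -/
def straighten (i : ι) (f : EuclideanSpace ℝ ι → ℝ) (x : EuclideanSpace ℝ ι) :
    EuclideanSpace ℝ ι :=
  x + (f x - x i) • EuclideanSpace.single i 1

theorem straighten_apply_self (i : ι) (f : EuclideanSpace ℝ ι → ℝ) (x : EuclideanSpace ℝ ι) :
    straighten i f x i = f x := by simp [straighten]

theorem dropCoord_straighten (i : ι) (f : EuclideanSpace ℝ ι → ℝ) (x : EuclideanSpace ℝ ι) :
    dropCoord i (straighten i f x) = dropCoord i x := by
  ext j
  simp [straighten, j.2]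

variable [Fintype ι]

theorem hasFDerivAt_straighten (i : ι) {f : EuclideanSpace ℝ ι → ℝ} {x : EuclideanSpace ℝ ι}
    (hf : DifferentiableAt ℝ f x) :
    HasFDerivAt (straighten i f) (ContinuousLinearMap.id ℝ _ +
      (fderiv ℝ f x - EuclideanSpace.proj i).smulRight (EuclideanSpace.single i (1 : ℝ))) x := by
  have h1 : HasFDerivAt (fun x : EuclideanSpace ℝ ι => x i)
      (EuclideanSpace.proj i : StrongDual ℝ (EuclideanSpace ℝ ι)) x :=
    (EuclideanSpace.proj i : StrongDual ℝ (EuclideanSpace ℝ ι)).hasFDerivAt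
  exact (hasFDerivAt_id x).add ((hf.hasFDerivAt.sub h1).smul_const _)

/-- The derivative of `straighten` is the identity plus a rank one map along the `i`-th basis
vector, so its determinant is 1 + (∂_i f - 1). -/
theorem det_straighten (i : ι) {f : EuclideanSpace ℝ ι → ℝ} {x : EuclideanSpace ℝ ι} :
    (ContinuousLinearMap.id ℝ (EuclideanSpace ℝ ι) +
      (fderiv ℝ f x - EuclideanSpace.proj i).smulRight (EuclideanSpace.single i (1 : ℝ))).det
      = gradient f x i := by
  have h := LinearMap.transvection.det
    (fderiv ℝ f x - (EuclideanSpace.proj i : StrongDual ℝ (EuclideanSpace ℝ ι))).toLinearMap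
    (EuclideanSpace.single i (1 : ℝ))
  have h2 : gradient f x i = fderiv ℝ f x (EuclideanSpace.single i 1) := by
    rw [← inner_gradient, EuclideanSpace.inner_single_right]
    simp
  rw [h2]
  calc _ = 1 + (fderiv ℝ f x - (EuclideanSpace.proj i : StrongDual ℝ (EuclideanSpace ℝ ι))).toLinearMap
        (EuclideanSpace.single i (1 : ℝ)) := h
    _ = _ := by simp

/-- The splitting of the `i`-th coordinate preserves volume. -/
theorem volume_eq_lintegral_dropCoord (i : ι) {B : Set (EuclideanSpace ℝ ι)}
    (hB : MeasurableSet B) :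
    volume B = ∫⁻ r : ℝ, volume (dropCoord i '' (B ∩ {x | x i = r})) := by
  set e₁ := MeasurableEquiv.piEquivPiSubtypeProd (fun _ : ι => ℝ) (fun j => j ≠ i)
  have he₁ : MeasurePreserving e₁ volume volume := volume_preserving_piEquivPiSubtypeProd _ _
  have : Unique {j // ¬ (j ≠ i)} :=
    ⟨⟨⟨i, by simp⟩⟩, fun j => Subtype.ext (not_not.1 j.2)⟩
  have hdef : ((default : {j // ¬ (j ≠ i)}) : ι) = i := not_not.1 (default : {j // ¬ (j ≠ i)}).2
  set T : EuclideanSpace ℝ ι → EuclideanSpace ℝ {j // j ≠ i} × ℝ := fun x => (dropCoord i x, x i)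
  have hT : MeasurePreserving T volume volume := by
    have h1 := (PiLp.volume_preserving_ofLp ι)
    have h2 := he₁.comp h1
    have h0 : MeasurePreserving (MeasurableEquiv.funUnique {j // ¬ (j ≠ i)} ℝ) volume volume := by
      convert volume_preserving_funUnique {j // ¬ (j ≠ i)} ℝ
    have h3 : MeasurePreserving (Prod.map (WithLp.toLp 2 : ({j // j ≠ i} → ℝ) → _)
        (MeasurableEquiv.funUnique {j // ¬ (j ≠ i)} ℝ)) volume volume :=
      (PiLp.volume_preserving_toLp {j // j ≠ i}).prod h0
    have h4 := h3.comp h2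
    have h5 : T = Prod.map (WithLp.toLp 2 : ({j // j ≠ i} → ℝ) → _)
        (MeasurableEquiv.funUnique {j // ¬ (j ≠ i)} ℝ) ∘ e₁ ∘ WithLp.ofLp := by
      funext x
      refine Prod.ext rfl ?_
      change x i = x ((default : {j // ¬ (j ≠ i)}) : ι)
      rw [hdef]
    rw [h5]
    exact h4
  set S : EuclideanSpace ℝ {j // j ≠ i} × ℝ → EuclideanSpace ℝ ι :=
    fun q => extendZero i q.1 + q.2 • EuclideanSpace.single i 1
  have hST : ∀ x, S (T x) = x := by
    intro x
    simp [S, T, extendZero_dropCoord]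
  have hTS : ∀ q, T (S q) = q := by
    intro q
    refine Prod.ext ?_ ?_
    · ext j
      simp [S, T, extendZero_apply_of_ne i _ j.2, j.2]
    · simp [S, T]
  have hSm : Measurable S := by
    have : Continuous S := by fun_prop
    exact this.measurable
  have hpre : B = T ⁻¹' (S ⁻¹' B) := by
    ext x; simp [hST]
  conv_lhs => rw [hpre]
  rw [hT.measure_preimage (hSm hB).nullMeasurableSet, Measure.volume_eq_prod,
    Measure.prod_apply_symm (hSm hB)]
  refine lintegral_congr fun r => ?_
  congr 1
  ext y
  constructor
  · intro hy
    refine ⟨S (y, r), ⟨hy, by simp [S]⟩, ?_⟩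
    exact congrArg Prod.fst (hTS (y, r))
  · rintro ⟨x, ⟨hx, rfl⟩, rfl⟩
    change S (T x) ∈ B
    rwa [hST]

/-- The coarea formula in an open set where `f` is strictly monotone in the `i`-th coordinate. -/
theorem lintegral_gradient_coord_eq {i : ι} {n : ℕ} (hn : Fintype.card ι = n + 1)
    {f : EuclideanSpace ℝ ι → ℝ} {U : Set (EuclideanSpace ℝ ι)}
    (hfm : Measurable f) (hU : MeasurableSet U)
    (hf : ∀ x ∈ U, ContDiffAt ℝ 1 f x) (hi : ∀ x ∈ U, gradient f x i ≠ 0)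
    (hinj : ∀ x ∈ U, ∀ y ∈ U, dropCoord i x = dropCoord i y → f x = f y → x = y)
    {A : Set (EuclideanSpace ℝ ι)} (hA : MeasurableSet A) (hAU : A ⊆ U) :
    ∫⁻ x in A, ENNReal.ofReal |gradient f x i| =
      ∫⁻ r : ℝ, ∫⁻ x in A ∩ {x | f x = r},
        ENNReal.ofReal (|gradient f x i| / ‖gradient f x‖) ∂μHE[n] := by
  have hinj' : InjOn (straighten i f) A := by
    intro x hx y hy hxy
    refine hinj x (hAU hx) y (hAU hy) ?_ ?_
    · rw [← dropCoord_straighten i f x, hxy, dropCoord_straighten]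
    · rw [← straighten_apply_self i f x, hxy, straighten_apply_self]
  -- The change of variables by `straighten` turns the integral of |∂_i f| into the volume of the
  -- image. The slice of the image at height r projects onto the same set as the level set `f = r`,
  -- where the area formula applies.
  have h1 := lintegral_abs_det_fderiv_eq_addHaar_image volume hA
    (fun x hx => (hasFDerivAt_straighten i
      ((hf x (hAU hx)).differentiableAt one_ne_zero)).hasFDerivWithinAt) hinj'
  simp_rw [det_straighten] at h1
  have hm : MeasurableSet (straighten i f '' A) := by
    refine hA.image_of_continuousOn_injOn (fun x hx => ?_) hinj'
    exact (hasFDerivAt_straighten i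
      ((hf x (hAU hx)).differentiableAt one_ne_zero)).continuousAt.continuousWithinAt
  rw [h1, volume_eq_lintegral_dropCoord i hm]
  refine lintegral_congr fun r => ?_
  have hlev : MeasurableSet {x | f x = r} := hfm (measurableSet_singleton r)
  have h2 := volume_dropCoord_image (i := i) hn (S := U ∩ {x | f x = r}) (f := f)
    (hU.inter hlev)
    (fun x hx y hy => hx.2.trans hy.2.symm) (fun x hx => hf x hx.1) (fun x hx => hi x hx.1)
    (fun x hx y hy h => hinj x hx.1 y hy.1 h (hx.2.trans hy.2.symm)) (A := A ∩ {x | f x = r})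
    (hA.inter hlev) (inter_subset_inter_left _ hAU)
  rw [← h2]
  congr 1
  ext y
  constructor
  · rintro ⟨_, ⟨⟨x, hx, rfl⟩, hr⟩, rfl⟩
    refine ⟨x, ⟨hx, ?_⟩, (dropCoord_straighten i f x).symm⟩
    rwa [mem_ofPred_eq, straighten_apply_self] at hr
  · rintro ⟨x, ⟨hx, hr⟩, rfl⟩
    exact ⟨_, ⟨mem_image_of_mem _ hx, by rwa [mem_ofPred_eq, straighten_apply_self]⟩,
      dropCoord_straighten i f x⟩

end Coarea

section Diagonal

variable {ι : Type*}

/-- The diagonal linear map with entries `c`. -/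
def diagMap (c : ι → ℝ) : EuclideanSpace ℝ ι →L[ℝ] EuclideanSpace ℝ ι :=
  (EuclideanSpace.equiv ι ℝ).symm.toContinuousLinearMap ∘L
    ContinuousLinearMap.pi fun j => c j • EuclideanSpace.proj j

@[simp] theorem diagMap_apply (c : ι → ℝ) (x : EuclideanSpace ℝ ι) (j : ι) :
    diagMap c x j = c j * x j := rfl

variable [Fintype ι]

theorem det_diagMap (c : ι → ℝ) : LinearMap.det (diagMap c).toLinearMap = ∏ j, c j := by
  classical
  have : (diagMap c).toLinearMap = Matrix.toLin (EuclideanSpace.basisFun ι ℝ).toBasis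
      (EuclideanSpace.basisFun ι ℝ).toBasis (Matrix.diagonal c) := by
    refine (EuclideanSpace.basisFun ι ℝ).toBasis.ext fun i => ?_
    rw [Matrix.toLin_self]
    ext j
    simp [Matrix.diagonal_apply]
    grind
  rw [this, LinearMap.det_toLin, Matrix.det_diagonal]

theorem volume_diagMap_image (c : ι → ℝ) (A : Set (EuclideanSpace ℝ ι)) :
    volume (diagMap c '' A) = ENNReal.ofReal |∏ j, c j| * volume A := by
  rw [← det_diagMap]
  exact Measure.addHaar_image_linearMap volume (diagMap c).toLinearMap A

end Diagonal

end

/-! ### Geometry of the pseudo-gauge and of the dilations. -/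

section

open scoped ENNReal NNReal

variable {m k : ℕ}

/-- The square `|z|²`. -/
def zsq (x : Space m k) : ℝ := ∑ i : Fin m, x (Sum.inl i) ^ 2

/-- The square `|t|²`. -/
def tsq (x : Space m k) : ℝ := ∑ j : Fin k, x (Sum.inr j) ^ 2

/-- The power `ρ_α^{2(α+1)}` of the pseudo-gauge. -/
def gauge (α : ℝ) (x : Space m k) : ℝ := zsq x ^ (α + 1) + 4 * (α + 1) ^ 2 * tsq x

/-- The weights of the coordinates under the anisotropic dilations. -/
def weight (α : ℝ) : Fin m ⊕ Fin k → ℝ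
  | Sum.inl _ => 1
  | Sum.inr _ => α + 1

/-- The anisotropic dilation `(z,t) ↦ (r z, r^{α+1} t)`. -/
def dil (α r : ℝ) : Space m k →L[ℝ] Space m k := diagMap fun i => r ^ weight α i

@[simp] theorem dil_apply (α r : ℝ) (x : Space m k) (i : Fin m ⊕ Fin k) :
    dil α r x i = r ^ weight α i * x i := rfl

theorem zsq_nonneg (x : Space m k) : 0 ≤ zsq x := Finset.sum_nonneg fun _ _ => sq_nonneg _

theorem tsq_nonneg (x : Space m k) : 0 ≤ tsq x := Finset.sum_nonneg fun _ _ => sq_nonneg _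

theorem norm_sq_eq (x : Space m k) : ‖x‖ ^ 2 = zsq x + tsq x := by
  rw [EuclideanSpace.norm_sq_eq, Fintype.sum_sum_type]
  simp [zsq, tsq]

theorem normZ_rpow (x : Space m k) (p : ℝ) : normZ x ^ p = zsq x ^ (p / 2) := by
  change Real.sqrt (zsq x) ^ p = _
  rw [Real.sqrt_eq_rpow, ← Real.rpow_mul (zsq_nonneg x)]
  congr 1
  ring

theorem contDiff_zsq {n : WithTop ℕ∞} : ContDiff ℝ n (zsq : Space m k → ℝ) := by
  unfold zsq
  fun_prop

theorem contDiff_tsq {n : WithTop ℕ∞} : ContDiff ℝ n (tsq : Space m k → ℝ) := by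
  unfold tsq
  fun_prop

theorem fderiv_zsq (x v : Space m k) :
    fderiv ℝ zsq x v = ∑ i : Fin m, 2 * x (Sum.inl i) * v (Sum.inl i) := by
  have h : HasFDerivAt (zsq : Space m k → ℝ) (∑ i : Fin m, (2 * x (Sum.inl i)) •
      (EuclideanSpace.proj (Sum.inl i) : StrongDual ℝ (Space m k))) x := by
    refine HasFDerivAt.fun_sum fun i _ => ?_
    have := ((EuclideanSpace.proj (Sum.inl i) : StrongDual ℝ (Space m k)).hasFDerivAt (x := x)).pow 2
    simpa using this
  rw [h.fderiv]
  simp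

theorem fderiv_tsq (x v : Space m k) :
    fderiv ℝ tsq x v = ∑ j : Fin k, 2 * x (Sum.inr j) * v (Sum.inr j) := by
  have h : HasFDerivAt (tsq : Space m k → ℝ) (∑ i : Fin k, (2 * x (Sum.inr i)) •
      (EuclideanSpace.proj (Sum.inr i) : StrongDual ℝ (Space m k))) x := by
    refine HasFDerivAt.fun_sum fun i _ => ?_
    have := ((EuclideanSpace.proj (Sum.inr i) : StrongDual ℝ (Space m k)).hasFDerivAt (x := x)).pow 2
    simpa using this
  rw [h.fderiv]
  simp

theorem zsq_dil (α : ℝ) {r : ℝ} (x : Space m k) : zsq (dil α r x) = r ^ 2 * zsq x := by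
  simp [zsq, weight, mul_pow, Finset.mul_sum]

theorem tsq_dil (α : ℝ) {r : ℝ} (hr : 0 ≤ r) (x : Space m k) :
    tsq (dil α r x) = r ^ (2 * (α + 1)) * tsq x := by
  rw [mul_comm 2, Real.rpow_mul hr]
  simp [tsq, weight, mul_pow, Finset.mul_sum]

section Gauge

variable {α : ℝ}

theorem rho_eq (x : Space m k) : rho α x = gauge α x ^ (1 / (2 * (α + 1))) := by
  have h : normT x ^ 2 = tsq x := Real.sq_sqrt (tsq_nonneg x)
  rw [rho, normZ_rpow, gauge, h]
  congr 3
  ring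

theorem gauge_dil {r : ℝ} (hr : 0 ≤ r) (x : Space m k) :
    gauge α (dil α r x) = r ^ (2 * (α + 1)) * gauge α x := by
  unfold gauge
  rw [zsq_dil, tsq_dil α hr, Real.mul_rpow (by positivity) (zsq_nonneg x), Real.rpow_mul hr,
    Real.rpow_two]
  ring

theorem zsq_pos_of_ne {x : Space m k} {i : Fin m} (hx : x (Sum.inl i) ≠ 0) : 0 < zsq x := by
  have h1 : x (Sum.inl i) ^ 2 ≤ zsq x :=
    Finset.single_le_sum (f := fun i : Fin m => x (Sum.inl i) ^ 2) (fun _ _ => sq_nonneg _)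
      (Finset.mem_univ i)
  have h2 : 0 < x (Sum.inl i) ^ 2 := by positivity
  linarith

theorem exists_coord_ne_zero {x : Space m k} (hx : x ≠ 0) : ∃ i, x i ≠ 0 := by
  by_contra! h
  exact hx (by ext i; simpa using h i)

theorem dil_dil {a b : ℝ} (ha : 0 ≤ a) (hb : 0 ≤ b) (x : Space m k) :
    dil α a (dil α b x) = dil α (a * b) x := by
  ext i
  simp [Real.mul_rpow ha hb, mul_assoc]

theorem dil_one (x : Space m k) : dil α 1 x = x := by
  ext i
  simp

variable (hα : 0 < α)
include hα

theorem gauge_nonneg (x : Space m k) : 0 ≤ gauge α x := by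
  have := zsq_nonneg x
  have := tsq_nonneg x
  unfold gauge
  positivity

theorem rho_nonneg (x : Space m k) : 0 ≤ rho α x := by
  rw [rho_eq]
  exact Real.rpow_nonneg (gauge_nonneg hα x) _

theorem rho_rpow (x : Space m k) : rho α x ^ (2 * (α + 1)) = gauge α x := by
  rw [rho_eq, ← Real.rpow_mul (gauge_nonneg hα x), one_div, inv_mul_cancel₀ (by positivity),
    Real.rpow_one]

theorem rho_dil {r : ℝ} (hr : 0 ≤ r) (x : Space m k) : rho α (dil α r x) = r * rho α x := by
  rw [rho_eq, gauge_dil hr, Real.mul_rpow (by positivity) (gauge_nonneg hα x),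
    ← Real.rpow_mul hr, mul_one_div_cancel (by positivity), Real.rpow_one, rho_eq]

theorem contDiff_gauge : ContDiff ℝ 1 (gauge α : Space m k → ℝ) := by
  refine ContDiff.add ?_ (contDiff_const.mul contDiff_tsq)
  exact contDiff_zsq.rpow_const_of_le (by norm_num; linarith)

theorem fderiv_gauge (x v : Space m k) :
    fderiv ℝ (gauge α) x v = (α + 1) * zsq x ^ α * fderiv ℝ zsq x v
      + 4 * (α + 1) ^ 2 * fderiv ℝ tsq x v := by
  have h1 : HasFDerivAt (zsq : Space m k → ℝ) (fderiv ℝ zsq x) x :=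
    (contDiff_zsq.differentiable one_ne_zero x).hasFDerivAt
  have h2 : HasFDerivAt (tsq : Space m k → ℝ) (fderiv ℝ tsq x) x :=
    (contDiff_tsq.differentiable one_ne_zero x).hasFDerivAt
  have h := (h1.rpow_const (p := α + 1) (Or.inr (by linarith))).add (h2.const_mul (4 * (α + 1) ^ 2))
  have h3 : HasFDerivAt (gauge α : Space m k → ℝ) _ x := h
  rw [h3.fderiv]
  simp

theorem continuous_gauge : Continuous (gauge α : Space m k → ℝ) := (contDiff_gauge hα).continuous

theorem continuous_rho : Continuous (rho α : Space m k → ℝ) := by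
  have : (rho α : Space m k → ℝ) = fun x => gauge α x ^ (1 / (2 * (α + 1))) := funext rho_eq
  rw [this]
  exact (continuous_gauge hα).rpow_const fun x => Or.inr (by positivity)

theorem gauge_eq_zero {x : Space m k} : gauge α x = 0 ↔ x = 0 := by
  constructor
  · intro h
    have h1 := Real.rpow_nonneg (zsq_nonneg x) (α + 1)
    have h2 : 0 ≤ 4 * (α + 1) ^ 2 * tsq x := by have := tsq_nonneg x; positivity
    unfold gauge at h
    have h3 : zsq x ^ (α + 1) = 0 := by linarith
    have h4 : 4 * (α + 1) ^ 2 * tsq x = 0 := by linarith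
    rw [Real.rpow_eq_zero (zsq_nonneg x) (by positivity)] at h3
    have h5 : tsq x = 0 := by
      rcases mul_eq_zero.1 h4 with h | h
      · have : 0 < 4 * (α + 1) ^ 2 := by positivity
        linarith
      · exact h
    have := norm_sq_eq x
    rw [h3, h5, add_zero] at this
    simpa using this
  · rintro rfl
    simp [gauge, zsq, tsq, Real.zero_rpow (by linarith : α + 1 ≠ 0)]

theorem gauge_pos {x : Space m k} (hx : x ≠ 0) : 0 < gauge α x :=
  lt_of_le_of_ne (gauge_nonneg hα x) fun h => hx ((gauge_eq_zero hα).1 h.symm)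

theorem rho_pos {x : Space m k} (hx : x ≠ 0) : 0 < rho α x := by
  rw [rho_eq]
  exact Real.rpow_pos_of_pos (gauge_pos hα hx) _

theorem rho_zero : rho α (0 : Space m k) = 0 := by
  rw [rho_eq, (gauge_eq_zero hα).2 rfl, Real.zero_rpow (by positivity)]

theorem contDiffAt_rho {x : Space m k} (hx : x ≠ 0) : ContDiffAt ℝ 1 (rho α) x := by
  have : (rho α : Space m k → ℝ) = fun x => gauge α x ^ (1 / (2 * (α + 1))) := funext rho_eq
  rw [this]
  exact (contDiff_gauge hα).contDiffAt.rpow_const_of_ne (gauge_pos hα hx).ne'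

theorem fderiv_rho {x : Space m k} (hx : x ≠ 0) (v : Space m k) :
    fderiv ℝ (rho α) x v = rho α x ^ (-(2 * α + 1)) *
      (zsq x ^ α * ∑ i : Fin m, x (Sum.inl i) * v (Sum.inl i)
        + 4 * (α + 1) * ∑ j : Fin k, x (Sum.inr j) * v (Sum.inr j)) := by
  have h0 : (rho α : Space m k → ℝ) = fun x => gauge α x ^ (1 / (2 * (α + 1))) := funext rho_eq
  have h1 : HasFDerivAt (gauge α : Space m k → ℝ) (fderiv ℝ (gauge α) x) x :=
    ((contDiff_gauge hα).differentiable one_ne_zero x).hasFDerivAt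
  have h2 := h1.rpow_const (p := 1 / (2 * (α + 1))) (Or.inl (gauge_pos hα hx).ne')
  rw [← h0] at h2
  have h3 : gauge α x ^ (1 / (2 * (α + 1)) - 1) = rho α x ^ (-(2 * α + 1)) := by
    rw [← rho_rpow hα x, ← Real.rpow_mul (rho_nonneg hα x)]
    congr 1
    field_simp
    ring
  rw [h2.fderiv]
  simp only [_root_.smul_apply, smul_eq_mul]
  rw [h3, fderiv_gauge hα, fderiv_zsq, fderiv_tsq]
  simp only [mul_assoc, ← Finset.mul_sum]
  field_simp

theorem gradient_rho_inl {x : Space m k} (hx : x ≠ 0) (i : Fin m) :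
    gradient (rho α) x (Sum.inl i) = rho α x ^ (-(2 * α + 1)) * (zsq x ^ α * x (Sum.inl i)) := by
  have := inner_gradient (rho α) x (EuclideanSpace.single (Sum.inl i) 1)
  rw [EuclideanSpace.inner_single_right, fderiv_rho hα hx] at this
  simpa [Pi.single_apply] using this

theorem gradient_rho_inr {x : Space m k} (hx : x ≠ 0) (j : Fin k) :
    gradient (rho α) x (Sum.inr j) = rho α x ^ (-(2 * α + 1)) * (4 * (α + 1) * x (Sum.inr j)) := by
  have := inner_gradient (rho α) x (EuclideanSpace.single (Sum.inr j) 1)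
  rw [EuclideanSpace.inner_single_right, fderiv_rho hα hx] at this
  simpa [Pi.single_apply] using this

/-- Any nonvanishing coordinate is transverse to the pseudo-spheres. The half spaces where one
coordinate has a fixed sign therefore serve as graph charts and cover the complement of the origin.
-/
theorem gradient_rho_coord_ne_zero {x : Space m k} {i : Fin m ⊕ Fin k} (hx : x i ≠ 0) :
    gradient (rho α) x i ≠ 0 := by
  have hx0 : x ≠ 0 := by rintro rfl; simp at hx
  have hρ := Real.rpow_pos_of_pos (rho_pos hα hx0) (-(2 * α + 1))
  cases i with
  | inl i =>
    rw [gradient_rho_inl hα hx0]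
    have := Real.rpow_pos_of_pos (zsq_pos_of_ne hx) α
    positivity
  | inr j =>
    rw [gradient_rho_inr hα hx0]
    positivity

theorem dil_ne_zero {r : ℝ} (hr : 0 < r) {x : Space m k} (hx : x ≠ 0) : dil α r x ≠ 0 := by
  intro h
  have := rho_dil hα hr.le x
  rw [h, rho_zero hα] at this
  have := mul_pos hr (rho_pos hα hx)
  linarith

/-- Since ρ is homogeneous of degree 1, its derivative in a coordinate of weight w is homogeneous of
degree 1 - w. -/
theorem gradient_rho_dil {r : ℝ} (hr : 0 < r) {x : Space m k} (hx : x ≠ 0) (i : Fin m ⊕ Fin k) :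
    gradient (rho α) (dil α r x) i = r ^ (1 - weight α i) * gradient (rho α) x i := by
  have hx' := dil_ne_zero hα hr hx
  have h1 : (r * rho α x) ^ (-(2 * α + 1)) = r ^ (-(2 * α + 1)) * rho α x ^ (-(2 * α + 1)) :=
    Real.mul_rpow hr.le (rho_nonneg hα x)
  cases i with
  | inl i =>
    rw [gradient_rho_inl hα hx', gradient_rho_inl hα hx, rho_dil hα hr.le, zsq_dil, h1,
      Real.mul_rpow (by positivity) (zsq_nonneg x), ← Real.rpow_natCast, ← Real.rpow_mul hr.le]
    have h2 : r ^ (-(2 * α + 1)) * r ^ (((2 : ℕ) : ℝ) * α) * r = 1 := by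
      rw [← Real.rpow_add hr, ← Real.rpow_add_one hr.ne']
      convert Real.rpow_zero r using 2
      push_cast
      ring
    simp only [dil_apply, weight, Real.rpow_one, sub_self, Real.rpow_zero, one_mul]
    linear_combination (rho α x ^ (-(2 * α + 1)) * (zsq x ^ α * x (Sum.inl i))) * h2
  | inr j =>
    rw [gradient_rho_inr hα hx', gradient_rho_inr hα hx, rho_dil hα hr.le, h1]
    have h2 : r ^ (-(2 * α + 1)) * r ^ (α + 1) = r ^ (1 - (α + 1)) := by
      rw [← Real.rpow_add hr]
      congr 1
      ring
    simp only [dil_apply, weight]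
    linear_combination (rho α x ^ (-(2 * α + 1)) * (4 * (α + 1) * x (Sum.inr j))) * h2

/-- Up to the common factor ρ^{-2(2α+1)} |z|^{2α}, the squares of the z-derivatives sum to
|z|^{2(α+1)} and those of the t-derivatives to 4(α+1)²|t|². Together they form ρ^{2(α+1)}. -/
theorem psi_eq {x : Space m k} (hx : x ≠ 0) : psi α x = zsq x ^ α * rho α x ^ (-(2 * α)) := by
  have hρ := rho_pos hα hx
  have h1 : psi α x = (rho α x ^ (-(2 * α + 1))) ^ 2 * zsq x ^ α * gauge α x := by
    have h0 : normZ x ^ α / 2 = zsq x ^ (α / 2) / 2 := by rw [normZ_rpow]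
    have h2 : (zsq x ^ (α / 2)) ^ 2 = zsq x ^ α := by
      rw [← Real.rpow_natCast, ← Real.rpow_mul (zsq_nonneg x)]
      congr 1
      push_cast
      ring
    have h3 : zsq x ^ (α + 1) = zsq x ^ α * zsq x :=
      Real.rpow_add_one' (zsq_nonneg x) (by positivity)
    rw [psi, Fintype.sum_sum_type]
    simp only [X, fderiv_rho hα hx, h0, gauge, h3]
    have h4 : ∀ j : Fin k, (rho α x ^ (-(2 * α + 1)) * (4 * (α + 1) *
        (x (Sum.inr j) * (zsq x ^ (α / 2) / 2)))) ^ 2 = (rho α x ^ (-(2 * α + 1))) ^ 2 *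
        (4 * (α + 1) ^ 2) * zsq x ^ α * x (Sum.inr j) ^ 2 := by
      intro j
      rw [← h2]
      ring
    have h5 : ∀ i : Fin m, (rho α x ^ (-(2 * α + 1)) * (zsq x ^ α * x (Sum.inl i))) ^ 2 =
        (rho α x ^ (-(2 * α + 1))) ^ 2 * (zsq x ^ α) ^ 2 * x (Sum.inl i) ^ 2 := by
      intro i
      ring
    generalize rho α x ^ (-(2 * α + 1)) = c at h4 h5 ⊢
    simp only [PiLp.smul_apply, PiLp.single_apply, smul_eq_mul, reduceCtorEq, if_false, mul_zero,
      Finset.sum_const_zero, mul_ite, mul_one, Finset.sum_ite_eq', Finset.mem_univ, if_true,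
      Sum.inl.injEq, Sum.inr.injEq, add_zero, zero_add, h4, h5, ← Finset.mul_sum]
    change _ * zsq x + _ * tsq x = _
    ring
  rw [h1, ← rho_rpow hα x, ← Real.rpow_natCast, ← Real.rpow_mul hρ.le, mul_right_comm,
    ← Real.rpow_add hρ, mul_comm]
  congr 2
  push_cast
  ring

theorem psi_dil {r : ℝ} (hr : 0 < r) {x : Space m k} (hx : x ≠ 0) :
    psi α (dil α r x) = psi α x := by
  rw [psi_eq hα hx, psi_eq hα (dil_ne_zero hα hr hx), zsq_dil, rho_dil hα hr.le,
    Real.mul_rpow (by positivity) (zsq_nonneg x), Real.mul_rpow hr.le (rho_nonneg hα x),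
    ← Real.rpow_natCast, ← Real.rpow_mul hr.le]
  have : r ^ (((2 : ℕ) : ℝ) * α) * r ^ (-(2 * α)) = 1 := by
    rw [← Real.rpow_add hr]
    convert Real.rpow_zero r using 2
    push_cast
    ring
  linear_combination (zsq x ^ α * rho α x ^ (-(2 * α))) * this

theorem isOpen_ball (r : ℝ) : IsOpen (ball α r : Set (Space m k)) :=
  isOpen_lt (continuous_rho hα) continuous_const

theorem isCompact_rho_le (r : ℝ) : IsCompact {x : Space m k | rho α x ≤ r} := by
  refine Metric.isCompact_of_isClosed_isBounded
    (isClosed_le (continuous_rho hα) continuous_const) ?_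
  have hb : ∀ x ∈ {x : Space m k | rho α x ≤ r},
      ‖x‖ ≤ Real.sqrt ((r ^ (2 * (α + 1))) ^ (α + 1)⁻¹ + r ^ (2 * (α + 1))) := by
    intro x hx
    refine Real.le_sqrt_of_sq_le ?_
    have hx : rho α x ≤ r := hx
    have h1 : gauge α x ≤ r ^ (2 * (α + 1)) := by
      rw [← rho_rpow hα x]
      exact Real.rpow_le_rpow (rho_nonneg hα x) hx (by positivity)
    have h2 := Real.rpow_nonneg (zsq_nonneg x) (α + 1)
    have h3 := tsq_nonneg x
    have h5 : 1 * tsq x ≤ 4 * (α + 1) ^ 2 * tsq x :=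
      mul_le_mul_of_nonneg_right (by nlinarith) h3
    unfold gauge at h1
    have h4 : zsq x ≤ (r ^ (2 * (α + 1))) ^ (α + 1)⁻¹ := by
      calc zsq x = (zsq x ^ (α + 1)) ^ (α + 1)⁻¹ := by
            rw [← Real.rpow_mul (zsq_nonneg x), mul_inv_cancel₀ (by positivity), Real.rpow_one]
        _ ≤ _ := Real.rpow_le_rpow h2 (by linarith) (by positivity)
    rw [norm_sq_eq]
    linarith
  exact isBounded_iff_forall_norm_le.2 ⟨_, hb⟩

theorem sphere_eq {r : ℝ} (hr : 0 < r) : (sphere α r : Set (Space m k)) = {x | rho α x = r} := by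
  apply Subset.antisymm
  · exact frontier_lt_subset_eq (continuous_rho hα) continuous_const
  · intro x hx
    have hx : rho α x = r := hx
    rw [sphere, (isOpen_ball hα r).frontier_eq]
    refine ⟨?_, fun h => ?_⟩
    -- A point with ρ = r is the limit of its dilates by s < 1, which lie in the open pseudo-ball.
    · have hc : ContinuousAt (fun s : ℝ => dil α s x) 1 := by
        have : ∀ i, ContinuousAt (fun s : ℝ => dil α s x i) 1 := by
          intro i
          simp only [dil_apply]
          exact (Real.continuousAt_rpow_const _ _ (Or.inl one_ne_zero)).mul continuousAt_const
        exact ((PiLp.continuous_toLp 2 _).continuousAt).comp (continuousAt_pi.2 this)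
      have h1 : Tendsto (fun s : ℝ => dil α s x) (𝓝[<] 1) (𝓝 x) := by
        have := hc.tendsto.mono_left (nhdsWithin_le_nhds (s := Iio 1))
        rwa [dil_one] at this
      refine mem_closure_of_tendsto h1 ?_
      filter_upwards [Ioo_mem_nhdsLT (zero_lt_one (α := ℝ))] with s hs
      change rho α _ < r
      rw [rho_dil hα hs.1.le, hx]
      nlinarith [hs.2]
    · have h : rho α x < r := h
      linarith

/-- On a half space `{±x_i > 0}` a point is determined by `ρ_α` and its other coordinates. -/
theorem eq_of_dropCoord_eq_of_rho_eq {i : Fin m ⊕ Fin k} {x y : Space m k}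
    (hxy : 0 < x i * y i) (h : dropCoord i x = dropCoord i y) (hρ : rho α x = rho α y) : x = y := by
  have hj : ∀ j, j ≠ i → x j = y j := by
    intro j hj
    have := congrArg (fun v => v ⟨j, hj⟩) h
    simpa using this
  -- Equality of the gauges leaves only the square of the `i`-th coordinate undetermined, and the
  -- sign condition then fixes the coordinate.
  have hG : gauge α x = gauge α y := by rw [← rho_rpow hα, hρ, rho_rpow hα]
  have hsq : x i ^ 2 = y i ^ 2 := by
    unfold gauge at hG
    cases i with
    | inl i =>
      have ht : tsq x = tsq y := Finset.sum_congr rfl fun j _ => by rw [hj _ (by simp)]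
      rw [ht] at hG
      have hz : zsq x = zsq y := by
        have h1 : zsq x ^ (α + 1) = zsq y ^ (α + 1) := by linarith
        exact (Real.rpow_left_inj (zsq_nonneg x) (zsq_nonneg y) (by positivity)).1 h1
      unfold zsq at hz
      rw [← Finset.add_sum_erase _ _ (Finset.mem_univ i),
        ← Finset.add_sum_erase (a := i) _ _ (Finset.mem_univ i)] at hz
      have h2 : ∑ l ∈ Finset.univ.erase i, x (Sum.inl l) ^ 2 =
          ∑ l ∈ Finset.univ.erase i, y (Sum.inl l) ^ 2 :=
        Finset.sum_congr rfl fun l hl => by rw [hj _ (by simpa using (Finset.ne_of_mem_erase hl))]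
      linarith
    | inr i =>
      have hz : zsq x = zsq y := Finset.sum_congr rfl fun j _ => by rw [hj _ (by simp)]
      rw [hz] at hG
      have ht : tsq x = tsq y := by
        have h1 : 4 * (α + 1) ^ 2 * (tsq x - tsq y) = 0 := by linarith
        rcases mul_eq_zero.1 h1 with h | h
        · have : 0 < 4 * (α + 1) ^ 2 := by positivity
          linarith
        · linarith
      unfold tsq at ht
      rw [← Finset.add_sum_erase _ _ (Finset.mem_univ i),
        ← Finset.add_sum_erase (a := i) _ _ (Finset.mem_univ i)] at ht
      have h2 : ∑ l ∈ Finset.univ.erase i, x (Sum.inr l) ^ 2 =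
          ∑ l ∈ Finset.univ.erase i, y (Sum.inr l) ^ 2 :=
        Finset.sum_congr rfl fun l hl => by rw [hj _ (by simpa using (Finset.ne_of_mem_erase hl))]
      linarith
  have hi : x i = y i := by
    rcases sq_eq_sq_iff_eq_or_eq_neg.1 hsq with h | h
    · exact h
    · rw [h] at hxy
      nlinarith [sq_nonneg (y i)]
  ext j
  by_cases h : j = i
  · rw [h, hi]
  · exact hj j h

end Gauge

end

/-! ### The surface measure on pseudo-spheres, its scaling, and polar coordinates. -/

section

open scoped ENNReal NNReal

/-- A positive finite density can be divided out. It is used with the density |∂_i ρ| on a half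
space, where only the weighted measure is directly computable, as the volume of a projection. -/
theorem measure_eq_of_setLIntegral_eq {E : Type*} [MeasurableSpace E] {μ ν : Measure E} {U : Set E}
    {h : E → ℝ≥0∞} (hU : MeasurableSet U) (hm : Measurable h) (h0 : ∀ x ∈ U, h x ≠ 0)
    (ht : ∀ x, h x ≠ ⊤)
    (heq : ∀ A ⊆ U, MeasurableSet A → ∫⁻ x in A, h x ∂μ = ∫⁻ x in A, h x ∂ν)
    {A : Set E} (hA : MeasurableSet A) (hAU : A ⊆ U) : μ A = ν A := by
  have hD : (μ.restrict U).withDensity h = (ν.restrict U).withDensity h := by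
    ext B hB
    rw [withDensity_apply _ hB, withDensity_apply _ hB, Measure.restrict_restrict hB,
      Measure.restrict_restrict hB]
    exact heq _ inter_subset_right (hB.inter hU)
  have key : ∀ κ : Measure E, κ A = ∫⁻ x in A, (h x)⁻¹ ∂((κ.restrict U).withDensity h) := by
    intro κ
    change _ = ∫⁻ x in A, h⁻¹ x ∂_
    rw [← lintegral_indicator hA, lintegral_withDensity_eq_lintegral_mul _ hm
      (hm.inv.indicator hA)]
    have h1 : ∀ x ∈ U, (h * A.indicator (h⁻¹)) x = A.indicator 1 x := by
      intro x hx
      by_cases hxA : x ∈ A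
      · simp [hxA, ENNReal.mul_inv_cancel (h0 x hx) (ht x)]
      · simp [hxA]
    rw [setLIntegral_congr_fun hU h1, lintegral_indicator_one hA, Measure.restrict_apply hA,
      inter_eq_left.2 hAU]
  rw [key μ, key ν, hD]

variable {m k : ℕ} {α : ℝ}

/-- The measure `|∇ρ_α|⁻¹ dH_{N-1}` on the pseudo-sphere `S_r`. -/
def leray (α r : ℝ) : Measure (Space m k) :=
  (μHE[m + k - 1].restrict (sphere α r)).withDensity
    fun x => ENNReal.ofReal ‖gradient (rho α) x‖⁻¹

/-- The half space `{s x_i > 0}`. -/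
def halfSpace (i : Fin m ⊕ Fin k) (s : ℝ) : Set (Space m k) := {x | 0 < s * x i}

theorem isOpen_halfSpace (i : Fin m ⊕ Fin k) (s : ℝ) : IsOpen (halfSpace i s) :=
  isOpen_lt continuous_const (by fun_prop)

theorem coord_ne_zero_of_mem_halfSpace {i : Fin m ⊕ Fin k} {s : ℝ} {x : Space m k}
    (hx : x ∈ halfSpace i s) : x i ≠ 0 := by
  intro h
  have hx : 0 < s * x i := hx
  simp [h] at hx

theorem ne_zero_of_mem_halfSpace {i : Fin m ⊕ Fin k} {s : ℝ} {x : Space m k}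
    (hx : x ∈ halfSpace i s) : x ≠ 0 := by
  rintro rfl
  exact coord_ne_zero_of_mem_halfSpace hx rfl

theorem mul_pos_of_mem_halfSpace {i : Fin m ⊕ Fin k} {s : ℝ} {x y : Space m k}
    (hx : x ∈ halfSpace i s) (hy : y ∈ halfSpace i s) : 0 < x i * y i := by
  have h : 0 < (s * x i) * (s * y i) := mul_pos hx hy
  have h1 : (s * x i) * (s * y i) = s ^ 2 * (x i * y i) := by ring
  rw [h1] at h
  exact pos_of_mul_pos_right h (sq_nonneg s)

theorem mem_halfSpace_self {i : Fin m ⊕ Fin k} {x : Space m k} (hx : x i ≠ 0) :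
    x ∈ halfSpace i (x i) := mul_self_pos.2 hx

theorem measurable_gradient_coord (f : Space m k → ℝ) (i : Fin m ⊕ Fin k) :
    Measurable fun x => gradient f x i := by
  have : (fun x => gradient f x i) = fun x => fderiv ℝ f x (EuclideanSpace.single i 1) := by
    funext x
    rw [← inner_gradient, EuclideanSpace.inner_single_right]
    simp
  rw [this]
  exact measurable_fderiv_apply_const ℝ f _

theorem measurable_norm_gradient (f : Space m k → ℝ) : Measurable fun x => ‖gradient f x‖ := by
  have : (fun x => ‖gradient f x‖) = fun x => ‖fderiv ℝ f x‖ := by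
    funext x
    simp [gradient]
  rw [this]
  exact (measurable_fderiv ℝ f).norm

theorem lintegral_leray (r : ℝ) {f : Space m k → ℝ≥0∞} (hf : Measurable f) :
    ∫⁻ x, f x ∂(leray α r) =
      ∫⁻ x in sphere α r, ENNReal.ofReal ‖gradient (rho α) x‖⁻¹ * f x ∂μHE[m + k - 1] :=
  lintegral_withDensity_eq_lintegral_mul _
    (measurable_norm_gradient (rho α)).inv.ennreal_ofReal hf

theorem sum_weight (α : ℝ) : ∑ i : Fin m ⊕ Fin k, weight α i = homDim m k α := by
  simp [Fintype.sum_sum_type, weight, homDim]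
  ring

theorem prod_rpow_weight {r : ℝ} (hr : 0 < r) :
    ∏ i : Fin m ⊕ Fin k, r ^ weight α i = r ^ homDim m k α := by
  rw [← Real.rpow_sum_of_pos hr, sum_weight]

theorem prod_rpow_weight_ne {r : ℝ} (hr : 0 < r) (i : Fin m ⊕ Fin k) :
    ∏ j : {j // j ≠ i}, r ^ weight α (j : Fin m ⊕ Fin k) = r ^ (homDim m k α - weight α i) := by
  rw [← Real.rpow_sum_of_pos hr, ← sum_weight, sum_eq_add_sum_ne i (weight α)]
  congr 1
  ring

theorem measurable_rho (hα : 0 < α) : Measurable (rho α : Space m k → ℝ) :=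
  (continuous_rho hα).measurable

theorem measurableSet_rho_eq (hα : 0 < α) (r : ℝ) : MeasurableSet {x : Space m k | rho α x = r} :=
  measurable_rho hα (measurableSet_singleton r)

theorem dil_inv_dil {r : ℝ} (hr : 0 < r) (x : Space m k) : dil α r⁻¹ (dil α r x) = x := by
  rw [dil_dil (inv_nonneg.2 hr.le) hr.le, inv_mul_cancel₀ hr.ne', dil_one]

theorem dil_dil_inv {r : ℝ} (hr : 0 < r) (x : Space m k) : dil α r (dil α r⁻¹ x) = x := by
  rw [dil_dil hr.le (inv_nonneg.2 hr.le), mul_inv_cancel₀ hr.ne', dil_one]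

theorem dil_mem_halfSpace {r : ℝ} (hr : 0 < r) {i : Fin m ⊕ Fin k} {s : ℝ} {x : Space m k} :
    dil α r x ∈ halfSpace i s ↔ x ∈ halfSpace i s := by
  have h : 0 < r ^ weight α i := Real.rpow_pos_of_pos hr _
  change 0 < s * (r ^ weight α i * x i) ↔ 0 < s * x i
  rw [mul_left_comm, mul_pos_iff_of_pos_left h]

theorem leray_compl_sphere {r : ℝ} : leray α r (sphere α r : Set (Space m k))ᶜ = 0 := by
  have hs : MeasurableSet (sphere α r : Set (Space m k)) := isClosed_frontier.measurableSet
  rw [leray, withDensity_apply _ hs.compl, Measure.restrict_restrict hs.compl]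
  simp

theorem setLIntegral_leray_eq {r : ℝ} {A : Set (Space m k)} (hA : MeasurableSet A)
    (i : Fin m ⊕ Fin k) :
    ∫⁻ x in A, ENNReal.ofReal |gradient (rho α) x i| ∂(leray α r) =
      ∫⁻ x in A ∩ sphere α r, ENNReal.ofReal (|gradient (rho α) x i| / ‖gradient (rho α) x‖)
        ∂μHE[m + k - 1] := by
  have hmeas : Measurable fun x : Space m k => ENNReal.ofReal |gradient (rho α) x i| :=
    (measurable_norm.comp (measurable_gradient_coord (rho α) i)).ennreal_ofReal
  rw [← lintegral_indicator hA, lintegral_leray r (hmeas.indicator hA),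
    ← Measure.restrict_restrict hA, ← lintegral_indicator hA]
  refine lintegral_congr fun x => ?_
  by_cases hx : x ∈ A
  · simp only [indicator_of_mem hx]
    rw [← ENNReal.ofReal_mul (by positivity), div_eq_inv_mul]
  · simp [indicator_of_notMem hx]

/-- Every nonzero point has a nonzero coordinate and hence an open half space around it, so the
local comparison applies away from the origin. -/
theorem measure_ext_halfSpace {μ ν : Measure (Space m k)} (hμ : μ {0} = 0) (hν : ν {0} = 0)
    (h : ∀ i s, ∀ A ⊆ halfSpace i s, MeasurableSet A → μ A = ν A) : μ = ν := by
  ext A hA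
  have key : ∀ {μ ν : Measure (Space m k)}, μ {0} = 0 →
      (∀ i s, ∀ A ⊆ halfSpace i s, MeasurableSet A → μ A = ν A) → μ A ≤ ν A := by
    intro μ ν hμ h
    have h1 : μ (A \ {0}) ≤ ν (A \ {0}) := by
      refine measure_le_of_locally_le (S := {0}ᶜ) (fun p hp => ?_)
        (hA.diff (measurableSet_singleton 0)) fun x hx => hx.2
      obtain ⟨i, hi⟩ := exists_coord_ne_zero hp
      exact ⟨halfSpace i (p i), (isOpen_halfSpace i (p i)).mem_nhds (mem_halfSpace_self hi),
        fun B hB hBm => (h i _ B (hB.trans inter_subset_right) hBm).le⟩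
    calc μ A ≤ μ (A \ {0}) + μ {0} := by
          rw [← measure_union_add_inter (A \ {0}) (measurableSet_singleton (0 : Space m k))]
          exact (measure_mono (by simp)).trans le_self_add
      _ ≤ ν (A \ {0}) := by rw [hμ, add_zero]; exact h1
      _ ≤ ν A := measure_mono sdiff_subset
  exact le_antisymm (key hμ h) (key hν fun i s A h1 h2 => (h i s A h1 h2).symm)

theorem measurable_dil : Measurable fun q : ℝ × Space m k => dil α q.1 q.2 := by
  have : ∀ i, Measurable fun q : ℝ × Space m k => dil α q.1 q.2 i := by
    intro i
    simp only [dil_apply]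
    have h1 : Measurable fun q : ℝ × Space m k => q.2 i :=
      (by fun_prop : Continuous fun q : ℝ × Space m k => q.2 i).measurable
    exact (measurable_fst.pow_const _).mul h1
  exact (PiLp.continuous_toLp 2 _).measurable.comp (measurable_pi_lambda _ this)

variable (hα : 0 < α)
include hα

theorem ne_zero_of_mem_sphere {r : ℝ} (hr : 0 < r) {x : Space m k} (hx : x ∈ sphere α r) :
    x ≠ 0 := by
  rintro rfl
  rw [sphere_eq hα hr, mem_ofPred_eq, rho_zero hα] at hx
  exact hr.ne hx

theorem leray_zero {r : ℝ} (hr : 0 < r) : leray α r ({0} : Set (Space m k)) = 0 :=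
  measure_mono_null (fun _ hx h => ne_zero_of_mem_sphere hα hr h hx) leray_compl_sphere

/-- In a half space, `|∂_i ρ_α|` times the surface measure is the measure of the projection. -/
theorem setLIntegral_leray_gradient_coord (hm : 0 < m) {r : ℝ} (hr : 0 < r)
    {i : Fin m ⊕ Fin k} {s : ℝ} {A : Set (Space m k)} (hA : MeasurableSet A)
    (hAU : A ⊆ halfSpace i s) :
    ∫⁻ x in A, ENNReal.ofReal |gradient (rho α) x i| ∂(leray α r) =
      volume (dropCoord i '' (A ∩ {x | rho α x = r})) := by
  have hS := measurableSet_rho_eq (m := m) (k := k) hα r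
  rw [volume_dropCoord_image (i := i) (n := m + k - 1) (f := rho α)
    (S := halfSpace i s ∩ {x | rho α x = r}) (by simp; omega)
    ((isOpen_halfSpace i s).measurableSet.inter hS)
    (fun x hx y hy => hx.2.trans hy.2.symm)
    (fun x hx => contDiffAt_rho hα (ne_zero_of_mem_halfSpace hx.1))
    (fun x hx => gradient_rho_coord_ne_zero hα (coord_ne_zero_of_mem_halfSpace hx.1))
    (fun x hx y hy h => eq_of_dropCoord_eq_of_rho_eq hα (mul_pos_of_mem_halfSpace hx.1 hy.1) h
      (hx.2.trans hy.2.symm))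
    (hA.inter hS) (inter_subset_inter_left _ hAU), setLIntegral_leray_eq hA, sphere_eq hα hr]

/-- The pseudo-sphere is compact. Near each of its points some |∂_i ρ| is bounded below, and the
measure weighted by it is the volume of a bounded projection. -/
theorem isFiniteMeasure_leray (hm : 0 < m) {r : ℝ} (hr : 0 < r) :
    IsFiniteMeasure (leray α r : Measure (Space m k)) := by
  have hc : IsCompact (sphere α r : Set (Space m k)) := by
    rw [sphere_eq hα hr]
    exact (isCompact_rho_le hα r).of_isClosed_subset
      (isClosed_eq (continuous_rho hα) continuous_const) fun x hx => le_of_eq hx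
  have hfin : leray α r (sphere α r : Set (Space m k)) < ⊤ := by
    refine hc.measure_lt_top_of_nhdsWithin fun p hp => ?_
    have hp0 := ne_zero_of_mem_sphere hα hr hp
    obtain ⟨i, hi⟩ := exists_coord_ne_zero hp0
    have hg := gradient_rho_coord_ne_zero hα hi
    set c := |gradient (rho α) p i| / 2
    have hc0 : 0 < c := by positivity
    have hcont : ContinuousAt (fun x => |gradient (rho α) x i|) p :=
      ((EuclideanSpace.proj i : StrongDual ℝ (Space m k)).continuous.continuousAt.comp
        (continuousAt_gradient (contDiffAt_rho hα hp0))).abs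
    set A := halfSpace i (p i) ∩ {x | c < |gradient (rho α) x i|}
    have hAm : MeasurableSet A := (isOpen_halfSpace i _).measurableSet.inter
      (measurableSet_lt measurable_const
        (measurable_norm.comp (measurable_gradient_coord (rho α) i)))
    have hAn : A ∈ 𝓝 p := inter_mem ((isOpen_halfSpace i _).mem_nhds (mem_halfSpace_self hi))
      (hcont.eventually (lt_mem_nhds (half_lt_self (abs_pos.2 hg))))
    refine ⟨A, mem_nhdsWithin_of_mem_nhds hAn, ?_⟩
    have h1 : ENNReal.ofReal c * leray α r A ≤
        ∫⁻ x in A, ENNReal.ofReal |gradient (rho α) x i| ∂(leray α r) := by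
      rw [← setLIntegral_const]
      exact setLIntegral_mono' hAm fun x hx => ENNReal.ofReal_le_ofReal hx.2.le
    rw [setLIntegral_leray_gradient_coord hα hm hr hAm inter_subset_left] at h1
    have h2 : volume (dropCoord i '' (A ∩ {x | rho α x = r})) < ⊤ := by
      refine lt_of_le_of_lt (measure_mono (image_mono ?_))
        ((isCompact_rho_le hα r).image (dropCoord i).continuous).measure_lt_top
      exact fun x hx => le_of_eq hx.2
    refine ENNReal.lt_top_of_mul_ne_top_right (lt_of_le_of_lt h1 h2).ne ?_
    simpa using hc0
  constructor
  rw [← union_compl_self (sphere α r)]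
  exact lt_of_le_of_lt (measure_union_le _ _) (by rw [leray_compl_sphere, add_zero]; exact hfin)

/-- In the chart of a coordinate of weight w, the projected volume scales by r^{Q-w} and the weight
|∂_i ρ| by r^{1-w}. The quotient r^{Q-1} does not depend on the chart. -/
theorem leray_eq_map_dil (hm : 0 < m) {r : ℝ} (hr : 0 < r) :
    (leray α r : Measure (Space m k)) =
      ENNReal.ofReal (r ^ (homDim m k α - 1)) • (leray α 1).map (dil α r) := by
  have hdm : Measurable (dil α r : Space m k → Space m k) := (dil α r).continuous.measurable
  refine measure_ext_halfSpace (leray_zero hα hr) ?_ fun i s A hAU hA => ?_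
  · rw [Measure.smul_apply, Measure.map_apply hdm (measurableSet_singleton 0)]
    have : (dil α r : Space m k → Space m k) ⁻¹' {0} ⊆ {0} := by
      intro x hx
      by_contra h
      exact dil_ne_zero hα hr h hx
    rw [measure_mono_null this (leray_zero hα one_pos), smul_zero]
  have hmeas : Measurable fun x : Space m k => ENNReal.ofReal |gradient (rho α) x i| :=
    (measurable_norm.comp (measurable_gradient_coord (rho α) i)).ennreal_ofReal
  refine measure_eq_of_setLIntegral_eq (isOpen_halfSpace i s).measurableSet hmeas
    (fun x hx => ?_) (fun x => ENNReal.ofReal_ne_top) (fun A hAU hA => ?_) hA hAU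
  · have := gradient_rho_coord_ne_zero hα (coord_ne_zero_of_mem_halfSpace hx)
    simpa using this
  have hB : dil α r ⁻¹' A ⊆ halfSpace i s := fun x hx => (dil_mem_halfSpace hr).1 (hAU hx)
  have h1 : ∫⁻ x in dil α r ⁻¹' A, ENNReal.ofReal |gradient (rho α) (dil α r x) i| ∂(leray α 1) =
      ENNReal.ofReal (r ^ (1 - weight α i)) *
        ∫⁻ x in dil α r ⁻¹' A, ENNReal.ofReal |gradient (rho α) x i| ∂(leray α 1) := by
    rw [← lintegral_const_mul _ hmeas]
    refine setLIntegral_congr_fun (hdm hA) fun x hx => ?_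
    have hr1 : 0 ≤ r ^ (1 - weight α i) := by positivity
    change ENNReal.ofReal |gradient (rho α) (dil α r x) i| = _
    rw [gradient_rho_dil hα hr (ne_zero_of_mem_halfSpace (hB hx)), abs_mul, abs_of_nonneg hr1,
      ENNReal.ofReal_mul hr1]
  have h2 : A ∩ {x | rho α x = r} = dil α r '' (dil α r ⁻¹' A ∩ {x | rho α x = 1}) := by
    ext x
    constructor
    · rintro ⟨hxA, hx⟩
      refine ⟨dil α r⁻¹ x, ⟨?_, ?_⟩, dil_dil_inv hr x⟩
      · rwa [mem_preimage, dil_dil_inv hr]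
      · have hx : rho α x = r := hx
        rw [mem_ofPred_eq, rho_dil hα (inv_nonneg.2 hr.le), hx, inv_mul_cancel₀ hr.ne']
    · rintro ⟨y, ⟨hyA, hy⟩, rfl⟩
      have hy : rho α y = 1 := hy
      exact ⟨hyA, by rw [mem_ofPred_eq, rho_dil hα hr.le, hy, mul_one]⟩
  have h3 : dropCoord i '' (A ∩ {x | rho α x = r}) =
      diagMap (fun j : {j // j ≠ i} => r ^ weight α (j : Fin m ⊕ Fin k)) ''
        (dropCoord i '' (dil α r ⁻¹' A ∩ {x | rho α x = 1})) := by
    rw [h2, image_image, image_image]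
    rfl
  rw [setLIntegral_leray_gradient_coord hα hm hr hA hAU, Measure.restrict_smul, lintegral_smul_measure,
    setLIntegral_map hA hmeas hdm, h1,
    setLIntegral_leray_gradient_coord hα hm one_pos (hdm hA) hB, h3, volume_diagMap_image,
    prod_rpow_weight_ne hr, smul_eq_mul, ← mul_assoc, ← ENNReal.ofReal_mul (by positivity),
    ← Real.rpow_add hr, abs_of_nonneg (by positivity)]
  congr 3
  ring

/-- The radial weight `r^{Q-1} dr` on `(0,∞)`. -/
def radial (m k : ℕ) (α : ℝ) : Measure ℝ :=
  (volume.restrict (Ioi 0)).withDensity fun r => ENNReal.ofReal (r ^ (homDim m k α - 1))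

omit hα in
theorem measurable_radial_weight :
    Measurable fun r : ℝ => ENNReal.ofReal (r ^ (homDim m k α - 1)) :=
  (measurable_id.pow_const _).ennreal_ofReal

/-- Integration in the polar coordinates of the anisotropic dilations. -/
theorem volume_eq_map_polar (hm : 0 < m) :
    (volume : Measure (Space m k)) =
      ((radial m k α).prod (leray α 1)).map fun q => dil α q.1 q.2 := by
  have hfin := isFiniteMeasure_leray (m := m) (k := k) hα hm one_pos
  refine measure_ext_halfSpace ?_ ?_ fun i s A hAU hA => ?_
  · have : Nonempty (Fin m ⊕ Fin k) := ⟨Sum.inl ⟨0, hm⟩⟩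
    exact measure_singleton 0
  · rw [Measure.map_apply measurable_dil (measurableSet_singleton 0)]
    -- A dilation by r > 0 sends no point of the unit pseudo-sphere to the origin. Both exceptional
    -- sets are null, as `radial` is carried by r > 0 and `leray α 1` by the unit pseudo-sphere.
    have hsub : (fun q : ℝ × Space m k => dil α q.1 q.2) ⁻¹' {0} ⊆
        (Iic 0 ×ˢ univ) ∪ (univ ×ˢ (sphere α 1)ᶜ) := by
      rintro ⟨r, x⟩ hq
      by_cases hr : r ≤ 0
      · exact Or.inl ⟨hr, mem_univ _⟩
      · refine Or.inr ⟨mem_univ _, fun hx => ?_⟩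
        exact dil_ne_zero hα (not_le.1 hr) (ne_zero_of_mem_sphere hα one_pos hx) hq
    refine measure_mono_null hsub (measure_union_null ?_ ?_)
    · rw [Measure.prod_prod, radial, withDensity_apply _ measurableSet_Iic,
        Measure.restrict_restrict measurableSet_Iic, Iic_inter_Ioi, Ioc_self]
      simp
    · rw [Measure.prod_prod, leray_compl_sphere, mul_zero]
  have hmeas : Measurable fun x : Space m k => ENNReal.ofReal |gradient (rho α) x i| :=
    (measurable_norm.comp (measurable_gradient_coord (rho α) i)).ennreal_ofReal
  refine measure_eq_of_setLIntegral_eq (isOpen_halfSpace i s).measurableSet hmeas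
    (fun x hx => ?_) (fun x => ENNReal.ofReal_ne_top) (fun A hAU hA => ?_) hA hAU
  · have := gradient_rho_coord_ne_zero hα (coord_ne_zero_of_mem_halfSpace hx)
    simpa using this
  have hmeasA := hmeas.indicator hA
  have hmeasD : Measurable fun q : ℝ × Space m k =>
      A.indicator (fun x => ENNReal.ofReal |gradient (rho α) x i|) (dil α q.1 q.2) :=
    hmeasA.comp measurable_dil
  -- One side is sliced by the coarea formula, the other by Fubini. For r > 0 the slices agree by
  -- the scaling of the surface measure, and the level sets with r ≤ 0 do not meet the half space.
  rw [← lintegral_indicator hA (μ := Measure.map _ _), lintegral_map hmeasA measurable_dil,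
    lintegral_prod _ hmeasD.aemeasurable, radial,
    lintegral_withDensity_eq_lintegral_mul _ measurable_radial_weight
      hmeasD.lintegral_prod_right',
    lintegral_gradient_coord_eq (i := i) (n := m + k - 1) (U := halfSpace i s) (by simp; omega)
      (measurable_rho hα) (isOpen_halfSpace i s).measurableSet
      (fun x hx => contDiffAt_rho hα (ne_zero_of_mem_halfSpace hx))
      (fun x hx => gradient_rho_coord_ne_zero hα (coord_ne_zero_of_mem_halfSpace hx))
      (fun x hx y hy h => eq_of_dropCoord_eq_of_rho_eq hα (mul_pos_of_mem_halfSpace hx hy) h)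
      hA hAU, ← lintegral_indicator measurableSet_Ioi]
  refine lintegral_congr fun r => ?_
  by_cases hr : 0 < r
  · rw [indicator_of_mem (mem_Ioi.2 hr), ← sphere_eq hα hr, ← setLIntegral_leray_eq hA,
      leray_eq_map_dil hα hm hr, Measure.restrict_smul, lintegral_smul_measure,
      ← lintegral_indicator hA, lintegral_map hmeasA (dil α r).continuous.measurable]
    rfl
  · rw [indicator_of_notMem (by simpa using hr)]
    have : A ∩ {x | rho α x = r} = ∅ := by
      ext x
      simp only [mem_inter_iff, mem_ofPred_eq, mem_empty_iff_false, iff_false, not_and]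
      intro hx h
      exact hr (h ▸ rho_pos hα (ne_zero_of_mem_halfSpace (hAU hx)))
    simp [this]

end

/-! ### Anisotropic mollification kernels. -/

section

theorem integral_comp_diagMap {ι : Type*} [Fintype ι] {c : ι → ℝ} (hc : ∏ j, c j ≠ 0)
    (f : EuclideanSpace ℝ ι → ℝ) :
    ∫ x, f (diagMap c x) = |∏ j, c j|⁻¹ * ∫ x, f x := by
  have hdet : LinearMap.det (diagMap c).toLinearMap ≠ 0 := by rwa [det_diagMap]
  have hmap := Measure.map_linearMap_addHaar_eq_smul_addHaar volume hdet
  rw [det_diagMap] at hmap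
  have hinj : Function.Injective (diagMap c) := by
    intro x y hxy
    ext j
    have := congrArg (fun v => v j) hxy
    exact mul_left_cancel₀ (fun h => hc (Finset.prod_eq_zero (Finset.mem_univ j) h)) this
  have hemb : MeasurableEmbedding (diagMap c) :=
    (diagMap c).continuous.measurableEmbedding hinj
  have := hemb.integral_map (μ := volume) f
  rw [← this]
  change ∫ y, f y ∂(Measure.map (diagMap c).toLinearMap volume) = _
  rw [hmap, integral_smul_measure, ENNReal.toReal_ofReal (abs_nonneg _), smul_eq_mul, abs_inv]

variable {m k : ℕ}

/-- The projection `(z,t) ↦ z`. -/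
def zPart : Space m k →L[ℝ] EuclideanSpace ℝ (Fin m) :=
  (EuclideanSpace.equiv (Fin m) ℝ).symm.toContinuousLinearMap ∘L
    ContinuousLinearMap.pi fun i => EuclideanSpace.proj (Sum.inl i)

theorem normZ_eq_norm (x : Space m k) : normZ x = ‖zPart x‖ := by
  rw [EuclideanSpace.norm_eq, normZ]
  simp [zPart]

theorem continuous_normZ : Continuous (normZ : Space m k → ℝ) := by
  have : (normZ : Space m k → ℝ) = fun x => ‖zPart x‖ := funext normZ_eq_norm
  rw [this]
  fun_prop

theorem normZ_sq (x : Space m k) : normZ x ^ 2 = zsq x := Real.sq_sqrt (zsq_nonneg x)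

theorem normZ_nonneg (x : Space m k) : 0 ≤ normZ x := Real.sqrt_nonneg _

/-- A fixed bump is rescaled with width `a` in z and width `b` in t. The L¹ norm of its
t-derivatives is of order 1/b, whatever `a` is, so `a` may be shrunk after `b` is fixed. This is
what controls the commutator of mollification with the variable coefficient |z|^α. -/
theorem exists_kernel_family (m k : ℕ) : ∃ C : ℝ, 0 ≤ C ∧ ∀ a b : ℝ, 0 < a → a ≤ b →
    ∃ φ : Space m k → ℝ, ContDiff ℝ ∞ φ ∧ (∀ x, 0 ≤ φ x) ∧
      (∀ x, φ x ≠ 0 → ‖x‖ < b ∧ normZ x < a) ∧ ∫ x, φ x = 1 ∧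
      ∀ j : Fin k, ∫ x, |fderiv ℝ φ x (EuclideanSpace.single (Sum.inr j) 1)| ≤ C / b := by
  set B : ContDiffBump (0 : Space m k) := ⟨1 / 2, 1, by norm_num, by norm_num⟩
  set φ₁ : Space m k → ℝ := B.normed volume
  have hφ₁ : ContDiff ℝ ∞ φ₁ := B.contDiff_normed
  refine ⟨∑ j : Fin k, ∫ x, |fderiv ℝ φ₁ x (EuclideanSpace.single (Sum.inr j) 1)|,
    Finset.sum_nonneg fun j _ => integral_nonneg fun x => abs_nonneg _, fun a b ha hab => ?_⟩
  have hb : 0 < b := ha.trans_le hab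
  set c : Fin m ⊕ Fin k → ℝ := Sum.elim (fun _ => a⁻¹) (fun _ => b⁻¹)
  have hc : 0 < ∏ j, c j := by
    refine Finset.prod_pos fun j _ => ?_
    cases j <;> simp [c, ha, hb]
  have hz : ∀ x, zsq (diagMap c x) = (a⁻¹) ^ 2 * zsq x := by
    intro x
    simp [zsq, c, mul_pow, Finset.mul_sum]
  have ht : ∀ x, tsq (diagMap c x) = (b⁻¹) ^ 2 * tsq x := by
    intro x
    simp [tsq, c, mul_pow, Finset.mul_sum]
  have hder : ∀ x v, fderiv ℝ (fun x => (∏ j, c j) * φ₁ (diagMap c x)) x v =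
      (∏ j, c j) * fderiv ℝ φ₁ (diagMap c x) (diagMap c v) := by
    intro x v
    have h1 : HasFDerivAt φ₁ (fderiv ℝ φ₁ (diagMap c x)) (diagMap c x) :=
      (hφ₁.differentiable (by simp) _).hasFDerivAt
    have h2 := (h1.comp x (diagMap c).hasFDerivAt).const_mul (∏ j, c j)
    have h3 : HasFDerivAt (fun x => (∏ j, c j) * φ₁ (diagMap c x)) _ x := h2
    rw [h3.fderiv]
    simp
  refine ⟨fun x => (∏ j, c j) * φ₁ (diagMap c x), ?_, ?_, ?_, ?_, ?_⟩
  · exact contDiff_const.mul (hφ₁.comp (diagMap c).contDiff)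
  · exact fun x => mul_nonneg hc.le (B.nonneg_normed _)
  · intro x hx
    have h1 : diagMap c x ∈ Function.support φ₁ := right_ne_zero_of_mul hx
    rw [B.support_normed_eq] at h1
    have h2 : ‖diagMap c x‖ < 1 := by simpa [B] using h1
    have h3 : ‖diagMap c x‖ ^ 2 < 1 := by nlinarith [norm_nonneg (diagMap c x)]
    rw [norm_sq_eq, hz, ht] at h3
    have h4 := zsq_nonneg x
    have h5 := tsq_nonneg x
    -- Since a ≤ b, the ellipsoid with semi-axes a and b lies in the ball of radius b and in the
    -- slab |z| < a.
    have h6 : 0 ≤ (b⁻¹) ^ 2 * tsq x := by positivity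
    have h7 : (b⁻¹) ^ 2 ≤ (a⁻¹) ^ 2 := by gcongr
    constructor
    · have h8 : (b⁻¹) ^ 2 * ‖x‖ ^ 2 < 1 := by
        rw [norm_sq_eq, mul_add]
        nlinarith
      rw [← mul_pow] at h8
      have h9 : b⁻¹ * ‖x‖ < 1 := by
        have : 0 ≤ b⁻¹ * ‖x‖ := by positivity
        nlinarith
      rwa [inv_mul_lt_iff₀ hb, mul_one] at h9
    · have h8 : (a⁻¹) ^ 2 * normZ x ^ 2 < 1 := by
        rw [normZ_sq]
        linarith
      rw [← mul_pow] at h8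
      have h9 : a⁻¹ * normZ x < 1 := by
        have : 0 ≤ a⁻¹ * normZ x := mul_nonneg (by positivity) (normZ_nonneg x)
        nlinarith
      rwa [inv_mul_lt_iff₀ ha, mul_one] at h9
  · rw [integral_const_mul, integral_comp_diagMap hc.ne', abs_of_pos hc, ← mul_assoc,
      mul_inv_cancel₀ hc.ne', one_mul, B.integral_normed]
  · intro j
    have hsingle : diagMap c (EuclideanSpace.single (Sum.inr j) (1 : ℝ)) =
        b⁻¹ • EuclideanSpace.single (Sum.inr j) (1 : ℝ) := by
      ext i
      by_cases h : i = Sum.inr j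
      · subst h; simp [c]
      · simp [h]
    have h1 : ∀ x, |fderiv ℝ (fun x => (∏ j, c j) * φ₁ (diagMap c x)) x
        (EuclideanSpace.single (Sum.inr j) 1)| = ((∏ j, c j) * b⁻¹) *
        |fderiv ℝ φ₁ (diagMap c x) (EuclideanSpace.single (Sum.inr j) 1)| := by
      intro x
      rw [hder, hsingle, map_smul, smul_eq_mul, ← mul_assoc, abs_mul, abs_of_pos (by positivity)]
    simp_rw [h1]
    rw [integral_const_mul, integral_comp_diagMap hc.ne'
      (fun x => |fderiv ℝ φ₁ x (EuclideanSpace.single (Sum.inr j) 1)|), abs_of_pos hc]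
    have h2 : (∏ j, c j) * b⁻¹ * ((∏ j, c j)⁻¹ *
        ∫ x, |fderiv ℝ φ₁ x (EuclideanSpace.single (Sum.inr j) 1)|) =
        (∫ x, |fderiv ℝ φ₁ x (EuclideanSpace.single (Sum.inr j) 1)|) / b := by
      field_simp
    rw [h2]
    gcongr
    exact Finset.single_le_sum
      (f := fun j : Fin k => ∫ x, |fderiv ℝ φ₁ x (EuclideanSpace.single (Sum.inr j) 1)|)
      (fun j _ => integral_nonneg fun x => abs_nonneg _) (Finset.mem_univ j)

end

/-! ### Smooth approximation together with the weak derivatives X_j. -/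

section

theorem abs_integral_kernel_sub_le {E : Type*} [NormedAddCommGroup E] [NormedSpace ℝ E]
    [FiniteDimensional ℝ E] [MeasurableSpace E] [BorelSpace E] {μ : Measure E}
    [μ.IsAddHaarMeasure] {φ h : E → ℝ} (hφ : Continuous φ) (hφc : HasCompactSupport φ)
    (hφ0 : ∀ x, 0 ≤ φ x) (hφ1 : ∫ x, φ x ∂μ = 1) (hh : Integrable h μ) (x : E) {c ε : ℝ}
    (hc : ∀ y, φ (x - y) ≠ 0 → |h y - c| ≤ ε) :
    |∫ y, φ (x - y) * h y ∂μ - c| ≤ ε := by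
  have hφi : Integrable φ μ := hφ.integrable_of_hasCompactSupport hφc
  have hφx : Integrable (fun y => φ (x - y)) μ := hφi.comp_sub_left x
  have hint : Integrable (fun y => φ (x - y) * h y) μ := by
    obtain ⟨M, hM⟩ := hφ.bounded_above_of_compact_support hφc
    exact hh.bdd_mul (c := M) (by fun_prop) (Eventually.of_forall fun y => hM _)
  have h1 : ∫ y, φ (x - y) ∂μ = 1 := by rw [integral_sub_left_eq_self φ μ x, hφ1]
  have h2 : ∫ y, φ (x - y) * h y ∂μ - c = ∫ y, φ (x - y) * (h y - c) ∂μ := by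
    simp_rw [mul_sub]
    rw [integral_sub hint (hφx.mul_const c), integral_mul_const, h1, one_mul]
  rw [h2]
  calc |∫ y, φ (x - y) * (h y - c) ∂μ| ≤ ∫ y, φ (x - y) * ε ∂μ := by
        rw [← Real.norm_eq_abs]
        refine norm_integral_le_of_norm_le (hφx.mul_const ε) (Eventually.of_forall fun y => ?_)
        rw [norm_mul, Real.norm_of_nonneg (hφ0 _), Real.norm_eq_abs]
        by_cases hy : φ (x - y) = 0
        · simp [hy]
        · exact mul_le_mul_of_nonneg_left (hc y hy) (hφ0 _)
    _ = ε := by rw [integral_mul_const, h1, one_mul]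

theorem fderiv_convolution_left {E : Type*} [NormedAddCommGroup E] [NormedSpace ℝ E]
    [FiniteDimensional ℝ E] [MeasurableSpace E] [BorelSpace E] {μ : Measure E}
    [μ.IsAddHaarMeasure] {φ h : E → ℝ} (hφ : ContDiff ℝ 1 φ) (hφc : HasCompactSupport φ)
    (hh : LocallyIntegrable h μ) (x v : E) :
    fderiv ℝ (convolution φ h (ContinuousLinearMap.mul ℝ ℝ) μ) x v =
      ∫ y, fderiv ℝ φ (x - y) v * h y ∂μ := by
  rw [(hφc.hasFDerivAt_convolution_left (ContinuousLinearMap.mul ℝ ℝ) hφ hh x).fderiv,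
    convolution_eq_swap]
  have hex := (hφc.fderiv ℝ).convolutionExists_left
    ((ContinuousLinearMap.mul ℝ ℝ).precompL E) (hφ.continuous_fderiv one_ne_zero) hh x
  rw [ContinuousLinearMap.integral_apply hex.integrable_swap]
  rfl

variable {m k : ℕ} {α : ℝ}

/-- `f` is continuous in `Ω` and has the continuous weak derivatives `X_j f = g_j` there. -/
structure HasWeakGrad (α : ℝ) (Ω : Set (Space m k)) (f : Space m k → ℝ)
    (g : Fin m ⊕ Fin k → Space m k → ℝ) : Prop where
  continuousOn : ContinuousOn f Ω
  weak : ∀ j, IsWeakX α Ω j f (g j)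

theorem continuous_X (hα : 0 < α) (j : Fin m ⊕ Fin k) :
    Continuous (X α j : Space m k → Space m k) := by
  cases j with
  | inl i => exact continuous_const
  | inr j =>
    have : Continuous fun x : Space m k => normZ x ^ α / 2 :=
      (continuous_normZ.rpow_const fun x => Or.inr hα.le).div_const 2
    exact this.smul continuous_const

/-- Local approximation by smooth functions together with the derivatives `X_j`. -/
theorem HasWeakGrad.exists_smooth_approx (hα : 0 < α) {Ω : Set (Space m k)} (hΩ : IsOpen Ω)
    {f : Space m k → ℝ} {g : Fin m ⊕ Fin k → Space m k → ℝ} (h : HasWeakGrad α Ω f g)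
    {K : Set (Space m k)} (hK : IsCompact K) (hKΩ : K ⊆ Ω) {η : ℝ} (hη : 0 < η) :
    ∃ F : Space m k → ℝ, ContDiff ℝ ∞ F ∧ (∀ x ∈ K, |F x - f x| ≤ η) ∧
      (∀ j, ∀ x ∈ K, |fderiv ℝ F x (X α j x) - g j x| ≤ η) ∧
      ∀ x, F x ≠ 0 → ∃ y ∈ Ω, f y ≠ 0 ∧ dist x y < η := by
  obtain ⟨r₀, hr₀, hK'Ω⟩ := hK.exists_cthickening_subset_open hΩ hKΩ
  set K' := Metric.cthickening r₀ K
  have hK' : IsCompact K' := hK.cthickening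
  have hKK' : K ⊆ K' := Metric.self_subset_cthickening K
  have hfc : ContinuousOn f K' := h.continuousOn.mono hK'Ω
  have hgc : ∀ j, ContinuousOn (g j) K' := fun j => (h.weak j).1.mono hK'Ω
  obtain ⟨δ, hδ, hfgδ⟩ : ∃ δ > 0, ∀ x ∈ K', ∀ y ∈ K', dist x y < δ →
      |f x - f y| ≤ η / 2 ∧ ∀ j, |g j x - g j y| ≤ η / 2 := by
    have hG : ContinuousOn (fun x => (f x, fun j => g j x)) K' :=
      hfc.prodMk (continuousOn_pi.2 hgc)
    obtain ⟨δ, hδ, hu⟩ := Metric.uniformContinuousOn_iff.1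
      (hK'.uniformContinuousOn_of_continuous hG) (η / 2) (by positivity)
    refine ⟨δ, hδ, fun x hx y hy hxy => ?_⟩
    have := (hu x hx y hy hxy).le
    rw [Prod.dist_eq, max_le_iff, dist_pi_le_iff (by positivity)] at this
    exact this
  obtain ⟨M, hM⟩ := hK'.exists_bound_of_continuousOn hfc
  obtain ⟨M₁, hM₁⟩ := hK'.exists_bound_of_continuousOn continuous_normZ.continuousOn
  obtain ⟨C, hC, hker⟩ := exists_kernel_family m k
  -- The scale `b` keeps the kernel centred in `K` inside `K'`, within the modulus of continuity of
  -- `f` and the `g j`, and the support of the approximation within η of that of `f`.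
  set b := min (min r₀ δ) η / 2
  have hb : 0 < b := by positivity
  have hbr : b < r₀ := by
    have : min (min r₀ δ) η ≤ r₀ := (min_le_left _ _).trans (min_le_left _ _)
    simp only [b]; linarith
  have hbδ : b < δ := by
    have : min (min r₀ δ) η ≤ δ := (min_le_left _ _).trans (min_le_right _ _)
    simp only [b]; linarith
  have hbη : b < η := by
    have : min (min r₀ δ) η ≤ η := min_le_right _ _
    simp only [b]; linarith
  -- This is the oscillation of |z|^α for which the commutator bound (η'/2) |M| (C/b) is at most
  -- η/2.
  set η' := η * b / ((|M| + 1) * (C + 1))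
  have hη' : 0 < η' := by positivity
  obtain ⟨δ', hδ', hrpow⟩ : ∃ δ' > 0, ∀ x ∈ K', ∀ y ∈ K', |normZ x - normZ y| < δ' →
      |normZ x ^ α - normZ y ^ α| ≤ η' := by
    have hcont : ContinuousOn (fun s : ℝ => s ^ α) (Icc 0 M₁) :=
      (Real.continuous_rpow_const hα.le).continuousOn
    obtain ⟨δ', hδ', hu⟩ := Metric.uniformContinuousOn_iff.1
      (isCompact_Icc.uniformContinuousOn_of_continuous hcont) η' hη'
    refine ⟨δ', hδ', fun x hx y hy hxy => (hu _ ⟨normZ_nonneg x, ?_⟩ _ ⟨normZ_nonneg y, ?_⟩ hxy).le⟩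
    · exact (le_abs_self _).trans (hM₁ x hx)
    · exact (le_abs_self _).trans (hM₁ y hy)
  -- The z-width is chosen last. It makes |z|^α vary by at most η' over the kernel without affecting
  -- the bound C/b.
  set a := min b (δ' / 2)
  have ha : 0 < a := by positivity
  have haδ : a < δ' := (min_le_right _ _).trans_lt (half_lt_self hδ')
  obtain ⟨φ, hφ, hφ0, hφs, hφ1, hφC⟩ := hker a b ha (min_le_left _ _)
  have hts : ∀ w ∈ tsupport φ, ‖w‖ ≤ b ∧ normZ w ≤ a := by
    have hcl : IsClosed {w : Space m k | ‖w‖ ≤ b ∧ normZ w ≤ a} :=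
      (isClosed_le continuous_norm continuous_const).inter
        (isClosed_le continuous_normZ continuous_const)
    have hsub : Function.support φ ⊆ {w : Space m k | ‖w‖ ≤ b ∧ normZ w ≤ a} :=
      fun w hw => ⟨(hφs w hw).1.le, (hφs w hw).2.le⟩
    exact fun w hw => closure_minimal hsub hcl hw
  have hφc : HasCompactSupport φ :=
    HasCompactSupport.of_support_subset_isCompact (isCompact_closedBall (0 : Space m k) b)
      fun w hw => by simpa using (hφs w hw).1.le
  have hφ' : ContDiff ℝ 1 φ := hφ.of_le (by simp)
  have hfi : Integrable (K'.indicator f) :=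
    (hfc.integrableOn_compact hK').integrable_indicator hK'.measurableSet
  have hgi : ∀ j, Integrable (K'.indicator (g j)) := fun j =>
    ((hgc j).integrableOn_compact hK').integrable_indicator hK'.measurableSet
  have hmemK' : ∀ x ∈ K, ∀ y, ‖x - y‖ ≤ b → y ∈ K' := fun x hx y hy =>
    Metric.mem_cthickening_of_dist_le y x r₀ K hx (by
      rw [dist_comm, dist_eq_norm]; exact hy.trans hbr.le)
  refine ⟨convolution φ (K'.indicator f) (ContinuousLinearMap.mul ℝ ℝ) volume,
    hφc.contDiff_convolution_left _ hφ hfi.locallyIntegrable, fun x hx => ?_, fun j x hx => ?_,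
    fun x hx => ?_⟩
  · rw [convolution_eq_swap]
    refine (abs_integral_kernel_sub_le hφ.continuous hφc hφ0 hφ1 hfi x
      (ε := η / 2) fun y hy => ?_).trans (by linarith)
    have h1 := (hφs _ hy).1
    have hyK := hmemK' x hx y h1.le
    rw [indicator_of_mem hyK]
    exact (hfgδ y hyK x (hKK' hx) (by rw [dist_comm, dist_eq_norm]; exact h1.trans hbδ)).1
  · rw [fderiv_convolution_left hφ' hφc hfi.locallyIntegrable]
    have hg1 : |(∫ y, φ (x - y) * K'.indicator (g j) y) - g j x| ≤ η / 2 := by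
      refine abs_integral_kernel_sub_le hφ.continuous hφc hφ0 hφ1 (hgi j) x fun y hy => ?_
      have h1 := (hφs _ hy).1
      have hyK := hmemK' x hx y h1.le
      rw [indicator_of_mem hyK]
      exact (hfgδ y hyK x (hKK' hx) (by rw [dist_comm, dist_eq_norm]; exact h1.trans hbδ)).2 j
    have hfd0 : ∀ y, y ∉ K' → fderiv ℝ φ (x - y) = 0 := by
      intro y hy
      have : x - y ∉ tsupport φ := fun hw => hy (hmemK' x hx y (hts _ hw).1)
      exact image_eq_zero_of_notMem_tsupport fun hw => this (tsupport_fderiv_subset ℝ hw)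
    have hφ0' : ∀ y, y ∉ K' → φ (x - y) = 0 := by
      intro y hy
      by_contra hne
      exact hy (hmemK' x hx y (hφs _ hne).1.le)
    -- The weak derivative is tested with y ↦ φ(x - y). The minus sign from reflecting the argument
    -- cancels the one in the definition.
    have hweak : ∫ y, fderiv ℝ φ (x - y) (X α j y) * K'.indicator f y =
        ∫ y, φ (x - y) * K'.indicator (g j) y := by
      have hθ : ContDiff ℝ ∞ fun y => φ (x - y) := hφ.comp (contDiff_const.sub contDiff_id)
      have hsub : tsupport (fun y => φ (x - y)) ⊆ K' :=
        closure_minimal (fun y hy => by_contra fun hn => hy (hφ0' y hn)) hK'.isClosed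
      have h1 := (h.weak j).2 _ hθ (HasCompactSupport.of_support_subset_isCompact hK'
        (subset_tsupport _ |>.trans hsub)) (hsub.trans hK'Ω)
      have hder : ∀ y v, fderiv ℝ (fun y => φ (x - y)) y v = - fderiv ℝ φ (x - y) v := by
        intro y v
        have h2 : HasFDerivAt φ (fderiv ℝ φ (x - y)) (x - y) :=
          (hφ'.differentiable one_ne_zero _).hasFDerivAt
        have h3 : HasFDerivAt (fun y : Space m k => x - y) (-ContinuousLinearMap.id ℝ _) y :=
          (hasFDerivAt_id y).const_sub x
        have h4 : HasFDerivAt (fun y => φ (x - y)) _ y := h2.comp y h3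
        rw [h4.fderiv]
        simp
      simp only [zero_mul, add_zero, hder, mul_neg, integral_neg, neg_inj] at h1
      rw [setIntegral_eq_integral_of_forall_compl_eq_zero,
        setIntegral_eq_integral_of_forall_compl_eq_zero] at h1
      · calc _ = ∫ y, f y * fderiv ℝ φ (x - y) (X α j y) := by
              refine integral_congr_ae (Eventually.of_forall fun y => ?_)
              by_cases hy : y ∈ K'
              · simp [hy, mul_comm]
              · simp [hy, hfd0 y hy]
          _ = ∫ y, g j y * φ (x - y) := h1
          _ = _ := by
              refine integral_congr_ae (Eventually.of_forall fun y => ?_)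
              by_cases hy : y ∈ K'
              · simp [hy, mul_comm]
              · simp [hy, hφ0' y hy]
      · intro y hy
        rw [hφ0' y fun hn => hy (hK'Ω hn), mul_zero]
      · intro y hy
        rw [hfd0 y fun hn => hy (hK'Ω hn)]
        simp
    have hbd : ∀ V : Space m k → Space m k, Continuous V →
        Integrable fun y => fderiv ℝ φ (x - y) (V y) * K'.indicator f y := by
      intro V hV
      have hc1 : Continuous fun y => fderiv ℝ φ (x - y) (V y) :=
        ((hφ'.continuous_fderiv one_ne_zero).comp (continuous_const.sub continuous_id)).clm_apply hV
      have hcs : HasCompactSupport fun y => fderiv ℝ φ (x - y) (V y) :=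
        HasCompactSupport.of_support_subset_isCompact hK' fun y hy => by
          by_contra hn
          exact hy (by simp [hfd0 y hn])
      obtain ⟨M₂, hM₂⟩ := hc1.bounded_above_of_compact_support hcs
      exact hfi.bdd_mul (c := M₂) hc1.aestronglyMeasurable (Eventually.of_forall hM₂)
    -- Differentiating the convolution evaluates the field at `x`, while the weak derivative has it
    -- at `y`. The difference vanishes for the z-fields and is bounded by the oscillation of |z|^α
    -- for the t-fields.
    have hcomm : |(∫ y, fderiv ℝ φ (x - y) (X α j x) * K'.indicator f y) -
        ∫ y, fderiv ℝ φ (x - y) (X α j y) * K'.indicator f y| ≤ η / 2 := by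
      rw [← integral_sub (hbd _ continuous_const) (hbd _ (continuous_X hα j))]
      cases j with
      | inl i => simp [X]; positivity
      | inr j =>
        have hint : Integrable fun y => (η' / 2 * |M|) *
            |fderiv ℝ φ (x - y) (EuclideanSpace.single (Sum.inr j) 1)| := by
          have hc1 : Continuous fun y => fderiv ℝ φ y (EuclideanSpace.single (Sum.inr j) 1) :=
            (hφ'.continuous_fderiv one_ne_zero).clm_apply continuous_const
          have hcs := hφc.fderiv_apply (𝕜 := ℝ) (EuclideanSpace.single (Sum.inr j) (1 : ℝ))
          exact (((hc1.integrable_of_hasCompactSupport hcs).comp_sub_left x).abs).const_mul _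
        have hle : ∀ y, ‖fderiv ℝ φ (x - y) (X α (Sum.inr j) x) * K'.indicator f y -
            fderiv ℝ φ (x - y) (X α (Sum.inr j) y) * K'.indicator f y‖ ≤ (η' / 2 * |M|) *
            |fderiv ℝ φ (x - y) (EuclideanSpace.single (Sum.inr j) 1)| := by
          intro y
          by_cases hw : x - y ∈ tsupport φ
          · obtain ⟨hw1, hw2⟩ := hts _ hw
            have hyK := hmemK' x hx y hw1
            have h1 : |normZ x ^ α - normZ y ^ α| ≤ η' := by
              refine hrpow x (hKK' hx) y hyK (lt_of_le_of_lt ?_ (hw2.trans_lt haδ))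
              rw [normZ_eq_norm, normZ_eq_norm, normZ_eq_norm, map_sub]
              exact abs_norm_sub_norm_le _ _
            rw [indicator_of_mem hyK]
            simp only [X, map_smul, smul_eq_mul]
            rw [← sub_mul, ← sub_mul, ← sub_div, norm_mul, norm_mul, norm_div]
            simp only [Real.norm_eq_abs, abs_two]
            have h2 : |f y| ≤ |M| := (hM y hyK).trans (le_abs_self M)
            calc _ ≤ η' / 2 * |fderiv ℝ φ (x - y) (EuclideanSpace.single (Sum.inr j) 1)| * |M| := by
                  gcongr
              _ = _ := by ring
          · have : fderiv ℝ φ (x - y) = 0 :=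
              image_eq_zero_of_notMem_tsupport fun hn => hw (tsupport_fderiv_subset ℝ hn)
            simp [this]
        rw [← Real.norm_eq_abs]
        refine (norm_integral_le_of_norm_le hint (Eventually.of_forall hle)).trans ?_
        rw [integral_const_mul, integral_sub_left_eq_self
          (fun y => |fderiv ℝ φ y (EuclideanSpace.single (Sum.inr j) 1)|) volume x]
        calc η' / 2 * |M| * ∫ y, |fderiv ℝ φ y (EuclideanSpace.single (Sum.inr j) 1)|
            ≤ η' / 2 * |M| * (C / b) := by gcongr; exact hφC j
          _ = (η / 2) * ((|M| * C) / ((|M| + 1) * (C + 1))) := by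
            simp only [η']; field_simp
          _ ≤ (η / 2) * 1 := by
            gcongr
            rw [div_le_one (by positivity)]
            nlinarith [abs_nonneg M]
          _ = η / 2 := mul_one _
    rw [hweak] at hcomm
    calc _ ≤ |(∫ y, fderiv ℝ φ (x - y) (X α j x) * K'.indicator f y) -
          ∫ y, φ (x - y) * K'.indicator (g j) y| +
          |(∫ y, φ (x - y) * K'.indicator (g j) y) - g j x| := abs_sub_le _ _ _
      _ ≤ η / 2 + η / 2 := add_le_add hcomm hg1
      _ = η := by ring
  · rw [convolution_eq_swap] at hx
    obtain ⟨y, hy⟩ : ∃ y, φ (x - y) * K'.indicator f y ≠ 0 := by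
      by_contra! hall
      exact hx (by simp [hall])
    have h1 : φ (x - y) ≠ 0 := left_ne_zero_of_mul hy
    have h2 : K'.indicator f y ≠ 0 := right_ne_zero_of_mul hy
    have hyK : y ∈ K' := by
      by_contra hn
      exact h2 (indicator_of_notMem hn f)
    refine ⟨y, hK'Ω hyK, by rwa [indicator_of_mem hyK] at h2, ?_⟩
    rw [dist_eq_norm]
    exact (hφs _ h1).1.trans hbη

end

/-! ### Weak solutions, product rule and admissible test functions. -/

section

variable {m k : ℕ} {α : ℝ}

/-- A weak solution `u`, with `X_j u = g_j`, of `∑_j X_j X_j u = 0` in `Ω`. -/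
structure IsWeakSol (α : ℝ) (Ω : Set (Space m k)) (u : Space m k → ℝ)
    (g : Fin m ⊕ Fin k → Space m k → ℝ) : Prop extends HasWeakGrad α Ω u g where
  integral_eq_zero : ∀ φ : Space m k → ℝ, ContDiff ℝ ∞ φ → HasCompactSupport φ → tsupport φ ⊆ Ω →
    ∫ x in Ω, ∑ j, g j x * fderiv ℝ φ x (X α j x) = 0

theorem integrable_mul_of_tsupport_subset {E : Type*} [TopologicalSpace E] [MeasurableSpace E]
    [OpensMeasurableSpace E] {μ : Measure E} [IsFiniteMeasureOnCompacts μ] [T2Space E]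
    {Ω : Set E} {f φ : E → ℝ} (hf : ContinuousOn f Ω) (hφ : Continuous φ)
    (hφc : HasCompactSupport φ) (hφΩ : tsupport φ ⊆ Ω) : Integrable (fun x => f x * φ x) μ := by
  have h1 : ContinuousOn (fun x => f x * φ x) (tsupport φ) := (hf.mono hφΩ).mul hφ.continuousOn
  have h2 : IntegrableOn (fun x => f x * φ x) (tsupport φ) μ :=
    h1.integrableOn_compact' hφc (isClosed_tsupport φ).measurableSet
  refine h2.integrable_of_forall_notMem_eq_zero fun x hx => ?_
  rw [image_eq_zero_of_notMem_tsupport hx, mul_zero]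

theorem continuous_fderiv_X (hα : 0 < α) {φ : Space m k → ℝ} (hφ : ContDiff ℝ 1 φ)
    (j : Fin m ⊕ Fin k) : Continuous fun x => fderiv ℝ φ x (X α j x) :=
  (hφ.continuous_fderiv one_ne_zero).clm_apply (continuous_X hα j)

theorem tsupport_fderiv_X_subset (φ : Space m k → ℝ) (j : Fin m ⊕ Fin k) :
    tsupport (fun x => fderiv ℝ φ x (X α j x)) ⊆ tsupport φ := by
  refine closure_minimal (fun x hx => ?_) (isClosed_tsupport φ)
  by_contra h
  refine hx ?_
  have : fderiv ℝ φ x = 0 :=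
    image_eq_zero_of_notMem_tsupport fun hn => h (tsupport_fderiv_subset ℝ hn)
  simp [this]

theorem isWeakX_weakX {Ω : Set (Space m k)} {f : Space m k → ℝ} (hf : Gamma1 α Ω f)
    (j : Fin m ⊕ Fin k) : IsWeakX α Ω j f (weakX α Ω j f) := by
  rw [weakX, dif_pos (hf.2 j)]
  exact (hf.2 j).choose_spec

/-- Testing each second derivative X_j X_j u and summing removes the second order terms. The
equation enters the later arguments only through this weak form. -/
theorem IsSolution.isWeakSol (hα : 0 < α) {Ω : Set (Space m k)}
    {u : Space m k → ℝ} (hu : IsSolution α Ω u) :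
    IsWeakSol α Ω u fun j => weakX α Ω j u := by
  refine ⟨⟨hu.1.1.1, isWeakX_weakX hu.1.1⟩, fun φ hφ hφc hφΩ => ?_⟩
  have hφ' : ContDiff ℝ 1 φ := hφ.of_le (by simp)
  have hint : ∀ j, IntegrableOn (fun x => weakX α Ω j u x * fderiv ℝ φ x (X α j x)) Ω := fun j =>
    (integrable_mul_of_tsupport_subset (isWeakX_weakX hu.1.1 j).1 (continuous_fderiv_X hα hφ' j)
      (hφc.mono' ((subset_tsupport _).trans (tsupport_fderiv_X_subset φ j)))
      ((tsupport_fderiv_X_subset φ j).trans hφΩ)).integrableOn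
  have hint2 : ∀ j, IntegrableOn (fun x => weakX α Ω j (weakX α Ω j u) x * φ x) Ω := fun j =>
    (integrable_mul_of_tsupport_subset (isWeakX_weakX (hu.1.2 j) j).1 hφ'.continuous hφc
      hφΩ).integrableOn
  rw [integral_finsetSum _ fun j _ => hint j]
  have h1 : ∀ j, ∫ x in Ω, weakX α Ω j u x * fderiv ℝ φ x (X α j x) =
      -∫ x in Ω, weakX α Ω j (weakX α Ω j u) x * φ x := by
    intro j
    have := (isWeakX_weakX (hu.1.2 j) j).2 φ hφ hφc hφΩ
    simpa using this
  simp_rw [h1]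
  rw [Finset.sum_neg_distrib, ← integral_finsetSum _ fun j _ => hint2 j, neg_eq_zero]
  refine setIntegral_eq_zero_of_forall_eq_zero fun x hx => ?_
  rw [← Finset.sum_mul]
  have : ∑ j, weakX α Ω j (weakX α Ω j u) x = 0 := hu.2 x hx
  rw [this, zero_mul]

/-- An integral identity valid for smooth test functions is valid for compactly supported test
functions with continuous weak derivatives `X_j`. -/
theorem HasWeakGrad.integral_eq_zero_of_forall_smooth (hα : 0 < α) {Ω : Set (Space m k)}
    (hΩ : IsOpen Ω) {w : Space m k → ℝ} {q : Fin m ⊕ Fin k → Space m k → ℝ}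
    (hw : HasWeakGrad α Ω w q) {K : Set (Space m k)} (hK : IsCompact K) (hKΩ : K ⊆ Ω)
    (hwK : ∀ x, x ∉ K → w x = 0) (hqK : ∀ j x, x ∉ K → q j x = 0)
    {a : Space m k → ℝ} {c : Fin m ⊕ Fin k → Space m k → ℝ} (ha : ContinuousOn a Ω)
    (hc : ∀ j, ContinuousOn (c j) Ω)
    (h : ∀ φ : Space m k → ℝ, ContDiff ℝ ∞ φ → HasCompactSupport φ → tsupport φ ⊆ Ω →
      ∫ x in Ω, (a x * φ x + ∑ j, c j x * fderiv ℝ φ x (X α j x)) = 0) :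
    ∫ x in Ω, (a x * w x + ∑ j, c j x * q j x) = 0 := by
  obtain ⟨r, hr, hK₁Ω⟩ := hK.exists_cthickening_subset_open hΩ hKΩ
  set K₁ := Metric.cthickening r K
  have hK₁ : IsCompact K₁ := hK.cthickening
  have hKK₁ : K ⊆ K₁ := Metric.self_subset_cthickening K
  have hredw : ∫ x in Ω, (a x * w x + ∑ j, c j x * q j x) =
      ∫ x in K₁, (a x * w x + ∑ j, c j x * q j x) := by
    refine setIntegral_eq_of_subset_of_forall_sdiff_eq_zero hΩ.measurableSet hK₁Ω fun x hx => ?_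
    have hxK : x ∉ K := fun hn => hx.2 (hKK₁ hn)
    simp [hwK x hxK, hqK _ x hxK]
  rw [hredw]
  have hiw : IntegrableOn (fun x => a x * w x + ∑ j, c j x * q j x) K₁ :=
    (((ha.mul hw.continuousOn).add (continuousOn_finsetSum _ fun j _ =>
      (hc j).mul (hw.weak j).1)).mono hK₁Ω).integrableOn_compact hK₁
  have hib : IntegrableOn (fun x => |a x| + ∑ j, |c j x|) K₁ :=
    ((ha.abs.add (continuousOn_finsetSum _ fun j _ => (hc j).abs)).mono
      hK₁Ω).integrableOn_compact hK₁
  set C := ∫ x in K₁, (|a x| + ∑ j, |c j x|)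
  -- The approximation within η is supported in `K₁` because η < r, hence is an admissible test
  -- function. Replacing `w` and `q` by it costs at most η times a fixed integral.
  have key : ∀ η : ℝ, 0 < η → η < r → |∫ x in K₁, (a x * w x + ∑ j, c j x * q j x)| ≤ η * C := by
    intro η hη hηr
    obtain ⟨F, hF, hFw, hFq, hFs⟩ := hw.exists_smooth_approx hα hΩ hK₁ hK₁Ω hη
    have hF' : ContDiff ℝ 1 F := hF.of_le (by simp)
    have hsupp : Function.support F ⊆ K₁ := by
      intro x hx
      obtain ⟨y, -, hy, hxy⟩ := hFs x hx
      have hyK : y ∈ K := by_contra fun hn => hy (hwK y hn)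
      exact Metric.mem_cthickening_of_dist_le x y r K hyK (hxy.le.trans hηr.le)
    have hts : tsupport F ⊆ K₁ := closure_minimal hsupp hK₁.isClosed
    have h0 := h F hF (HasCompactSupport.of_support_subset_isCompact hK₁ hsupp) (hts.trans hK₁Ω)
    have hredF : ∫ x in Ω, (a x * F x + ∑ j, c j x * fderiv ℝ F x (X α j x)) =
        ∫ x in K₁, (a x * F x + ∑ j, c j x * fderiv ℝ F x (X α j x)) := by
      refine setIntegral_eq_of_subset_of_forall_sdiff_eq_zero hΩ.measurableSet hK₁Ω fun x hx => ?_
      have h1 : F x = 0 := image_eq_zero_of_notMem_tsupport fun hn => hx.2 (hts hn)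
      have h2 : fderiv ℝ F x = 0 :=
        image_eq_zero_of_notMem_tsupport fun hn => hx.2 (hts (tsupport_fderiv_subset ℝ hn))
      simp [h1, h2]
    rw [hredF] at h0
    have hiF : IntegrableOn (fun x => a x * F x + ∑ j, c j x * fderiv ℝ F x (X α j x)) K₁ :=
      (((ha.mono hK₁Ω).mul hF'.continuous.continuousOn).add (continuousOn_finsetSum _ fun j _ =>
        ((hc j).mono hK₁Ω).mul
          (continuous_fderiv_X hα hF' j).continuousOn)).integrableOn_compact hK₁
    rw [← sub_zero (∫ x in K₁, (a x * w x + ∑ j, c j x * q j x)), ← h0, ← integral_sub hiw hiF,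
      ← integral_const_mul, ← Real.norm_eq_abs]
    refine norm_integral_le_of_norm_le (hib.const_mul η) ?_
    filter_upwards [ae_restrict_mem hK₁.measurableSet] with x hx
    have e1 : a x * w x + ∑ j, c j x * q j x -
        (a x * F x + ∑ j, c j x * fderiv ℝ F x (X α j x)) =
        -(a x * (F x - w x) + ∑ j, c j x * (fderiv ℝ F x (X α j x) - q j x)) := by
      simp only [mul_sub, Finset.sum_sub_distrib]
      ring
    rw [e1, norm_neg, mul_add, Finset.mul_sum, Real.norm_eq_abs]
    refine (abs_add_le _ _).trans (add_le_add ?_ ((Finset.abs_sum_le_sum_abs _ _).trans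
      (Finset.sum_le_sum fun j _ => ?_)))
    · rw [abs_mul, mul_comm]
      exact mul_le_mul_of_nonneg_right (hFw x hx) (abs_nonneg _)
    · rw [abs_mul, mul_comm]
      exact mul_le_mul_of_nonneg_right (hFq j x hx) (abs_nonneg _)
  have hlim : Tendsto (fun η : ℝ => η * C) (𝓝[>] 0) (𝓝 0) := by
    have : Tendsto (fun η : ℝ => η * C) (𝓝 0) (𝓝 (0 * C)) :=
      (continuous_id.mul continuous_const).tendsto 0
    rw [zero_mul] at this
    exact this.mono_left nhdsWithin_le_nhds
  have := ge_of_tendsto hlim (b := |∫ x in K₁, (a x * w x + ∑ j, c j x * q j x)|) (by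
    filter_upwards [Ioo_mem_nhdsGT hr] with η hη using key η hη.1 hη.2)
  exact abs_nonpos_iff.1 this

/-- The power of |z| is constant along t-directions, so it passes through the derivative even where
it is not differentiable. -/
theorem hasLineDerivAt_mul_X {f : Space m k → ℝ} {f' : Space m k →L[ℝ] ℝ} {x : Space m k}
    (hf : HasFDerivAt f f' x) (j : Fin k) (p : ℝ) :
    HasLineDerivAt ℝ (fun x => normZ x ^ p / 2 * f x)
      (normZ x ^ p / 2 * f' (EuclideanSpace.single (Sum.inr j) 1)) x
      (EuclideanSpace.single (Sum.inr j) 1) := by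
  have h1 : HasDerivAt (fun t : ℝ => f (x + t • EuclideanSpace.single (Sum.inr j) (1 : ℝ)))
      (f' (EuclideanSpace.single (Sum.inr j) 1)) 0 := hf.hasLineDerivAt _
  have h2 : ∀ t : ℝ, normZ (x + t • EuclideanSpace.single (Sum.inr j) (1 : ℝ)) = normZ x := by
    intro t
    simp [normZ]
  have h3 : HasDerivAt (fun t : ℝ => normZ x ^ p / 2 *
      f (x + t • EuclideanSpace.single (Sum.inr j) (1 : ℝ))) _ 0 :=
    h1.const_mul (normZ x ^ p / 2)
  unfold HasLineDerivAt
  simpa only [h2] using h3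

/-- Continuously differentiable functions have their classical derivatives as weak derivatives. -/
theorem ContDiff.hasWeakGrad (hα : 0 < α) {f : Space m k → ℝ} (hf : ContDiff ℝ 1 f)
    (Ω : Set (Space m k)) : HasWeakGrad α Ω f fun j x => fderiv ℝ f x (X α j x) := by
  refine ⟨hf.continuous.continuousOn, fun j => ⟨(continuous_fderiv_X hα hf j).continuousOn,
    fun φ hφ hφc hφΩ => ?_⟩⟩
  have hφ' : ContDiff ℝ 1 φ := hφ.of_le (by simp)
  have hfd : ∀ x, HasFDerivAt f (fderiv ℝ f x) x := fun x =>
    (hf.differentiable one_ne_zero x).hasFDerivAt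
  have hφd : ∀ x, HasFDerivAt φ (fderiv ℝ φ x) x := fun x =>
    (hφ'.differentiable one_ne_zero x).hasFDerivAt
  have hts := tsupport_fderiv_X_subset (α := α) φ j
  rw [setIntegral_eq_integral_of_forall_compl_eq_zero,
    setIntegral_eq_integral_of_forall_compl_eq_zero]
  rotate_left
  · intro x hx
    rw [image_eq_zero_of_notMem_tsupport fun hn => hx (hφΩ hn), mul_zero]
  · intro x hx
    have h1 : φ x = 0 := image_eq_zero_of_notMem_tsupport fun hn => hx (hφΩ hn)
    have h2 : fderiv ℝ φ x (X α j x) = 0 :=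
      image_eq_zero_of_notMem_tsupport (f := fun x => fderiv ℝ φ x (X α j x))
        fun hn => hx (hφΩ (hts hn))
    rw [h1, h2]
    simp
  simp only [zero_mul, add_zero]
  have hcs : HasCompactSupport fun x => fderiv ℝ φ x (X α j x) :=
    hφc.mono' ((subset_tsupport _).trans hts)
  have i1 : Integrable fun x => f x * φ x :=
    (hf.continuous.mul hφ'.continuous).integrable_of_hasCompactSupport hφc.mul_left
  have i2 : Integrable fun x => fderiv ℝ f x (X α j x) * φ x :=
    ((continuous_fderiv_X hα hf j).mul hφ'.continuous).integrable_of_hasCompactSupport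
      hφc.mul_left
  have i3 : Integrable fun x => f x * fderiv ℝ φ x (X α j x) :=
    (hf.continuous.mul (continuous_fderiv_X hα hφ' j)).integrable_of_hasCompactSupport
      hcs.mul_left
  cases j with
  | inl i =>
    exact integral_bilinear_hasLineDerivAt_right_eq_neg_left_of_integrable
      (v := EuclideanSpace.single (Sum.inl i) 1) (B := ContinuousLinearMap.mul ℝ ℝ) i2 i3 i1
      (fun x _ => (hfd x).hasLineDerivAt _) (fun x _ => (hφd x).hasLineDerivAt _)
  | inr j =>
    have hcw : Continuous fun x : Space m k => normZ x ^ α / 2 :=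
      (continuous_normZ.rpow_const fun x => Or.inr hα.le).div_const 2
    have hX : ∀ h : Space m k → ℝ, ∀ x, fderiv ℝ h x (X α (Sum.inr j) x) =
        normZ x ^ α / 2 * fderiv ℝ h x (EuclideanSpace.single (Sum.inr j) 1) := by
      intro h x
      simp [X]
    simp only [hX] at i2 i3 ⊢
    -- The coefficient |z|^α/2 is attached to `f`. Integration by parts along t_j requires only line
    -- derivatives in that direction.
    have h := integral_bilinear_hasLineDerivAt_right_eq_neg_left_of_integrable (μ := volume)
      (f := fun x => normZ x ^ α / 2 * f x) (g := φ)
      (v := EuclideanSpace.single (Sum.inr j) 1) (B := ContinuousLinearMap.mul ℝ ℝ) i2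
      (by simpa only [ContinuousLinearMap.mul_apply', mul_assoc, mul_left_comm] using i3)
      (((hcw.mul hf.continuous).mul hφ'.continuous).integrable_of_hasCompactSupport hφc.mul_left)
      (fun x _ => hasLineDerivAt_mul_X (hfd x) j α) (fun x _ => (hφd x).hasLineDerivAt _)
    simp only [ContinuousLinearMap.mul_apply'] at h
    rw [← h]
    congr 1
    funext x
    ring

/-- The product rule for a weakly differentiable function and a `C¹` function. -/
theorem HasWeakGrad.mul_contDiff (hα : 0 < α) {Ω : Set (Space m k)} (hΩ : IsOpen Ω)
    {v : Space m k → ℝ} {q : Fin m ⊕ Fin k → Space m k → ℝ} (hv : HasWeakGrad α Ω v q)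
    {c : Space m k → ℝ} (hc : ContDiff ℝ 1 c) :
    HasWeakGrad α Ω (fun x => c x * v x)
      fun j x => c x * q j x + v x * fderiv ℝ c x (X α j x) := by
  refine ⟨hc.continuous.continuousOn.mul hv.continuousOn, fun j => ⟨?_, fun φ hφ hφc hφΩ => ?_⟩⟩
  · exact (hc.continuous.continuousOn.mul (hv.weak j).1).add
      (hv.continuousOn.mul (continuous_fderiv_X hα hc j).continuousOn)
  have hφ' : ContDiff ℝ 1 φ := hφ.of_le (by simp)
  have hcφ : ContDiff ℝ 1 fun x => c x * φ x := hc.mul hφ'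
  have hder : ∀ x v, fderiv ℝ (fun x => c x * φ x) x v =
      c x * fderiv ℝ φ x v + φ x * fderiv ℝ c x v := by
    intro x v
    rw [fderiv_fun_mul (hc.differentiable one_ne_zero x) (hφ'.differentiable one_ne_zero x)]
    simp
  have hts : tsupport (fun x => c x * φ x) ⊆ tsupport φ := tsupport_mul_subset_right
  -- The product cφ is the natural test function for the weak derivative of `v`, but it is only C¹,
  -- so the defining identity is first extended by approximation.
  have h0 := (ContDiff.hasWeakGrad hα hcφ Ω).integral_eq_zero_of_forall_smooth hα hΩ hφc hφΩ
    (fun x hx => image_eq_zero_of_notMem_tsupport (f := fun x => c x * φ x)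
      fun hn => hx (hts hn))
    (fun i x hx => image_eq_zero_of_notMem_tsupport
      (f := fun x => fderiv ℝ (fun x => c x * φ x) x (X α i x))
      fun hn => hx (hts (tsupport_fderiv_X_subset _ i hn)))
    (a := q j) (c := fun i x => if i = j then v x else 0) (hv.weak j).1
    (fun i => by
      by_cases h : i = j
      · simpa [h] using hv.continuousOn
      · simpa [h] using continuousOn_const)
    (fun θ hθ hθc hθΩ => by
      have hθ' : ContDiff ℝ 1 θ := hθ.of_le (by simp)
      have h1 := (hv.weak j).2 θ hθ hθc hθΩ
      have hi1 : IntegrableOn (fun x => q j x * θ x) Ω :=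
        (integrable_mul_of_tsupport_subset (hv.weak j).1 hθ'.continuous hθc hθΩ).integrableOn
      have hi2 : IntegrableOn (fun x => v x * fderiv ℝ θ x (X α j x)) Ω :=
        (integrable_mul_of_tsupport_subset hv.continuousOn (continuous_fderiv_X hα hθ' j)
          (hθc.mono' ((subset_tsupport _).trans (tsupport_fderiv_X_subset θ j)))
          ((tsupport_fderiv_X_subset θ j).trans hθΩ)).integrableOn
      simp only [ite_mul, zero_mul, add_zero, Finset.sum_ite_eq', Finset.mem_univ, if_true]
        at h1 ⊢
      rw [integral_add hi1 hi2, h1, add_neg_cancel])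
  simp only [ite_mul, zero_mul, add_zero, Finset.sum_ite_eq', Finset.mem_univ, if_true] at h0 ⊢
  have hi1 : IntegrableOn (fun x => c x * v x * fderiv ℝ φ x (X α j x)) Ω :=
    (integrable_mul_of_tsupport_subset (hc.continuous.continuousOn.mul hv.continuousOn)
      (continuous_fderiv_X hα hφ' j)
      (hφc.mono' ((subset_tsupport _).trans (tsupport_fderiv_X_subset φ j)))
      ((tsupport_fderiv_X_subset φ j).trans hφΩ)).integrableOn
  have hi2 : IntegrableOn (fun x => (c x * q j x + v x * fderiv ℝ c x (X α j x)) * φ x) Ω :=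
    (integrable_mul_of_tsupport_subset ((hc.continuous.continuousOn.mul (hv.weak j).1).add
      (hv.continuousOn.mul (continuous_fderiv_X hα hc j).continuousOn)) hφ'.continuous hφc
      hφΩ).integrableOn
  rw [eq_neg_iff_add_eq_zero, ← integral_add hi1 hi2, ← h0]
  congr 1
  funext x
  rw [hder]
  ring

/-- A weak solution may be tested with compactly supported functions having continuous weak
derivatives `X_j`. -/
theorem IsWeakSol.integral_mul_eq_zero (hα : 0 < α) {Ω : Set (Space m k)} (hΩ : IsOpen Ω)
    {u : Space m k → ℝ} {g : Fin m ⊕ Fin k → Space m k → ℝ} (hu : IsWeakSol α Ω u g)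
    {w : Space m k → ℝ} {q : Fin m ⊕ Fin k → Space m k → ℝ}
    (hw : HasWeakGrad α Ω w q) {K : Set (Space m k)} (hK : IsCompact K) (hKΩ : K ⊆ Ω)
    (hwK : ∀ x, x ∉ K → w x = 0) (hqK : ∀ j x, x ∉ K → q j x = 0) :
    ∫ x in Ω, ∑ j, g j x * q j x = 0 := by
  have := hw.integral_eq_zero_of_forall_smooth hα hΩ hK hKΩ hwK hqK (a := fun _ => 0) (c := g)
    continuousOn_const (fun j => (hu.weak j).1)
    (fun φ hφ hφc hφΩ => by simpa using hu.integral_eq_zero φ hφ hφc hφΩ)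
  simpa using this

end

/-! ### Continuity, differentiation and polar integration over pseudo-spheres and pseudo-balls. -/

section

variable {m k : ℕ} {α : ℝ}

theorem ae_mem_sphere : ∀ᵐ y ∂(leray α 1 : Measure (Space m k)), y ∈ sphere α 1 :=
  leray_compl_sphere

theorem restrict_leray_sphere :
    (leray α 1 : Measure (Space m k)).restrict (sphere α 1) = leray α 1 :=
  Measure.restrict_eq_self_of_ae_mem ae_mem_sphere

/-- Differentiation under an integral over a compact set. -/
theorem hasDerivAt_setIntegral_of_isCompact {μ : Measure (Space m k)} [IsFiniteMeasureOnCompacts μ]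
    {K : Set (Space m k)} (hK : IsCompact K) {I : Set ℝ} (hI : IsOpen I)
    {H H' : ℝ → Space m k → ℝ} (hH : ContinuousOn (Function.uncurry H) (I ×ˢ K))
    (hH' : ContinuousOn (Function.uncurry H') (I ×ˢ K))
    (hder : ∀ r ∈ I, ∀ y ∈ K, HasDerivAt (fun r => H r y) (H' r y) r) {r₀ : ℝ} (hr₀ : r₀ ∈ I) :
    HasDerivAt (fun r => ∫ y in K, H r y ∂μ) (∫ y in K, H' r₀ y ∂μ) r₀ := by
  have : IsFiniteMeasure (μ.restrict K) := ⟨by simpa using hK.measure_lt_top⟩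
  obtain ⟨ε, hε, hεI⟩ := Metric.nhds_basis_closedBall.mem_iff.1 (hI.mem_nhds hr₀)
  obtain ⟨M, hM⟩ := ((isCompact_closedBall r₀ ε).prod hK).exists_bound_of_continuousOn
    (hH'.mono (prod_mono hεI Subset.rfl))
  have hslice : ∀ {H : ℝ → Space m k → ℝ},
      ContinuousOn (Function.uncurry H) (I ×ˢ K) → ∀ r ∈ I,
      IntegrableOn (H r) K μ := fun hH r hr =>
    (hH.comp (by fun_prop : ContinuousOn (fun y : Space m k => (r, y)) _)
      fun y hy => ⟨hr, hy⟩ : ContinuousOn _ K).integrableOn_compact hK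
  refine (hasDerivAt_integral_of_dominated_loc_of_deriv_le (bound := fun _ => M) (F' := H')
    (s := Metric.closedBall r₀ ε) (Metric.closedBall_mem_nhds r₀ hε) ?_ (hslice hH r₀ hr₀)
    (hslice hH' r₀ hr₀).aestronglyMeasurable ?_ (integrable_const M) ?_).2
  · filter_upwards [hI.mem_nhds hr₀] with r hr using (hslice hH r hr).aestronglyMeasurable
  · filter_upwards [ae_restrict_mem hK.measurableSet] with y hy r hr using hM (r, y) ⟨hr, hy⟩
  · filter_upwards [ae_restrict_mem hK.measurableSet] with y hy r hr using hder r (hεI hr) y hy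

variable (hα : 0 < α) (hm : 0 < m)
include hα

theorem rho_eq_one_of_mem_sphere {y : Space m k} (hy : y ∈ sphere α 1) : rho α y = 1 := by
  rwa [sphere_eq hα one_pos] at hy

theorem isCompact_sphere {r : ℝ} (hr : 0 < r) : IsCompact (sphere α r : Set (Space m k)) := by
  rw [sphere_eq hα hr]
  exact (isCompact_rho_le hα r).of_isClosed_subset
    (isClosed_eq (continuous_rho hα) continuous_const) fun x hx => le_of_eq hx

theorem dil_mem_punctured {R r : ℝ} (hr : r ∈ Ioo 0 R) {y : Space m k} (hy : y ∈ sphere α 1) :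
    dil α r y ∈ ball α R \ {0} := by
  refine ⟨?_, dil_ne_zero hα hr.1 (ne_zero_of_mem_sphere hα one_pos hy)⟩
  change rho α _ < R
  rw [rho_dil hα hr.1.le, rho_eq_one_of_mem_sphere hα hy, mul_one]
  exact hr.2

include hm

theorem integrable_leray {f : Space m k → ℝ} (hf : ContinuousOn f (sphere α 1)) :
    Integrable f (leray α 1) := by
  have := isFiniteMeasure_leray (m := m) (k := k) hα hm one_pos
  rw [← restrict_leray_sphere]
  exact hf.integrableOn_compact (isCompact_sphere hα one_pos)

theorem continuousOn_integral_leray {I : Set ℝ} (hI : IsOpen I) {H : ℝ → Space m k → ℝ}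
    (hH : ContinuousOn (Function.uncurry H) (I ×ˢ sphere α 1)) :
    ContinuousOn (fun r => ∫ y, H r y ∂(leray α 1)) I := by
  have := isFiniteMeasure_leray (m := m) (k := k) hα hm one_pos
  refine fun r₀ hr₀ => ContinuousAt.continuousWithinAt ?_
  obtain ⟨ε, hε, hεI⟩ := Metric.nhds_basis_closedBall.mem_iff.1 (hI.mem_nhds hr₀)
  obtain ⟨M, hM⟩ := ((isCompact_closedBall r₀ ε).prod
    (isCompact_sphere (m := m) (k := k) hα one_pos)).exists_bound_of_continuousOn
    (hH.mono (prod_mono hεI Subset.rfl))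
  have hnear : ∀ᶠ r in 𝓝 r₀, r ∈ Metric.closedBall r₀ ε := Metric.closedBall_mem_nhds r₀ hε
  refine continuousAt_of_dominated (bound := fun _ => M) ?_ ?_ (integrable_const M) ?_
  · filter_upwards [hnear] with r hr
    have h1 : ContinuousOn (H r) (sphere α 1) := hH.comp
      (by fun_prop : ContinuousOn (fun y : Space m k => (r, y)) _) fun y hy => ⟨hεI hr, hy⟩
    exact (integrable_leray hα hm h1).aestronglyMeasurable
  · filter_upwards [hnear] with r hr
    filter_upwards [ae_mem_sphere] with y hy using hM (r, y) ⟨hr, hy⟩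
  · filter_upwards [ae_mem_sphere] with y hy
    have h1 : ContinuousOn (fun r => H r y) I := hH.comp
      (by fun_prop : ContinuousOn (fun r : ℝ => (r, y)) _) fun r hr => ⟨hr, hy⟩
    exact h1.continuousAt (hI.mem_nhds hr₀)

theorem hasDerivAt_integral_leray {I : Set ℝ} (hI : IsOpen I) {H H' : ℝ → Space m k → ℝ}
    (hH : ContinuousOn (Function.uncurry H) (I ×ˢ sphere α 1))
    (hH' : ContinuousOn (Function.uncurry H') (I ×ˢ sphere α 1))
    (hder : ∀ r ∈ I, ∀ y ∈ sphere α 1, HasDerivAt (fun r => H r y) (H' r y) r)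
    {r₀ : ℝ} (hr₀ : r₀ ∈ I) :
    HasDerivAt (fun r => ∫ y, H r y ∂(leray α 1)) (∫ y, H' r₀ y ∂(leray α 1)) r₀ := by
  have := isFiniteMeasure_leray (m := m) (k := k) hα hm one_pos
  have := hasDerivAt_setIntegral_of_isCompact (μ := leray α 1) (isCompact_sphere hα one_pos) hI
    hH hH' hder hr₀
  rwa [restrict_leray_sphere] at this

theorem integral_polar {f : Space m k → ℝ} (hf : Integrable f) :
    ∫ x, f x = ∫ r in Ioi 0, r ^ (homDim m k α - 1) * ∫ y, f (dil α r y) ∂(leray α 1) := by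
  have := isFiniteMeasure_leray (m := m) (k := k) hα hm one_pos
  have hv := volume_eq_map_polar (m := m) (k := k) hα hm
  have hf' := hf
  rw [hv] at hf'
  have : SFinite (radial m k α) := by unfold radial; infer_instance
  have hfp : Integrable (fun q : ℝ × Space m k => f (dil α q.1 q.2))
      ((radial m k α).prod (leray α 1)) :=
    (integrable_map_measure hf'.aestronglyMeasurable measurable_dil.aemeasurable).1 hf'
  rw [hv, integral_map measurable_dil.aemeasurable hf'.aestronglyMeasurable,
    integral_prod _ hfp, radial, integral_withDensity_eq_integral_toReal_smul
      measurable_radial_weight (Eventually.of_forall fun r => ENNReal.ofReal_lt_top)]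
  refine setIntegral_congr_fun measurableSet_Ioi fun r hr => ?_
  have hr : 0 < r := hr
  simp only [smul_eq_mul]
  rw [ENNReal.toReal_ofReal (by positivity)]

theorem volume_rho_eq {s : ℝ} : volume {x : Space m k | rho α x = s} = 0 := by
  have := isFiniteMeasure_leray (m := m) (k := k) hα hm one_pos
  have hms := measurableSet_rho_eq (m := m) (k := k) hα s
  rw [volume_eq_map_polar hα hm, Measure.map_apply measurable_dil hms]
  have hsub : (fun q : ℝ × Space m k => dil α q.1 q.2) ⁻¹' {x | rho α x = s} ⊆
      ((Iic 0 ×ˢ univ) ∪ ({s} ×ˢ univ)) ∪ (univ ×ˢ (sphere α 1)ᶜ) := by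
    rintro ⟨r, y⟩ hq
    by_cases hy : y ∈ sphere α 1
    · by_cases hr : r ≤ 0
      · exact Or.inl (Or.inl ⟨hr, mem_univ _⟩)
      · refine Or.inl (Or.inr ⟨?_, mem_univ _⟩)
        have hq : rho α (dil α r y) = s := hq
        rwa [rho_dil hα (not_le.1 hr).le, rho_eq_one_of_mem_sphere hα hy, mul_one] at hq
    · exact Or.inr ⟨mem_univ _, hy⟩
  refine measure_mono_null hsub (measure_union_null (measure_union_null ?_ ?_) ?_)
  · rw [Measure.prod_prod, radial, withDensity_apply _ measurableSet_Iic,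
      Measure.restrict_restrict measurableSet_Iic, Iic_inter_Ioi, Ioc_self]
    simp
  · rw [Measure.prod_prod, radial, withDensity_apply _ (measurableSet_singleton s)]
    have : ((volume : Measure ℝ).restrict (Ioi 0)).restrict {s} = 0 := by
      rw [Measure.restrict_eq_zero]
      exact measure_mono_null Subset.rfl (by simp)
    simp [this]
  · rw [Measure.prod_prod, leray_compl_sphere, mul_zero]

/-- The indicator of the pseudo-ball of radius s is locally constant in s, near s₀, at points off
the pseudo-sphere of radius s₀, which is a null set. Dominated convergence then applies. -/
theorem continuousOn_integral_ball {R : ℝ} {F : Space m k → ℝ} (hF : ContinuousOn F (ball α R)) :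
    ContinuousOn (fun s => ∫ x in ball α s, F x) (Iio R) := by
  refine fun s₀ hs₀ => ContinuousAt.continuousWithinAt ?_
  obtain ⟨b, hsb, hbR⟩ := exists_between (mem_Iio.1 hs₀)
  set K : Set (Space m k) := {x | rho α x ≤ b}
  have hK : IsCompact K := isCompact_rho_le hα b
  have hKR : K ⊆ ball α R := fun x hx => lt_of_le_of_lt (show rho α x ≤ b from hx) hbR
  have hint : Integrable (K.indicator F) :=
    ((hF.mono hKR).integrableOn_compact hK).integrable_indicator hK.measurableSet
  have heq : ∀ s < b, ∫ x in ball α s, F x = ∫ x, (ball α s).indicator (K.indicator F) x := by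
    intro s hs
    rw [integral_indicator (isOpen_ball hα s).measurableSet]
    refine setIntegral_congr_fun (isOpen_ball hα s).measurableSet fun x hx => ?_
    have hx : rho α x < s := hx
    have hxK : x ∈ K := (hx.trans hs).le
    simp [hxK]
  have hc : ContinuousAt (fun s => ∫ x, (ball α s).indicator (K.indicator F) x) s₀ := by
    refine continuousAt_of_dominated (bound := fun x => ‖K.indicator F x‖) ?_ ?_ hint.norm ?_
    · exact Eventually.of_forall fun s =>
        hint.aestronglyMeasurable.indicator (isOpen_ball hα s).measurableSet
    · exact Eventually.of_forall fun s => Eventually.of_forall fun x =>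
        norm_indicator_le_norm_self _ _
    · have h0 : ∀ᵐ x : Space m k, rho α x ≠ s₀ := by
        rw [ae_iff]
        simpa using volume_rho_eq hα hm
      filter_upwards [h0] with x hx
      rcases lt_or_gt_of_ne hx with h | h
      · refine (continuousAt_const (y := K.indicator F x)).congr ?_
        filter_upwards [lt_mem_nhds h] with s hs
        rw [indicator_of_mem (show x ∈ ball α s from hs)]
      · refine (continuousAt_const (y := (0 : ℝ))).congr ?_
        filter_upwards [gt_mem_nhds h] with s hs
        rw [indicator_of_notMem (show x ∉ ball α s from fun hn => lt_asymm hs hn)]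
  refine hc.congr ?_
  filter_upwards [gt_mem_nhds hsb] with s hs using (heq s hs).symm

end

/-! ### Green's identity by radial cutoffs. -/

section

variable {m k : ℕ} {α : ℝ}

/-- The conormal density `∑_j g_j X_j ρ_α`. -/
def flux (α : ℝ) (g : Fin m ⊕ Fin k → Space m k → ℝ) (x : Space m k) : ℝ :=
  ∑ j, g j x * fderiv ℝ (rho α) x (X α j x)

theorem exists_Icc_of_compact_subset_Ioo {T : Set ℝ} (hT : IsCompact T) {R : ℝ} (hR : 0 < R)
    (hTR : T ⊆ Ioo 0 R) : ∃ a b, 0 < a ∧ a < b ∧ b < R ∧ T ⊆ Ioo a b := by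
  have hT' : IsCompact (insert (R / 2) T) := hT.insert _
  have hne : (insert (R / 2) T).Nonempty := ⟨_, mem_insert _ _⟩
  have hsub : insert (R / 2) T ⊆ Ioo 0 R :=
    insert_subset ⟨by positivity, half_lt_self hR⟩ hTR
  obtain ⟨p, hp, hpmin⟩ := hT'.exists_isLeast hne
  obtain ⟨q, hq, hqmax⟩ := hT'.exists_isGreatest hne
  have h1 := hsub hp
  have h2 := hsub hq
  have h3 : p ≤ q := hpmin hq
  refine ⟨p / 2, (q + R) / 2, by linarith [h1.1], by linarith [h1.1, h2.2], by linarith [h2.2],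
    fun t ht => ⟨?_, ?_⟩⟩
  · have : p ≤ t := hpmin (mem_insert_of_mem _ ht)
    linarith [h1.1]
  · have : t ≤ q := hqmax (mem_insert_of_mem _ ht)
    linarith [h2.2]

/-- The radial cutoff with profile `-g`. -/
def cutoff (R : ℝ) (g : ℝ → ℝ) (t : ℝ) : ℝ := ∫ s in t..R, g s

theorem hasDerivAt_cutoff {g : ℝ → ℝ} (hg : Continuous g) (R t : ℝ) :
    HasDerivAt (cutoff R g) (-g t) t :=
  intervalIntegral.integral_hasDerivAt_left (hg.intervalIntegrable _ _)
    hg.stronglyMeasurable.stronglyMeasurableAtFilter hg.continuousAt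

theorem contDiff_cutoff {g : ℝ → ℝ} (hg : Continuous g) (R : ℝ) : ContDiff ℝ 1 (cutoff R g) := by
  rw [contDiff_one_iff_deriv]
  refine ⟨fun t => (hasDerivAt_cutoff hg R t).differentiableAt, ?_⟩
  have : deriv (cutoff R g) = fun t => -g t := funext fun t => (hasDerivAt_cutoff hg R t).deriv
  rw [this]
  exact hg.neg

theorem cutoff_eq_zero {g : ℝ → ℝ} {b R : ℝ} (hgb : ∀ t, b ≤ t → g t = 0) (hbR : b ≤ R) {t : ℝ}
    (ht : b ≤ t) : cutoff R g t = 0 := by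
  refine intervalIntegral.integral_zero_ae (Eventually.of_forall fun s hs => hgb s ?_)
  have := (uIoc_subset_uIcc hs).1
  exact (le_min ht hbR).trans this

theorem cutoff_eq_of_le {g : ℝ → ℝ} (hg : Continuous g) {a R : ℝ} (hga : ∀ t, t ≤ a → g t = 0)
    {t : ℝ} (ht : t ≤ a) : cutoff R g t = cutoff R g a := by
  have h1 : ∫ s in t..a, g s = 0 := by
    refine intervalIntegral.integral_zero_ae (Eventually.of_forall fun s hs => hga s ?_)
    rw [uIoc_of_le ht] at hs
    exact hs.2
  have h2 := intervalIntegral.integral_add_adjacent_intervals (hg.intervalIntegrable (μ := volume) t a)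
    (hg.intervalIntegrable a R)
  rw [h1, zero_add] at h2
  exact h2.symm

theorem cutoff_eq_integral_indicator {g : ℝ → ℝ} {b R : ℝ} (hgb : ∀ t, b ≤ t → g t = 0)
    (hbR : b ≤ R) {t : ℝ} (ht : t ≤ R) : cutoff R g t = ∫ s, (Ioi t).indicator g s := by
  rw [integral_indicator measurableSet_Ioi, cutoff, intervalIntegral.integral_of_le ht]
  refine (setIntegral_eq_of_subset_of_forall_sdiff_eq_zero measurableSet_Ioi
    (fun s hs => hs.1) fun s hs => hgb s ?_).symm
  by_contra hn
  exact hs.2 ⟨hs.1, (not_le.1 hn).le.trans hbR⟩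

variable (hα : 0 < α) (hm : 0 < m)
include hα

/-- Differentiability of ρ is available only away from the origin. There is no difficulty at the
origin, because `g` vanishes on (-∞, a] and the cutoff is constant near it. -/
theorem contDiff_cutoff_rho {g : ℝ → ℝ} (hg : Continuous g) {a R : ℝ} (ha : 0 < a)
    (hga : ∀ t, t ≤ a → g t = 0) :
    ContDiff ℝ 1 fun x : Space m k => cutoff R g (rho α x) := by
  rw [contDiff_iff_contDiffAt]
  intro x
  by_cases hx : x = 0
  · subst hx
    refine (contDiffAt_const (c := cutoff R g a)).congr_of_eventuallyEq ?_
    have h0 : rho α (0 : Space m k) < a := by rwa [rho_zero hα]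
    filter_upwards [(continuous_rho hα).continuousAt.eventually (gt_mem_nhds h0)] with y hy
    exact cutoff_eq_of_le hg hga hy.le
  · exact (contDiff_cutoff hg R).contDiffAt.comp x (contDiffAt_rho hα hx)

theorem fderiv_cutoff_rho {g : ℝ → ℝ} (hg : Continuous g) {a R : ℝ} (ha : 0 < a)
    (hga : ∀ t, t ≤ a → g t = 0) (x v : Space m k) :
    fderiv ℝ (fun x : Space m k => cutoff R g (rho α x)) x v =
      -(g (rho α x) * fderiv ℝ (rho α) x v) := by
  by_cases hx : x = 0
  · subst hx
    have h0 : rho α (0 : Space m k) < a := by rwa [rho_zero hα]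
    have h1 : (fun x : Space m k => cutoff R g (rho α x)) =ᶠ[𝓝 0] fun _ => cutoff R g a := by
      filter_upwards [(continuous_rho hα).continuousAt.eventually (gt_mem_nhds h0)] with y hy
      exact cutoff_eq_of_le hg hga hy.le
    rw [h1.fderiv_eq, hga _ h0.le]
    simp
  · have h1 : HasFDerivAt (rho α) (fderiv ℝ (rho α) x) x :=
      ((contDiffAt_rho hα hx).differentiableAt one_ne_zero).hasFDerivAt
    have h2 := (hasDerivAt_cutoff hg R (rho α x)).comp_hasFDerivAt x h1
    have h3 : HasFDerivAt (fun x : Space m k => cutoff R g (rho α x)) _ x := h2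
    rw [h3.fderiv]
    simp

theorem continuousOn_flux {R : ℝ} {g : Fin m ⊕ Fin k → Space m k → ℝ}
    (hg : ∀ j, ContinuousOn (g j) (ball α R)) : ContinuousOn (flux α g) (ball α R \ {0}) := by
  refine continuousOn_finsetSum _ fun j _ => ((hg j).mono sdiff_subset).mul fun x hx => ?_
  have h1 : ContinuousAt (fderiv ℝ (rho α)) x :=
    ((contDiffAt_rho hα hx.2).fderiv_right (m := 0) (by norm_num)).continuousAt
  exact (h1.clm_apply (continuous_X hα j).continuousAt).continuousWithinAt

omit hα in
theorem continuousOn_dil :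
    ContinuousOn (fun q : ℝ × Space m k => dil α q.1 q.2) (Ioi 0 ×ˢ univ) := by
  have : ∀ i, ContinuousOn (fun q : ℝ × Space m k => dil α q.1 q.2 i) (Ioi 0 ×ˢ univ) := by
    intro i
    simp only [dil_apply]
    exact (continuousOn_fst.rpow_const fun q hq => Or.inl (ne_of_gt hq.1)).mul
      (by fun_prop : Continuous fun q : ℝ × Space m k => q.2 i).continuousOn
  exact (PiLp.continuous_toLp 2 _).comp_continuousOn (continuousOn_pi.2 this)

theorem continuousOn_comp_dil {R : ℝ} {f : Space m k → ℝ} (hf : ContinuousOn f (ball α R \ {0})) :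
    ContinuousOn (Function.uncurry fun r (y : Space m k) => f (dil α r y))
      (Ioo 0 R ×ˢ sphere α 1) := by
  exact hf.comp (continuousOn_dil.mono (prod_mono Ioo_subset_Ioi_self (subset_univ _)))
    fun q hq => dil_mem_punctured hα hq.1 hq.2

/-- The profile confines the integrand to a closed annulus a ≤ ρ ≤ b. This matters because the flux
is continuous only away from the origin. -/
theorem integrable_radial_mul {R : ℝ} {f : Space m k → ℝ} (hf : ContinuousOn f (ball α R \ {0}))
    {g : ℝ → ℝ} (hg : Continuous g) {a b : ℝ} (ha : 0 < a) (hbR : b < R)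
    (hga : ∀ t, t ≤ a → g t = 0) (hgb : ∀ t, b ≤ t → g t = 0) :
    Integrable fun x => g (rho α x) * f x := by
  have hsub : Function.support (fun x : Space m k => g (rho α x)) ⊆
      {x | rho α x ≤ b} ∩ {x | a ≤ rho α x} := fun x hx => by
    constructor
    · by_contra hn
      exact hx (hgb _ (not_le.1 (show ¬ rho α x ≤ b from hn)).le)
    · by_contra hn
      exact hx (hga _ (not_le.1 (show ¬ a ≤ rho α x from hn)).le)
  have hK := isCompact_rho_le (m := m) (k := k) hα b
  have hclosed : IsClosed ({x : Space m k | rho α x ≤ b} ∩ {x | a ≤ rho α x}) :=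
    hK.isClosed.inter (isClosed_le continuous_const (continuous_rho hα))
  have hct : tsupport (fun x : Space m k => g (rho α x)) ⊆ ball α R \ {0} := by
    refine (closure_minimal hsub hclosed).trans fun x hx =>
      ⟨lt_of_le_of_lt (show rho α x ≤ b from hx.1) hbR, ?_⟩
    rintro rfl
    have h1 : a ≤ rho α (0 : Space m k) := hx.2
    rw [rho_zero hα] at h1
    linarith
  have hcc : HasCompactSupport (fun x : Space m k => g (rho α x)) :=
    HasCompactSupport.of_support_subset_isCompact hK (hsub.trans inter_subset_left)
  have := integrable_mul_of_tsupport_subset (μ := volume) hf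
    (hg.comp (continuous_rho hα)) hcc hct
  simpa only [mul_comm, Function.comp_apply] using this

/-- The integrated Green identity, tested with a radial cutoff. -/
theorem IsWeakSol.integral_cutoff_eq {R : ℝ} {u v : Space m k → ℝ}
    {gu gv : Fin m ⊕ Fin k → Space m k → ℝ} (hu : IsWeakSol α (ball α R) u gu)
    (hv : HasWeakGrad α (ball α R) v gv) {g : ℝ → ℝ} (hg : Continuous g) {a b : ℝ}
    (ha : 0 < a) (hbR : b < R) (hga : ∀ t, t ≤ a → g t = 0) (hgb : ∀ t, b ≤ t → g t = 0) :
    ∫ x in ball α R, cutoff R g (rho α x) * ∑ j, gu j x * gv j x =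
      ∫ x in ball α R, g (rho α x) * (v x * flux α gu x) := by
  have hΩ := isOpen_ball (m := m) (k := k) hα R
  set c : Space m k → ℝ := fun x => cutoff R g (rho α x)
  have hc : ContDiff ℝ 1 c := contDiff_cutoff_rho hα hg ha hga
  set K : Set (Space m k) := {x | rho α x ≤ b}
  have hK : IsCompact K := isCompact_rho_le hα b
  have hKΩ : K ⊆ ball α R := fun x hx => lt_of_le_of_lt (show rho α x ≤ b from hx) hbR
  have hcK : ∀ x, x ∉ K → c x = 0 := fun x hx =>
    cutoff_eq_zero hgb hbR.le (not_le.1 (show ¬ rho α x ≤ b from hx)).le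
  have hgK : ∀ x, x ∉ K → g (rho α x) = 0 := fun x hx =>
    hgb _ (not_le.1 (show ¬ rho α x ≤ b from hx)).le
  have h0 := hu.integral_mul_eq_zero hα hΩ (hv.mul_contDiff hα hΩ hc) hK hKΩ
    (fun x hx => by rw [hcK x hx, zero_mul])
    (fun j x hx => by
      rw [fderiv_cutoff_rho hα hg ha hga, hcK x hx, hgK x hx]
      ring)
  have hi1 : IntegrableOn (fun x => c x * ∑ j, gu j x * gv j x) (ball α R) := by
    have hcc : HasCompactSupport c :=
      HasCompactSupport.of_support_subset_isCompact hK fun x hx => by_contra fun hn => hx (hcK x hn)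
    have hct : tsupport c ⊆ ball α R :=
      (closure_minimal (s := Function.support c) (fun x hx => by_contra fun hn => hx (hcK x hn))
        hK.isClosed).trans hKΩ
    have hF : ContinuousOn (fun x => ∑ j, gu j x * gv j x) (ball α R) :=
      continuousOn_finsetSum _ fun j _ => (hu.weak j).1.mul (hv.weak j).1
    have := integrable_mul_of_tsupport_subset (μ := volume) hF hc.continuous hcc hct
    simpa only [mul_comm] using this.integrableOn
  have hi2 : IntegrableOn (fun x => g (rho α x) * (v x * flux α gu x)) (ball α R) := by
    exact (integrable_radial_mul hα ((hv.continuousOn.mono sdiff_subset).mul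
      (continuousOn_flux hα fun j => (hu.weak j).1)) hg ha hbR hga hgb).integrableOn
  rw [← sub_eq_zero, ← integral_sub hi1 hi2, ← h0]
  congr 1
  funext x
  simp only [fderiv_cutoff_rho hα hg ha hga, flux, Finset.mul_sum, ← Finset.sum_sub_distrib, c]
  refine Finset.sum_congr rfl fun j _ => ?_
  ring

/-- Fubini on the region ρ(x) < s: inside the pseudo-ball the cutoff at `x` is the integral of `g`
over s > ρ(x). -/
theorem integral_cutoff_mul {R : ℝ} {F : Space m k → ℝ} (hF : ContinuousOn F (ball α R))
    {g : ℝ → ℝ} (hg : Continuous g) {a b : ℝ} (hbR : b < R) (hga : ∀ t, t ≤ a → g t = 0)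
    (hgb : ∀ t, b ≤ t → g t = 0) :
    ∫ x in ball α R, cutoff R g (rho α x) * F x = ∫ s, g s * ∫ x in ball α s, F x := by
  set K : Set (Space m k) := {x | rho α x ≤ b}
  have hK : IsCompact K := isCompact_rho_le hα b
  have hKΩ : K ⊆ ball α R := fun x hx => lt_of_le_of_lt (show rho α x ≤ b from hx) hbR
  have hFi : Integrable (K.indicator F) :=
    ((hF.mono hKΩ).integrableOn_compact hK).integrable_indicator hK.measurableSet
  have hgi : Integrable g := hg.integrable_of_hasCompactSupport
    (HasCompactSupport.of_support_subset_isCompact (isCompact_Icc (a := a) (b := b))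
      fun t ht => ⟨by_contra fun hn => ht (hga t (not_le.1 hn).le),
        by_contra fun hn => ht (hgb t (not_le.1 hn).le)⟩)
  set T : Set (Space m k × ℝ) := {p | rho α p.1 < p.2}
  have hT : MeasurableSet T :=
    (isOpen_lt ((continuous_rho hα).comp continuous_fst) continuous_snd).measurableSet
  have hint : Integrable (T.indicator fun p : Space m k × ℝ => K.indicator F p.1 * g p.2)
      (volume.prod volume) := (hFi.mul_prod hgi).indicator hT
  have hswap := integral_integral_swap
    (f := fun (x : Space m k) (s : ℝ) => T.indicator (fun p => K.indicator F p.1 * g p.2) (x, s))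
    hint
  have hL : ∀ x, ∫ s, T.indicator (fun p => K.indicator F p.1 * g p.2) (x, s) =
      (ball α R).indicator (fun x => cutoff R g (rho α x) * F x) x := by
    intro x
    by_cases hx : x ∈ K
    · have h1 : ∀ s, T.indicator (fun p => K.indicator F p.1 * g p.2) (x, s) =
          F x * (Ioi (rho α x)).indicator g s := by
        intro s
        by_cases hs : rho α x < s
        · rw [indicator_of_mem (show (x, s) ∈ T from hs), indicator_of_mem (mem_Ioi.2 hs),
            indicator_of_mem hx]
        · rw [indicator_of_notMem (show (x, s) ∉ T from hs),
            indicator_of_notMem (show s ∉ Ioi (rho α x) from hs), mul_zero]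
      simp_rw [h1]
      rw [integral_const_mul, ← cutoff_eq_integral_indicator hgb hbR.le (hKΩ hx).le,
        indicator_of_mem (hKΩ hx), mul_comm]
    · have h1 : ∀ s, T.indicator (fun p => K.indicator F p.1 * g p.2) (x, s) = 0 := by
        intro s
        simp [indicator, hx]
      simp only [h1, integral_zero]
      by_cases hxR : x ∈ ball α R
      · rw [indicator_of_mem hxR,
          cutoff_eq_zero hgb hbR.le (not_le.1 (show ¬ rho α x ≤ b from hx)).le, zero_mul]
      · rw [indicator_of_notMem hxR]
  simp_rw [hL] at hswap
  rw [integral_indicator (isOpen_ball hα R).measurableSet] at hswap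
  rw [hswap]
  refine integral_congr_ae (Eventually.of_forall fun s => ?_)
  change ∫ x, T.indicator (fun p => K.indicator F p.1 * g p.2) (x, s) = g s * ∫ x in ball α s, F x
  by_cases hs : s < b
  · have h1 : ∀ x, T.indicator (fun p => K.indicator F p.1 * g p.2) (x, s) =
        g s * (ball α s).indicator F x := by
      intro x
      by_cases hx : rho α x < s
      · rw [indicator_of_mem (show (x, s) ∈ T from hx), indicator_of_mem (show x ∈ ball α s from hx),
          indicator_of_mem (show x ∈ K from (hx.trans hs).le), mul_comm]
      · rw [indicator_of_notMem (show (x, s) ∉ T from hx),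
          indicator_of_notMem (show x ∉ ball α s from hx), mul_zero]
    simp_rw [h1]
    rw [integral_const_mul, integral_indicator (isOpen_ball hα s).measurableSet]
  · have h1 : g s = 0 := hgb s (not_lt.1 hs)
    simp [h1, indicator]

include hm in
theorem integral_radial_mul {R : ℝ} {f : Space m k → ℝ} (hf : ContinuousOn f (ball α R \ {0}))
    {g : ℝ → ℝ} (hg : Continuous g) {a b : ℝ} (ha : 0 < a) (hbR : b < R)
    (hga : ∀ t, t ≤ a → g t = 0) (hgb : ∀ t, b ≤ t → g t = 0) :
    ∫ x in ball α R, g (rho α x) * f x =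
      ∫ s, g s * (s ^ (homDim m k α - 1) * ∫ y, f (dil α s y) ∂(leray α 1)) := by
  have hzero : ∀ x, x ∉ ball α R → g (rho α x) * f x = 0 := fun x hx => by
    rw [hgb _ (hbR.le.trans (not_lt.1 (show ¬ rho α x < R from hx))), zero_mul]
  have hI : ∫ s, g s * (s ^ (homDim m k α - 1) * ∫ y, f (dil α s y) ∂(leray α 1)) =
      ∫ s in Ioi (0 : ℝ), g s * (s ^ (homDim m k α - 1) * ∫ y, f (dil α s y) ∂(leray α 1)) :=
    (setIntegral_eq_integral_of_forall_compl_eq_zero fun s hs => by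
      rw [hga s ((not_lt.1 (show ¬ 0 < s from hs)).trans ha.le), zero_mul]).symm
  rw [setIntegral_eq_integral_of_forall_compl_eq_zero hzero, hI,
    integral_polar hα hm (integrable_radial_mul hα hf hg ha hbR hga hgb)]
  refine setIntegral_congr_fun measurableSet_Ioi fun r hr => ?_
  have hr : 0 < r := hr
  have h1 : ∫ y, g (rho α (dil α r y)) * f (dil α r y) ∂(leray α 1) =
      ∫ y, g r * f (dil α r y) ∂(leray α 1) := by
    refine integral_congr_ae ?_
    filter_upwards [ae_mem_sphere] with y hy
    rw [rho_dil hα hr.le, rho_eq_one_of_mem_sphere hα hy, mul_one]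
  simp only [h1, integral_const_mul]
  ring

include hm in
/-- Green's identity on the pseudo-balls for weak solutions. -/
theorem IsWeakSol.green {R : ℝ} {u v : Space m k → ℝ}
    {gu gv : Fin m ⊕ Fin k → Space m k → ℝ} (hu : IsWeakSol α (ball α R) u gu)
    (hv : HasWeakGrad α (ball α R) v gv) {s : ℝ} (hs : s ∈ Ioo 0 R) :
    ∫ x in ball α s, ∑ j, gu j x * gv j x =
      s ^ (homDim m k α - 1) * ∫ y, v (dil α s y) * flux α gu (dil α s y) ∂(leray α 1) := by
  have hF : ContinuousOn (fun x => ∑ j, gu j x * gv j x) (ball α R) :=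
    continuousOn_finsetSum _ fun j _ => (hu.weak j).1.mul (hv.weak j).1
  have hf : ContinuousOn (fun x => v x * flux α gu x) (ball α R \ {0}) :=
    (hv.continuousOn.mono sdiff_subset).mul (continuousOn_flux hα fun j => (hu.weak j).1)
  set D : ℝ → ℝ := fun s => ∫ x in ball α s, ∑ j, gu j x * gv j x
  set I : ℝ → ℝ := fun s =>
    s ^ (homDim m k α - 1) * ∫ y, v (dil α s y) * flux α gu (dil α s y) ∂(leray α 1)
  have hD : ContinuousOn D (Ioo 0 R) :=
    (continuousOn_integral_ball hα hm hF).mono fun s hs => hs.2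
  have hI : ContinuousOn I (Ioo 0 R) :=
    (continuousOn_id.rpow_const fun s hs => Or.inl (ne_of_gt hs.1)).mul
      (continuousOn_integral_leray hα hm isOpen_Ioo (continuousOn_comp_dil hα hf))
  -- The identity integrated against every smooth profile `g` supported in (0,R) gives equality for
  -- almost every radius, and continuity in the radius gives it for all.
  have hae := isOpen_Ioo.ae_eq_zero_of_integral_contDiff_smul_eq_zero (μ := volume)
    (f := fun s => D s - I s) (U := Ioo 0 R)
    ((hD.sub hI).locallyIntegrableOn measurableSet_Ioo) (fun g hg hgc hgR => by
      obtain ⟨a, b, ha, -, hbR, hab⟩ :=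
        exists_Icc_of_compact_subset_Ioo hgc (hs.1.trans hs.2) hgR
      have hga : ∀ t, t ≤ a → g t = 0 := fun t ht =>
        image_eq_zero_of_notMem_tsupport fun hn => absurd (hab hn).1 (not_lt.2 ht)
      have hgb : ∀ t, b ≤ t → g t = 0 := fun t ht =>
        image_eq_zero_of_notMem_tsupport fun hn => absurd (hab hn).2 (not_lt.2 ht)
      have h1 := hu.integral_cutoff_eq hα hv hg.continuous ha hbR hga hgb
      rw [integral_cutoff_mul hα hF hg.continuous hbR hga hgb,
        integral_radial_mul hα hm hf hg.continuous ha hbR hga hgb] at h1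
      have i1 : Integrable fun s => g s * D s := by
        simpa only [mul_comm] using
          integrable_mul_of_tsupport_subset (μ := volume) hD hg.continuous hgc hgR
      have i2 : Integrable fun s => g s * I s := by
        simpa only [mul_comm] using
          integrable_mul_of_tsupport_subset (μ := volume) hI hg.continuous hgc hgR
      simp only [smul_eq_mul, mul_sub]
      rw [integral_sub i1 i2, sub_eq_zero]
      exact h1)
  have heq : D =ᵐ[volume.restrict (Ioo 0 R)] I := by
    rw [EventuallyEq, ae_restrict_iff' measurableSet_Ioo]
    filter_upwards [hae] with t ht hts using sub_eq_zero.1 (ht hts)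
  exact Measure.eqOn_open_of_ae_eq heq isOpen_Ioo hD hI hs

end

/-! ### The conormal derivative as a derivative along the dilations. -/

section

variable {m k : ℕ} {α : ℝ}

theorem clm_apply_eq_sum (L : Space m k →L[ℝ] ℝ) (w : Space m k) :
    L w = ∑ i, w i * L (EuclideanSpace.single i 1) := by
  conv_lhs => rw [← (EuclideanSpace.basisFun (Fin m ⊕ Fin k) ℝ).sum_repr w]
  simp

theorem hasDerivAt_dil {r : ℝ} (hr : 0 < r) (y : Space m k) :
    HasDerivAt (fun r => dil α r y)
      (WithLp.toLp 2 fun i => weight α i * r ^ (weight α i - 1) * y i) r := by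
  have h1 : HasDerivAt (fun r i => r ^ weight α i * y i)
      (fun i => weight α i * r ^ (weight α i - 1) * y i) r := by
    rw [hasDerivAt_pi]
    intro i
    exact (Real.hasDerivAt_rpow_const (Or.inl hr.ne')).mul_const (y i)
  exact (PiLp.continuousLinearEquiv 2 ℝ (fun _ : Fin m ⊕ Fin k => ℝ)).symm.hasFDerivAt.comp_hasDerivAt r h1

variable (hα : 0 < α) (hm : 0 < m)
include hα

omit hα in
theorem sq_fderiv_rho_le_psi (x : Space m k) (j : Fin m ⊕ Fin k) :
    fderiv ℝ (rho α) x (X α j x) ^ 2 ≤ psi α x :=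
  Finset.single_le_sum (f := fun j => fderiv ℝ (rho α) x (X α j x) ^ 2)
    (fun _ _ => sq_nonneg _) (Finset.mem_univ j)

/-- For z-fields and t-fields alike, X_j ρ times X_j is one common scalar times the j-th component
of the dilation field Z. In the t-case, the two factors |z|^α/2 together with 4(α+1) produce the
weight α + 1. -/
theorem fderiv_rho_X {x : Space m k} (hx : x ≠ 0) (j : Fin m ⊕ Fin k) (L : Space m k →L[ℝ] ℝ) :
    L (X α j x) * fderiv ℝ (rho α) x (X α j x) =
      rho α x ^ (-(2 * α + 1)) * zsq x ^ α *
        (weight α j * x j * L (EuclideanSpace.single j 1)) := by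
  rw [fderiv_rho hα hx]
  cases j with
  | inl i =>
    simp [X, weight]
    ring
  | inr j =>
    have h : (normZ x ^ α) ^ 2 = zsq x ^ α := by
      rw [normZ_rpow, ← Real.rpow_natCast, ← Real.rpow_mul (zsq_nonneg x)]
      congr 1
      push_cast
      ring
    simp [X, weight]
    rw [← h]
    ring

/-- The conormal derivative on the pseudo-spheres is a multiple of the derivative along the
dilations. -/
theorem hasDerivAt_comp_dil_of_contDiff {F : Space m k → ℝ} (hF : ContDiff ℝ 1 F)
    {y : Space m k} (hy : y ∈ sphere α 1) {r : ℝ} (hr : 0 < r) :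
    HasDerivAt (fun r => psi α y * F (dil α r y))
      (flux α (fun j x => fderiv ℝ F x (X α j x)) (dil α r y)) r := by
  have hy0 := ne_zero_of_mem_sphere hα one_pos hy
  have hx0 : dil α r y ≠ 0 := dil_ne_zero hα hr hy0
  have hρ : rho α (dil α r y) = r := by
    rw [rho_dil hα hr.le, rho_eq_one_of_mem_sphere hα hy, mul_one]
  have h1 : HasFDerivAt F (fderiv ℝ F (dil α r y)) (dil α r y) :=
    (hF.differentiable one_ne_zero _).hasFDerivAt
  have h2 := (h1.comp_hasDerivAt r (hasDerivAt_dil (α := α) hr y)).const_mul (psi α y)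
  have h3 : psi α y = zsq (dil α r y) ^ α * r ^ (-(2 * α)) := by
    rw [← psi_dil hα hr hy0, psi_eq hα hx0, hρ]
  refine h2.congr_deriv ?_
  symm
  rw [clm_apply_eq_sum, Finset.mul_sum]
  refine Finset.sum_congr rfl fun j _ => ?_
  change _ = _ * (weight α j * r ^ (weight α j - 1) * y j * _)
  rw [fderiv_rho_X hα hx0 j, hρ, h3, dil_apply, Real.rpow_sub_one hr.ne',
    show -(2 * α + 1) = -(2 * α) - 1 by ring, Real.rpow_sub_one hr.ne']
  ring

/-- For smooth functions this is the chain rule. In general, smooth approximants converge on the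
curve r ↦ δ_r y and their fluxes converge uniformly, since each |X_j ρ| is at most √ψ and ψ is
constant on the curve. -/
theorem HasWeakGrad.hasDerivAt_comp_dil {R : ℝ} {u : Space m k → ℝ}
    {g : Fin m ⊕ Fin k → Space m k → ℝ} (hu : HasWeakGrad α (ball α R) u g)
    {y : Space m k} (hy : y ∈ sphere α 1) {r : ℝ} (hr : r ∈ Ioo 0 R) :
    HasDerivAt (fun r => psi α y * u (dil α r y)) (flux α g (dil α r y)) r := by
  obtain ⟨d, hrd, hdR⟩ := exists_between hr.2
  have hK := isCompact_rho_le (m := m) (k := k) hα d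
  have hKΩ : {x : Space m k | rho α x ≤ d} ⊆ ball α R :=
    fun x hx => lt_of_le_of_lt (show rho α x ≤ d from hx) hdR
  have hη : ∀ n : ℕ, (0 : ℝ) < 1 / (n + 1) := fun n => by positivity
  choose F hF hF0 hF1 _ using fun n =>
    hu.exists_smooth_approx hα (isOpen_ball hα R) hK hKΩ (hη n)
  have hmem : ∀ s ∈ Ioo 0 d, dil α s y ∈ {x : Space m k | rho α x ≤ d} := fun s hs => by
    change rho α _ ≤ d
    rw [rho_dil hα hs.1.le, rho_eq_one_of_mem_sphere hα hy, mul_one]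
    exact hs.2.le
  have hy0 := ne_zero_of_mem_sphere hα one_pos hy
  set c : ℝ := ∑ _j : Fin m ⊕ Fin k, Real.sqrt (psi α y)
  have hlim : ∀ a : ℝ, Tendsto (fun n : ℕ => a * (1 / ((n : ℝ) + 1))) atTop (𝓝 0) := fun a => by
    simpa using tendsto_one_div_add_atTop_nhds_zero_nat.const_mul a
  refine hasDerivAt_of_tendstoUniformlyOn (𝕜 := ℝ) (s := Ioo 0 d) (l := atTop) isOpen_Ioo
    (g := fun r => psi α y * u (dil α r y)) (g' := fun r => flux α g (dil α r y))
    (f := fun n r => psi α y * F n (dil α r y))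
    (f' := fun n r => flux α (fun j x => fderiv ℝ (F n) x (X α j x)) (dil α r y))
    ?_ (Eventually.of_forall fun n s hs => hasDerivAt_comp_dil_of_contDiff hα
      ((hF n).of_le (by simp)) hy hs.1) ?_ ⟨hr.1, hrd⟩
  · rw [Metric.tendstoUniformlyOn_iff]
    intro ε hε
    filter_upwards [(hlim c).eventually (gt_mem_nhds hε)] with n hn s hs
    refine lt_of_le_of_lt ?_ hn
    rw [dist_comm, Real.dist_eq]
    simp only [flux, ← Finset.sum_sub_distrib, ← sub_mul, c, Finset.sum_mul]
    refine (Finset.abs_sum_le_sum_abs _ _).trans (Finset.sum_le_sum fun j _ => ?_)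
    rw [abs_mul, mul_comm]
    refine mul_le_mul ?_ (hF1 n j _ (hmem s hs)) (abs_nonneg _) (Real.sqrt_nonneg _)
    refine Real.abs_le_sqrt ?_
    rw [← psi_dil hα hs.1 hy0]
    exact sq_fderiv_rho_le_psi _ j
  · intro s hs
    refine Tendsto.const_mul _ (tendsto_iff_dist_tendsto_zero.2 ?_)
    refine squeeze_zero (fun _ => dist_nonneg) (fun n => ?_) (hlim 1)
    rw [one_mul, Real.dist_eq]
    exact hF0 n _ (hmem s hs)

theorem fderiv_rho_X_dil {a : ℝ} (ha : 0 < a) {x : Space m k} (hx : x ≠ 0) (j : Fin m ⊕ Fin k) :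
    fderiv ℝ (rho α) (dil α a x) (X α j (dil α a x)) = fderiv ℝ (rho α) x (X α j x) := by
  have hX : ∀ v : Space m k, ∀ i, fderiv ℝ (rho α) v (EuclideanSpace.single i 1) =
      gradient (rho α) v i := fun v i => by
    rw [← inner_gradient, EuclideanSpace.inner_single_right]
    simp
  cases j with
  | inl i => simp [X, hX, gradient_rho_dil hα ha hx, weight]
  | inr j =>
    have h1 : normZ (dil α a x) ^ α = a ^ α * normZ x ^ α := by
      rw [normZ_rpow, normZ_rpow, zsq_dil, Real.mul_rpow (by positivity) (zsq_nonneg x),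
        ← Real.rpow_natCast, ← Real.rpow_mul ha.le]
      congr 2
      push_cast
      ring
    have h2 : a ^ α * a ^ (1 - (α + 1)) = 1 := by
      rw [← Real.rpow_add ha]
      simp
    simp only [X, map_smul, hX, gradient_rho_dil hα ha hx, weight, smul_eq_mul, h1]
    linear_combination (normZ x ^ α / 2 * gradient (rho α) x (Sum.inr j)) * h2

omit hα in
theorem X_dil {a : ℝ} (ha : 0 < a) (j : Fin m ⊕ Fin k) (x : Space m k) :
    dil α a (X α j x) = a • X α j (dil α a x) := by
  cases j with
  | inl i =>
    ext l
    by_cases h : l = Sum.inl i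
    · subst h; simp [X, weight]
    · simp [X, h]
  | inr j =>
    have h1 : normZ (dil α a x) ^ α = a ^ α * normZ x ^ α := by
      rw [normZ_rpow, normZ_rpow, zsq_dil, Real.mul_rpow (by positivity) (zsq_nonneg x),
        ← Real.rpow_natCast, ← Real.rpow_mul ha.le]
      congr 2
      push_cast
      ring
    ext l
    by_cases h : l = Sum.inr j
    · subst h
      simp [X, weight, h1, Real.rpow_add_one ha.ne']
      ring
    · simp [X, h]

end

/-! ### Dilated solutions and the pairing on the unit pseudo-sphere. -/

section

variable {m k : ℕ} {α : ℝ}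

theorem HasWeakDerivAlong.mono {Ω Ω' : Set (Space m k)} (hΩ : MeasurableSet Ω) (hΩ' : Ω' ⊆ Ω)
    {V : Space m k → Space m k} {c : ℝ} {f g : Space m k → ℝ} (h : HasWeakDerivAlong Ω V c f g) :
    HasWeakDerivAlong Ω' V c f g := by
  intro φ hφ hφc hφΩ
  have h0 : ∀ x ∉ Ω', φ x = 0 := fun x hx => image_eq_zero_of_notMem_tsupport fun h => hx (hφΩ h)
  have h1 : ∀ x ∉ Ω', fderiv ℝ φ x = 0 := fun x hx =>
    image_eq_zero_of_notMem_tsupport fun h => hx (hφΩ (tsupport_fderiv_subset ℝ h))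
  have := h φ hφ hφc (hφΩ.trans hΩ')
  rwa [setIntegral_eq_of_subset_of_forall_sdiff_eq_zero hΩ hΩ'
      fun x hx => by simp [h0 x hx.2, h1 x hx.2],
    setIntegral_eq_of_subset_of_forall_sdiff_eq_zero hΩ hΩ'
      fun x hx => by simp [h0 x hx.2]] at this

theorem HasWeakGrad.mono {Ω Ω' : Set (Space m k)} (hΩ : MeasurableSet Ω) (hΩ' : Ω' ⊆ Ω)
    {f : Space m k → ℝ} {g : Fin m ⊕ Fin k → Space m k → ℝ} (h : HasWeakGrad α Ω f g) :
    HasWeakGrad α Ω' f g :=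
  ⟨h.continuousOn.mono hΩ', fun j => ⟨(h.weak j).1.mono hΩ', (h.weak j).2.mono hΩ hΩ'⟩⟩

theorem IsWeakSol.mono {Ω Ω' : Set (Space m k)} (hΩ : MeasurableSet Ω) (hΩ' : Ω' ⊆ Ω)
    {f : Space m k → ℝ} {g : Fin m ⊕ Fin k → Space m k → ℝ} (h : IsWeakSol α Ω f g) :
    IsWeakSol α Ω' f g := by
  refine ⟨h.toHasWeakGrad.mono hΩ hΩ', fun φ hφ hφc hφΩ => ?_⟩
  have h1 : ∀ x ∉ Ω', fderiv ℝ φ x = 0 := fun x hx =>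
    image_eq_zero_of_notMem_tsupport fun h => hx (hφΩ (tsupport_fderiv_subset ℝ h))
  have := h.integral_eq_zero φ hφ hφc (hφΩ.trans hΩ')
  rwa [setIntegral_eq_of_subset_of_forall_sdiff_eq_zero hΩ hΩ'
    fun x hx => by simp [h1 x hx.2]] at this

/-- The integral `∫ u(δ_a y) v(δ_b y) ψ_α(y)` over the unit pseudo-sphere. -/
def pairing (α : ℝ) (u v : Space m k → ℝ) (a b : ℝ) : ℝ :=
  ∫ y, psi α y * u (dil α a y) * v (dil α b y) ∂(leray α 1)

variable (hα : 0 < α) (hm : 0 < m)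
include hα

theorem dil_mem_ball {R a : ℝ} (ha : 0 < a) {x : Space m k} :
    dil α a x ∈ ball α R ↔ x ∈ ball α (R / a) := by
  change rho α _ < R ↔ rho α x < R / a
  rw [rho_dil hα ha.le, lt_div_iff₀ ha, mul_comm]

theorem setIntegral_comp_dil {R a : ℝ} (ha : 0 < a) (f : Space m k → ℝ) :
    ∫ x in ball α (R / a), f (dil α a x) = (a ^ homDim m k α)⁻¹ * ∫ x in ball α R, f x := by
  have h1 : ∏ i : Fin m ⊕ Fin k, a ^ weight α i = a ^ homDim m k α := prod_rpow_weight ha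
  have h2 : ∏ i : Fin m ⊕ Fin k, a ^ weight α i ≠ 0 := by
    rw [h1]
    exact (Real.rpow_pos_of_pos ha _).ne'
  have h3 := integral_comp_diagMap h2 ((ball α R).indicator f)
  rw [h1, abs_of_pos (Real.rpow_pos_of_pos ha _),
    integral_indicator (isOpen_ball hα R).measurableSet] at h3
  rw [← h3, ← integral_indicator (isOpen_ball hα _).measurableSet]
  congr 1
  funext x
  change _ = (ball α R).indicator f (dil α a x)
  by_cases hx : x ∈ ball α (R / a)
  · rw [indicator_of_mem hx, indicator_of_mem ((dil_mem_ball hα ha).2 hx)]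
  · rw [indicator_of_notMem hx, indicator_of_notMem (mt (dil_mem_ball hα ha).1 hx)]

theorem test_comp_dil_inv {R a : ℝ} (ha : 0 < a) {φ : Space m k → ℝ} (hφc : HasCompactSupport φ)
    (hφΩ : tsupport φ ⊆ ball α (R / a)) :
    HasCompactSupport (φ ∘ dil α a⁻¹) ∧ tsupport (φ ∘ dil α a⁻¹) ⊆ ball α R := by
  have hK : IsCompact (dil α a '' tsupport φ) :=
    IsCompact.image hφc (dil α a).continuous
  have hsub : Function.support (φ ∘ dil α a⁻¹) ⊆ dil α a '' tsupport φ := fun x hx =>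
    ⟨dil α a⁻¹ x, subset_tsupport _ hx, dil_dil_inv ha x⟩
  refine ⟨HasCompactSupport.of_support_subset_isCompact hK hsub,
    (closure_minimal hsub hK.isClosed).trans ?_⟩
  rintro _ ⟨x, hx, rfl⟩
  exact (dil_mem_ball hα ha).2 (hφΩ hx)

omit hα in
theorem fderiv_comp_dil_inv {a : ℝ} (ha : 0 < a) {φ : Space m k → ℝ} (hφ : ContDiff ℝ ∞ φ)
    (j : Fin m ⊕ Fin k) (x : Space m k) :
    fderiv ℝ φ x (X α j x) =
      a * fderiv ℝ (φ ∘ dil α a⁻¹) (dil α a x) (X α j (dil α a x)) := by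
  have h1 : HasFDerivAt φ (fderiv ℝ φ x) (dil α a⁻¹ (dil α a x)) := by
    rw [dil_inv_dil ha]
    exact (hφ.differentiable (by simp) x).hasFDerivAt
  have h2 := h1.comp (dil α a x) (dil α a⁻¹).hasFDerivAt
  rw [h2.fderiv, ContinuousLinearMap.comp_apply, X_dil (inv_pos.2 ha), dil_inv_dil ha, map_smul,
    smul_eq_mul, mul_inv_cancel_left₀ ha.ne']

/-- The fields X_j are homogeneous of degree one under the dilations, so composition with δ_a
multiplies them by `a`, and the change of variables in the integrals contributes only a common
Jacobian. -/
theorem IsWeakSol.comp_dil {R a : ℝ} (ha : 0 < a) {u : Space m k → ℝ}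
    {g : Fin m ⊕ Fin k → Space m k → ℝ} (hu : IsWeakSol α (ball α R) u g) :
    IsWeakSol α (ball α (R / a)) (fun x => u (dil α a x)) fun j x => a * g j (dil α a x) := by
  have hmaps : MapsTo (dil α a) (ball α (R / a) : Set (Space m k)) (ball α R) := fun x hx =>
    (dil_mem_ball hα ha).2 hx
  have hcont : ∀ {f : Space m k → ℝ}, ContinuousOn f (ball α R) →
      ContinuousOn (fun x => f (dil α a x)) (ball α (R / a)) := fun hf =>
    hf.comp (dil α a).continuous.continuousOn hmaps
  refine ⟨⟨hcont hu.continuousOn, fun j => ⟨continuousOn_const.mul (hcont (hu.weak j).1),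
    fun φ hφ hφc hφΩ => ?_⟩⟩, fun φ hφ hφc hφΩ => ?_⟩
  · obtain ⟨hc, hs⟩ := test_comp_dil_inv hα ha hφc hφΩ
    have h1 := (hu.weak j).2 _ (hφ.comp (dil α a⁻¹).contDiff) hc hs
    have h2 := setIntegral_comp_dil (R := R) hα ha fun x => u x *
      (fderiv ℝ (φ ∘ dil α a⁻¹) x (X α j x) + 0 * (φ ∘ dil α a⁻¹) x)
    have h3 := setIntegral_comp_dil (R := R) hα ha fun x => g j x * (φ ∘ dil α a⁻¹) x
    rw [h1, mul_neg, ← h3] at h2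
    simp only [Function.comp_apply, dil_inv_dil ha, zero_mul, add_zero] at h2 ⊢
    simp only [fderiv_comp_dil_inv ha hφ, mul_assoc, mul_left_comm _ a, integral_const_mul]
    rw [← mul_neg]
    congr 1
  · obtain ⟨hc, hs⟩ := test_comp_dil_inv hα ha hφc hφΩ
    have h1 := hu.integral_eq_zero _ (hφ.comp (dil α a⁻¹).contDiff) hc hs
    have h2 := setIntegral_comp_dil (R := R) hα ha fun x => ∑ j, g j x *
      fderiv ℝ (φ ∘ dil α a⁻¹) x (X α j x)
    rw [h1, mul_zero] at h2
    simp only [fderiv_comp_dil_inv ha hφ, mul_assoc, mul_left_comm _ a, ← Finset.mul_sum,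
      integral_const_mul, h2, mul_zero]

theorem flux_comp_dil {a : ℝ} (ha : 0 < a) (g : Fin m ⊕ Fin k → Space m k → ℝ) {x : Space m k}
    (hx : x ≠ 0) : flux α (fun j x => a * g j (dil α a x)) x = a * flux α g (dil α a x) := by
  simp only [flux, Finset.mul_sum, fderiv_rho_X_dil hα ha hx]
  exact Finset.sum_congr rfl fun j _ => by ring

include hm in
/-- The symmetric form of Green's identity, for two solutions dilated by different factors. -/
theorem IsWeakSol.integral_flux_symm {R : ℝ} {u v : Space m k → ℝ}
    {gu gv : Fin m ⊕ Fin k → Space m k → ℝ} (hu : IsWeakSol α (ball α R) u gu)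
    (hv : IsWeakSol α (ball α R) v gv) {a b : ℝ} (ha : a ∈ Ioo 0 R) (hb : b ∈ Ioo 0 R) :
    a * ∫ y, v (dil α b y) * flux α gu (dil α a y) ∂(leray α 1) =
      b * ∫ y, u (dil α a y) * flux α gv (dil α b y) ∂(leray α 1) := by
  -- Both dilates solve the equation in the pseudo-ball of radius R' > 1. Green's identity at radius
  -- 1 can thus be applied with either one as the solution, and the Dirichlet form on the left is
  -- symmetric.
  set R' := min (R / a) (R / b)
  have hR' : (1 : ℝ) ∈ Ioo 0 R' := ⟨one_pos, lt_min ((one_lt_div ha.1).2 ha.2)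
    ((one_lt_div hb.1).2 hb.2)⟩
  have hsub : ∀ c, R' ≤ c → (ball α R' : Set (Space m k)) ⊆ ball α c := fun c hc x hx =>
    lt_of_lt_of_le hx hc
  have hu' := (hu.comp_dil hα ha.1).mono (isOpen_ball hα _).measurableSet
    (hsub _ (min_le_left _ _))
  have hv' := (hv.comp_dil hα hb.1).mono (isOpen_ball hα _).measurableSet
    (hsub _ (min_le_right _ _))
  have h1 := hu'.green hα hm hv'.toHasWeakGrad hR'
  have h2 := hv'.green hα hm hu'.toHasWeakGrad hR'
  simp only [Real.one_rpow, one_mul, dil_one] at h1 h2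
  have h3 : ∫ y, v (dil α b y) * flux α (fun j x => a * gu j (dil α a x)) y ∂(leray α 1) =
      ∫ y, a * (v (dil α b y) * flux α gu (dil α a y)) ∂(leray α 1) := by
    refine integral_congr_ae ?_
    filter_upwards [ae_mem_sphere] with y hy
    rw [flux_comp_dil hα ha.1 gu (ne_zero_of_mem_sphere hα one_pos hy)]
    ring
  have h4 : ∫ y, u (dil α a y) * flux α (fun j x => b * gv j (dil α b x)) y ∂(leray α 1) =
      ∫ y, b * (u (dil α a y) * flux α gv (dil α b y)) ∂(leray α 1) := by
    refine integral_congr_ae ?_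
    filter_upwards [ae_mem_sphere] with y hy
    rw [flux_comp_dil hα hb.1 gv (ne_zero_of_mem_sphere hα one_pos hy)]
    ring
  rw [← integral_const_mul, ← integral_const_mul, ← h3, ← h4, ← h1, ← h2]
  simp only [mul_comm]

theorem continuousOn_psi : ContinuousOn (psi α) ({0}ᶜ : Set (Space m k)) := by
  have h : ContinuousOn (fun x : Space m k => zsq x ^ α * rho α x ^ (-(2 * α))) {0}ᶜ :=
    ((contDiff_zsq (n := 0)).continuous.rpow_const fun x => Or.inr hα.le).continuousOn.mul
      ((continuous_rho hα).continuousOn.rpow_const fun x hx => Or.inl (rho_pos hα hx).ne')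
  exact h.congr fun x hx => psi_eq hα hx

theorem continuousOn_psi_snd (I : Set ℝ) :
    ContinuousOn (fun q : ℝ × Space m k => psi α q.2) (I ×ˢ sphere α 1) :=
  (continuousOn_psi hα).comp continuousOn_snd fun _ hq => ne_zero_of_mem_sphere hα one_pos hq.2

omit hα in
theorem fderiv_rho_X_eq_zero {x : Space m k} (hx : psi α x = 0) (j : Fin m ⊕ Fin k) :
    fderiv ℝ (rho α) x (X α j x) = 0 := by
  have := sq_fderiv_rho_le_psi (α := α) x j
  rw [hx] at this
  exact pow_eq_zero_iff two_ne_zero |>.1 (le_antisymm this (sq_nonneg _))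

theorem flux_dil_eq_zero {y : Space m k} (hy : y ∈ sphere α 1) (hψ : psi α y = 0) {a : ℝ}
    (ha : 0 < a) (g : Fin m ⊕ Fin k → Space m k → ℝ) : flux α g (dil α a y) = 0 := by
  refine Finset.sum_eq_zero fun j _ => ?_
  rw [fderiv_rho_X_dil hα ha (ne_zero_of_mem_sphere hα one_pos hy), fderiv_rho_X_eq_zero hψ,
    mul_zero]

theorem HasWeakGrad.hasDerivAt_mul_comp_dil {R : ℝ} {u v : Space m k → ℝ}
    {gu gv : Fin m ⊕ Fin k → Space m k → ℝ} (hu : HasWeakGrad α (ball α R) u gu)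
    (hv : HasWeakGrad α (ball α R) v gv) {c : ℝ → ℝ} {c' r : ℝ} (hc : HasDerivAt c c' r)
    (hr : r ∈ Ioo 0 R) (hcr : c r ∈ Ioo 0 R) {y : Space m k} (hy : y ∈ sphere α 1) :
    HasDerivAt (fun r => psi α y * u (dil α r y) * v (dil α (c r) y))
      (v (dil α (c r) y) * flux α gu (dil α r y) +
        c' * (u (dil α r y) * flux α gv (dil α (c r) y))) r := by
  -- Only ψu is known to be differentiable along the dilations. Where ψ(y) = 0 both fluxes and the
  -- function vanish; elsewhere the product rule is applied to ψu and ψv and one factor ψ is divided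
  -- out.
  by_cases hψ : psi α y = 0
  · rw [flux_dil_eq_zero hα hy hψ hr.1, flux_dil_eq_zero hα hy hψ hcr.1]
    simpa [hψ] using hasDerivAt_const r (0 : ℝ)
  · have h1 := hu.hasDerivAt_comp_dil hα hy hr
    have h2 : HasDerivAt (fun r => psi α y * v (dil α (c r) y))
        (flux α gv (dil α (c r) y) * c') r := (hv.hasDerivAt_comp_dil hα hy hcr).comp r hc
    have h3 := (h1.mul h2).const_mul (psi α y)⁻¹
    have h4 : (fun r => psi α y * u (dil α r y) * v (dil α (c r) y)) = fun r => (psi α y)⁻¹ *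
        ((psi α y * u (dil α r y)) * (psi α y * v (dil α (c r) y))) := by
      funext s
      field_simp
    rw [h4]
    refine h3.congr_deriv ?_
    field_simp

include hm in
/-- Differentiation of the pairing along a curve of dilation factors. -/
theorem HasWeakGrad.hasDerivAt_pairing {R : ℝ} {u v : Space m k → ℝ}
    {gu gv : Fin m ⊕ Fin k → Space m k → ℝ} (hu : HasWeakGrad α (ball α R) u gu)
    (hv : HasWeakGrad α (ball α R) v gv) {I : Set ℝ} (hI : IsOpen I) (hIR : I ⊆ Ioo 0 R)
    {c c' : ℝ → ℝ} (hc : ∀ r ∈ I, HasDerivAt c (c' r) r) (hc' : ContinuousOn c' I)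
    (hcR : MapsTo c I (Ioo 0 R)) {r : ℝ} (hr : r ∈ I) :
    HasDerivAt (fun r => pairing α u v r (c r))
      (∫ y, v (dil α (c r) y) * flux α gu (dil α r y) ∂(leray α 1) +
        c' r * ∫ y, u (dil α r y) * flux α gv (dil α (c r) y) ∂(leray α 1)) r := by
  have hcc : ContinuousOn c I := fun r hr => (hc r hr).continuousAt.continuousWithinAt
  have hd1 : ∀ f : Space m k → ℝ, ContinuousOn f (ball α R \ {0}) →
      ContinuousOn (fun q : ℝ × Space m k => f (dil α q.1 q.2)) (I ×ˢ sphere α 1) := fun f hf =>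
    (continuousOn_comp_dil hα hf).mono (prod_mono hIR subset_rfl)
  have hcm : ContinuousOn (fun q : ℝ × Space m k => (c q.1, q.2)) (I ×ˢ sphere α 1) :=
    (hcc.comp continuousOn_fst fun q hq => hq.1).prodMk continuousOn_snd
  have hd2 : ∀ f : Space m k → ℝ, ContinuousOn f (ball α R \ {0}) →
      ContinuousOn (fun q : ℝ × Space m k => f (dil α (c q.1) q.2)) (I ×ˢ sphere α 1) := by
    intro f hf
    exact ContinuousOn.comp (g := Function.uncurry fun r (y : Space m k) => f (dil α r y))
      (f := fun q : ℝ × Space m k => (c q.1, q.2)) (t := Ioo 0 R ×ˢ sphere α 1)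
      (continuousOn_comp_dil hα hf) hcm fun q hq => ⟨hcR hq.1, hq.2⟩
  have hfu := continuousOn_flux hα fun j => (hu.weak j).1
  have hfv := continuousOn_flux hα fun j => (hv.weak j).1
  have hu0 : ContinuousOn u (ball α R \ {0}) := hu.continuousOn.mono sdiff_subset
  have hv0 : ContinuousOn v (ball α R \ {0}) := hv.continuousOn.mono sdiff_subset
  have hA := (hd2 _ hv0).mul (hd1 _ hfu)
  have hB := (hd1 _ hu0).mul (hd2 _ hfv)
  have key := hasDerivAt_integral_leray hα hm hI
    (H := fun r y => psi α y * u (dil α r y) * v (dil α (c r) y))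
    (H' := fun r y => v (dil α (c r) y) * flux α gu (dil α r y) +
      c' r * (u (dil α r y) * flux α gv (dil α (c r) y)))
    (((continuousOn_psi_snd hα I).mul (hd1 _ hu0)).mul (hd2 _ hv0))
    (hA.add ((hc'.comp continuousOn_fst fun q hq => hq.1).mul hB))
    (fun r hr y hy => hu.hasDerivAt_mul_comp_dil hα hv (hc r hr) (hIR hr) (hcR hr) hy) hr
  have hs : ∀ f : Space m k → ℝ, ContinuousOn f (ball α R \ {0}) → ∀ a ∈ Ioo 0 R,
      ContinuousOn (fun y => f (dil α a y)) (sphere α 1) := fun f hf a ha =>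
    hf.comp (dil α a).continuous.continuousOn fun y hy => dil_mem_punctured hα ha hy
  have i1 : Integrable (fun y => v (dil α (c r) y) * flux α gu (dil α r y)) (leray α 1) :=
    integrable_leray hα hm ((hs _ hv0 _ (hcR hr)).mul (hs _ hfu _ (hIR hr)))
  have i2 : Integrable (fun y => u (dil α r y) * flux α gv (dil α (c r) y)) (leray α 1) :=
    integrable_leray hα hm ((hs _ hu0 _ (hIR hr)).mul (hs _ hfv _ (hcR hr)))
  refine key.congr_deriv ?_
  rw [integral_add i1 (i2.const_mul _), integral_const_mul]

include hm in
/-- The pairing of two solutions depends only on the product of the dilation factors. -/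
theorem IsWeakSol.pairing_eq {R : ℝ} {u v : Space m k → ℝ}
    {gu gv : Fin m ⊕ Fin k → Space m k → ℝ} (hu : IsWeakSol α (ball α R) u gu)
    (hv : IsWeakSol α (ball α R) v gv) {a b a' b' : ℝ} (ha : a ∈ Ioo 0 R) (hb : b ∈ Ioo 0 R)
    (ha' : a' ∈ Ioo 0 R) (hb' : b' ∈ Ioo 0 R) (hab : a * b = a' * b') :
    pairing α u v a b = pairing α u v a' b' := by
  have hR : 0 < R := ha.1.trans ha.2
  set C := a * b
  have hC : 0 < C := mul_pos ha.1 hb.1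
  have hI : ∀ r s : ℝ, r ∈ Ioo 0 R → s ∈ Ioo 0 R → C = r * s → r ∈ Ioo (C / R) R := by
    intro r s hr hs h
    refine ⟨?_, hr.2⟩
    rw [h, div_lt_iff₀ hR]
    exact mul_lt_mul_of_pos_left hs.2 hr.1
  have hIR : Ioo (C / R) R ⊆ Ioo 0 R := Ioo_subset_Ioo_left (by positivity)
  have hcR : MapsTo (fun r => C / r) (Ioo (C / R) R) (Ioo 0 R) := fun r hr => by
    have hr0 := (hIR hr).1
    refine ⟨by positivity, ?_⟩
    change C / r < R
    rw [div_lt_iff₀ hr0, mul_comm]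
    exact (div_lt_iff₀ hR).1 hr.1
  -- Along the hyperbola ab = C, with b = C/a, the derivative is ∂_a F - (b/a) ∂_b F, which is zero
  -- by the symmetric Green identity.
  have hder : ∀ r ∈ Ioo (C / R) R, HasDerivAt (fun r => pairing α u v r (C / r)) 0 r := by
    intro r hr
    have hr0 := (hIR hr).1
    have h1 := hu.hasDerivAt_pairing hα hm hv.toHasWeakGrad isOpen_Ioo hIR
      (c := fun r => C / r) (c' := fun r => -(C / r ^ 2))
      (fun r hr => by
        have := (hasDerivAt_inv (hIR hr).1.ne').const_mul C
        refine (this.congr_deriv ?_)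
        ring)
      (by
        refine (continuousOn_const.div (by fun_prop) fun r hr => ?_).neg
        exact pow_ne_zero 2 (hIR hr).1.ne') hcR hr
    refine h1.congr_deriv ?_
    have h2 := hu.integral_flux_symm hα hm hv (hIR hr) (hcR hr)
    rw [← mul_right_inj' hr0.ne', mul_add, h2]
    field_simp
    ring
  have key := isOpen_Ioo.is_const_of_deriv_eq_zero isPreconnected_Ioo
    (fun r hr => (hder r hr).differentiableAt.differentiableWithinAt)
    (fun r hr => (hder r hr).deriv) (hI a b ha hb rfl) (hI a' b' ha' hb' hab)
  beta_reduce at key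
  rwa [show C / a = b from mul_div_cancel_left₀ b ha.1.ne', hab,
    mul_div_cancel_left₀ b' ha'.1.ne'] at key

include hm in
-- Each of the two factors contributes the same flux integral, and Green's identity with v = u
-- identifies it with the Dirichlet integral.
theorem IsWeakSol.hasDerivAt_pairing_self {R : ℝ} {u : Space m k → ℝ}
    {g : Fin m ⊕ Fin k → Space m k → ℝ} (hu : IsWeakSol α (ball α R) u g) {r : ℝ}
    (hr : r ∈ Ioo 0 R) :
    HasDerivAt (fun r => pairing α u u r r)
      (2 * r ^ (1 - homDim m k α) * ∫ x in ball α r, ∑ j, g j x ^ 2) r := by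
  have h1 := hu.hasDerivAt_pairing hα hm hu.toHasWeakGrad isOpen_Ioo subset_rfl
    (c := fun r => r) (c' := fun _ => 1) (fun r _ => hasDerivAt_id r) continuousOn_const
    (fun _ h => h) hr
  refine h1.congr_deriv ?_
  have h2 := hu.green hα hm hu.toHasWeakGrad hr
  simp only [pow_two]
  rw [h2]
  have h3 : r ^ (1 - homDim m k α) * r ^ (homDim m k α - 1) = 1 := by
    rw [← Real.rpow_add hr.1]
    simp
  linear_combination (-2 * ∫ y, u (dil α r y) * flux α g (dil α r y) ∂(leray α 1)) * h3

end

/-! ### Logarithmic convexity, positivity of the height and unique continuation. -/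

section

variable {m k : ℕ} {α : ℝ}

/-- Midpoint convexity says that consecutive increments with a fixed step do not decrease, and
induction compares the first with the last. -/
theorem midpoint_telescope {F : ℝ → ℝ} {b : ℝ}
    (hF : ∀ x y, x < b → y < b → 2 * F ((x + y) / 2) ≤ F x + F y) {x d : ℝ} (hd : 0 ≤ d) :
    ∀ n : ℕ, x + (n + 1) * d < b → F (x + d) - F x ≤ F (x + (n + 1) * d) - F (x + n * d)
  | 0, _ => by simp
  | n + 1, h => by
    push_cast at h ⊢
    have h1 : x + ((n : ℝ) + 1) * d < b := by linarith
    have h2 : x + (n : ℝ) * d < b := by linarith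
    have h3 := midpoint_telescope hF hd n h1
    have h4 := hF _ _ h2 h
    rw [show (x + n * d + (x + (n + 1 + 1) * d)) / 2 = x + (n + 1) * d by ring] at h4
    linarith

/-- The derivative of a differentiable midpoint convex function is monotone. -/
theorem deriv_le_of_midpoint_convex {F F' : ℝ → ℝ} {b : ℝ}
    (hF : ∀ x y, x < b → y < b → 2 * F ((x + y) / 2) ≤ F x + F y)
    (hd : ∀ x < b, HasDerivAt F (F' x) x) {x y : ℝ} (hxy : x < y) (hy : y < b) : F' x ≤ F' y := by
  -- The step divides [x,y] evenly, so the grid starting at `x` reaches `y` exactly and the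
  -- difference quotients at both ends can be compared with the same step.
  set d : ℕ → ℝ := fun n => (y - x) / (n + 1)
  have hdpos : ∀ n, 0 < d n := fun n => div_pos (sub_pos.2 hxy) (by positivity)
  have hdlim : Tendsto d atTop (𝓝[>] 0) := by
    refine tendsto_nhdsWithin_iff.2 ⟨?_, Eventually.of_forall hdpos⟩
    have := (tendsto_one_div_add_atTop_nhds_zero_nat (𝕜 := ℝ)).const_mul (y - x)
    simpa [d, div_eq_mul_inv] using this
  have hslope : ∀ z < b, Tendsto (fun n => (d n)⁻¹ • (F (z + d n) - F z)) atTop (𝓝 (F' z)) :=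
    fun z hz => (hasDerivAt_iff_tendsto_slope_zero.1 (hd z hz)).comp
      (hdlim.mono_right (nhdsGT_le_nhdsNE 0))
  refine le_of_tendsto_of_tendsto (hslope x (hxy.trans hy)) (hslope y hy) ?_
  have h0 : Tendsto d atTop (𝓝 0) := hdlim.mono_right nhdsWithin_le_nhds
  filter_upwards [h0.eventually (gt_mem_nhds (sub_pos.2 hy))] with n hn
  have h1 : x + ((n : ℝ) + 1) * d n = y := by
    simp only [d]
    field_simp
    ring
  have h2 := midpoint_telescope hF (x := x) (hdpos n).le (n + 1) (by push_cast; linarith)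
  push_cast at h2
  rw [show x + ((n : ℝ) + 1 + 1) * d n = y + d n by rw [← h1]; ring, h1] at h2
  simp only [smul_eq_mul]
  exact mul_le_mul_of_nonneg_left h2 (inv_nonneg.2 (hdpos n).le)

variable (hα : 0 < α) (hm : 0 < m)
include hα

include hm in
-- The factor 1/|∇ρ| is the density of the surface measure `leray α r`. Pulling back to radius 1
-- costs only r^{Q-1}, because ψ is invariant under dilations.
theorem integral_sphere_eq {r : ℝ} (hr : 0 < r) (f : Space m k → ℝ) :
    ∫ x in sphere α r, f x * (psi α x / ‖gradient (rho α) x‖) ∂(μHE[m + k - 1]) =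
      r ^ (homDim m k α - 1) * ∫ y, psi α y * f (dil α r y) ∂(leray α 1) := by
  have h1 : ∫ x in sphere α r, f x * (psi α x / ‖gradient (rho α) x‖) ∂(μHE[m + k - 1]) =
      ∫ x, psi α x * f x ∂(leray α r) := by
    have hd : Measurable fun x : Space m k => ENNReal.ofReal ‖gradient (rho α) x‖⁻¹ :=
      (measurable_norm_gradient (rho α)).inv.ennreal_ofReal
    rw [leray, integral_withDensity_eq_integral_toReal_smul hd
      (Eventually.of_forall fun _ => ENNReal.ofReal_lt_top)]
    congr 1
    funext x
    rw [ENNReal.toReal_ofReal (by positivity), smul_eq_mul]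
    ring
  have hinj : Function.Injective (dil α r : Space m k → Space m k) :=
    Function.LeftInverse.injective (dil_inv_dil hr)
  have he : MeasurableEmbedding (dil α r : Space m k → Space m k) :=
    (dil α r).continuous.measurableEmbedding hinj
  rw [h1, leray_eq_map_dil hα hm hr, integral_smul_measure, he.integral_map,
    ENNReal.toReal_ofReal (by positivity), smul_eq_mul]
  congr 1
  refine integral_congr_ae ?_
  filter_upwards [ae_mem_sphere] with y hy
  rw [psi_dil hα hr (ne_zero_of_mem_sphere hα one_pos hy)]

include hm in
theorem height_eq {r : ℝ} (hr : 0 < r) (u : Space m k → ℝ) :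
    height α u r = r ^ (homDim m k α - 1) * pairing α u u r r := by
  rw [height, integral_sphere_eq hα hm hr fun x => u x ^ 2, pairing]
  simp only [pow_two, mul_assoc]

omit hα in
theorem psi_nonneg (x : Space m k) : 0 ≤ psi α x := Finset.sum_nonneg fun _ _ => sq_nonneg _

omit hα in
theorem pairing_self_nonneg (u : Space m k → ℝ) (a : ℝ) : 0 ≤ pairing α u u a a :=
  integral_nonneg fun y => by
    have := psi_nonneg (α := α) y
    change 0 ≤ psi α y * u (dil α a y) * u (dil α a y)
    rw [mul_assoc]
    exact mul_nonneg this (mul_self_nonneg _)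

include hm in
theorem integrable_pairing {R : ℝ} {u v : Space m k → ℝ} (hu : ContinuousOn u (ball α R))
    (hv : ContinuousOn v (ball α R)) {a b : ℝ} (ha : a ∈ Ioo 0 R) (hb : b ∈ Ioo 0 R) :
    Integrable (fun y => psi α y * u (dil α a y) * v (dil α b y)) (leray α 1) := by
  have h : ∀ f : Space m k → ℝ, ContinuousOn f (ball α R) → ∀ a ∈ Ioo 0 R,
      ContinuousOn (fun y => f (dil α a y)) (sphere α 1) := fun f hf a ha =>
    hf.comp (dil α a).continuous.continuousOn fun y hy => (dil_mem_punctured hα ha hy).1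
  exact integrable_leray hα hm ((((continuousOn_psi hα).mono fun y hy =>
    ne_zero_of_mem_sphere hα one_pos hy).mul (h u hu a ha)).mul (h v hv b hb))

include hm in
theorem integral_psi_mul_sq {R : ℝ} {u v : Space m k → ℝ} (hu : ContinuousOn u (ball α R))
    (hv : ContinuousOn v (ball α R)) {a b : ℝ} (ha : a ∈ Ioo 0 R) (hb : b ∈ Ioo 0 R) (t : ℝ) :
    ∫ y, psi α y * (u (dil α a y) + t * v (dil α b y)) ^ 2 ∂(leray α 1) =
      pairing α u u a a + 2 * t * pairing α u v a b + t * t * pairing α v v b b := by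
  have i1 := integrable_pairing hα hm hu hu ha ha
  have i2 := (integrable_pairing hα hm hu hv ha hb).const_mul (2 * t)
  have i3 := (integrable_pairing hα hm hv hv hb hb).const_mul (t * t)
  have i12 : Integrable (fun y => psi α y * u (dil α a y) * u (dil α a y) +
    2 * t * (psi α y * u (dil α a y) * v (dil α b y))) (leray α 1) := i1.add i2
  unfold pairing
  rw [← integral_const_mul, ← integral_const_mul, ← integral_add i1 i2, ← integral_add i12 i3]
  congr 1
  funext y
  ring

include hm in
theorem sq_pairing_le {R : ℝ} {u v : Space m k → ℝ} (hu : ContinuousOn u (ball α R))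
    (hv : ContinuousOn v (ball α R)) {a b : ℝ} (ha : a ∈ Ioo 0 R) (hb : b ∈ Ioo 0 R) :
    pairing α u v a b ^ 2 ≤ pairing α u u a a * pairing α v v b b := by
  have h : ∀ t : ℝ, 0 ≤ pairing α v v b b * (t * t) + 2 * pairing α u v a b * t +
      pairing α u u a a := by
    intro t
    have h1 := integral_psi_mul_sq hα hm hu hv ha hb t
    have h2 : 0 ≤ ∫ y, psi α y * (u (dil α a y) + t * v (dil α b y)) ^ 2 ∂(leray α 1) :=
      integral_nonneg fun y => mul_nonneg (psi_nonneg y) (sq_nonneg _)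
    linarith
  have := discrim_le_zero h
  unfold discrim at this
  linarith

include hm in
-- The three-spheres inequality: the pairing at (c,c) equals the one at (a,b), to which
-- Cauchy-Schwarz applies.
theorem IsWeakSol.pairing_self_sq_le {R : ℝ} {u : Space m k → ℝ}
    {g : Fin m ⊕ Fin k → Space m k → ℝ} (hu : IsWeakSol α (ball α R) u g) {a b c : ℝ}
    (ha : a ∈ Ioo 0 R) (hb : b ∈ Ioo 0 R) (hc : c ∈ Ioo 0 R) (h : c * c = a * b) :
    pairing α u u c c ^ 2 ≤ pairing α u u a a * pairing α u u b b := by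
  rw [hu.pairing_eq hα hm hu hc hc ha hb h]
  exact sq_pairing_le hα hm hu.continuousOn hu.continuousOn ha hb

include hm in
theorem IsWeakSol.monotoneOn_pairing_self {R : ℝ} {u : Space m k → ℝ}
    {g : Fin m ⊕ Fin k → Space m k → ℝ} (hu : IsWeakSol α (ball α R) u g) :
    MonotoneOn (fun r => pairing α u u r r) (Ioo 0 R) := by
  have hd := fun r hr => hu.hasDerivAt_pairing_self hα hm (r := r) hr
  refine monotoneOn_of_deriv_nonneg (convex_Ioo 0 R)
    (fun r hr => (hd r hr).continuousAt.continuousWithinAt) ?_ ?_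
  · rw [interior_Ioo]
    exact fun r hr => (hd r hr).differentiableAt.differentiableWithinAt
  · rw [interior_Ioo]
    intro r hr
    rw [(hd r hr).deriv]
    have : 0 ≤ ∫ x in ball α r, ∑ j, g j x ^ 2 :=
      integral_nonneg fun x => Finset.sum_nonneg fun _ _ => sq_nonneg _
    have := Real.rpow_nonneg hr.1.le (1 - homDim m k α)
    positivity

include hm in
/-- A continuous function whose spherical means of squares vanish is zero. -/
theorem eq_zero_of_pairing_self_eq_zero {R : ℝ} {u : Space m k → ℝ}
    (hu : ContinuousOn u (ball α R)) {r : ℝ} (hrR : r < R)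
    (h0 : ∀ s ∈ Ioo 0 r, pairing α u u s s = 0) : ∀ x ∈ ball α r, u x = 0 := by
  set f : Space m k → ℝ := fun x => zsq x ^ α * (u x * u x)
  have hz : Continuous fun x : Space m k => zsq x ^ α :=
    (contDiff_zsq (n := 0)).continuous.rpow_const fun x => Or.inr hα.le
  have hf : ContinuousOn f (ball α R) := hz.continuousOn.mul (hu.mul hu)
  have hrsub : (ball α r : Set (Space m k)) ⊆ ball α R := fun x hx => lt_trans hx hrR
  have hfi : Integrable ((ball α r).indicator f) := by
    refine IntegrableOn.integrable_indicator ?_ (isOpen_ball hα r).measurableSet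
    refine IntegrableOn.mono_set (t := {x | rho α x ≤ r}) ?_
      fun x hx => le_of_lt (show rho α x < r from hx)
    exact (hf.mono fun x hx => lt_of_le_of_lt (show rho α x ≤ r from hx) hrR).integrableOn_compact
      (isCompact_rho_le hα r)
  have hf0 : ∀ x, 0 ≤ (ball α r).indicator f x := fun x =>
    indicator_nonneg (fun x _ => mul_nonneg (Real.rpow_nonneg (zsq_nonneg x) _)
      (mul_self_nonneg _)) x
  have hint : ∫ x, (ball α r).indicator f x = 0 := by
    rw [integral_polar hα hm hfi]
    refine setIntegral_eq_zero_of_forall_eq_zero fun s hs => ?_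
    have hs : 0 < s := hs
    refine mul_eq_zero_of_right _ ?_
    by_cases hsr : s < r
    -- On the pseudo-sphere of radius s the weight |z|^{2α} is s^{2α} ψ, so the integral is a
    -- multiple of the vanishing pairing.
    · have h1 : ∫ y, (ball α r).indicator f (dil α s y) ∂(leray α 1) =
          ∫ y, s ^ (2 * α) * (psi α y * u (dil α s y) * u (dil α s y)) ∂(leray α 1) := by
        refine integral_congr_ae ?_
        filter_upwards [ae_mem_sphere] with y hy
        have hy0 := ne_zero_of_mem_sphere hα one_pos hy
        have hx0 := dil_ne_zero hα hs hy0
        have hρ : rho α (dil α s y) = s := by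
          rw [rho_dil hα hs.le, rho_eq_one_of_mem_sphere hα hy, mul_one]
        rw [indicator_of_mem (show dil α s y ∈ ball α r from hρ.trans_lt hsr), ← psi_dil hα hs hy0,
          psi_eq hα hx0, hρ]
        simp only [f]
        rw [show s ^ (2 * α) * (zsq (dil α s y) ^ α * s ^ (-(2 * α)) * u (dil α s y) *
          u (dil α s y)) = (s ^ (2 * α) * s ^ (-(2 * α))) * (zsq (dil α s y) ^ α *
          (u (dil α s y) * u (dil α s y))) by ring, ← Real.rpow_add hs, add_neg_cancel,
          Real.rpow_zero, one_mul]
      rw [h1, integral_const_mul]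
      exact mul_eq_zero_of_right _ (h0 s ⟨hs, hsr⟩)
    · rw [← integral_zero (Space m k) ℝ (μ := leray α 1)]
      refine integral_congr_ae ?_
      filter_upwards [ae_mem_sphere] with y hy
      refine indicator_of_notMem (fun h => hsr ?_) _
      have h : rho α (dil α s y) < r := h
      rwa [rho_dil hα hs.le, rho_eq_one_of_mem_sphere hα hy, mul_one] at h
  have hae := (integral_eq_zero_iff_of_nonneg hf0 hfi).1 hint
  have hfz : ∀ x ∈ ball α r, f x = 0 := by
    refine Measure.eqOn_open_of_ae_eq (μ := volume) (g := fun _ => 0) ?_ (isOpen_ball hα r)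
      (hf.mono hrsub) continuousOn_const
    rw [EventuallyEq, ae_restrict_iff' (isOpen_ball hα r).measurableSet]
    filter_upwards [hae] with x hx hxr
    rwa [indicator_of_mem hxr] at hx
  intro x hx
  have hpos : ∀ x ∈ ball α r, 0 < zsq x → u x = 0 := fun x hx hxz => by
    have := (mul_eq_zero.1 (hfz x hx)).resolve_left (Real.rpow_pos_of_pos hxz _).ne'
    exact mul_self_eq_zero.1 this
  -- The weight |z|^{2α} gives no information on z = 0. Such points are approached along a
  -- z-direction, where |z| becomes positive, and continuity concludes.
  set c : ℝ → Space m k := fun t => x + t • EuclideanSpace.single (Sum.inl ⟨0, hm⟩) 1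
  have hc : Continuous c := by fun_prop
  have hc0 : c 0 = x := by simp [c]
  have h1 : Tendsto (fun t => u (c t)) (𝓝[≠] 0) (𝓝 (u x)) := by
    have : ContinuousAt u (c 0) := by
      rw [hc0]
      exact hu.continuousAt ((isOpen_ball hα R).mem_nhds (hrsub hx))
    have h2 : ContinuousAt (fun t => u (c t)) 0 := this.comp hc.continuousAt
    have h3 : Tendsto (fun t => u (c t)) (𝓝 0) (𝓝 (u (c 0))) := h2
    rw [hc0] at h3
    exact h3.mono_left nhdsWithin_le_nhds
  have h2 : ∀ᶠ t in 𝓝[≠] (0 : ℝ), u (c t) = 0 := by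
    have h3 : ∀ᶠ t in 𝓝 (0 : ℝ), c t ∈ ball α r :=
      hc.continuousAt.eventually ((isOpen_ball hα r).mem_nhds (by rwa [hc0]))
    have h4 : ∀ᶠ t in 𝓝[≠] (0 : ℝ), t ≠ -(x (Sum.inl ⟨0, hm⟩)) := by
      by_cases hx0 : x (Sum.inl ⟨0, hm⟩) = 0
      · rw [hx0, neg_zero]
        exact eventually_mem_nhdsWithin
      · exact nhdsWithin_le_nhds (isOpen_ne.mem_nhds (neg_ne_zero.2 hx0).symm)
    filter_upwards [h3.filter_mono nhdsWithin_le_nhds, h4] with t ht ht'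
    refine hpos _ ht (zsq_pos_of_ne (i := ⟨0, hm⟩) ?_)
    simp only [c, PiLp.add_apply, PiLp.smul_apply, PiLp.single_apply, if_true, smul_eq_mul, mul_one]
    intro h
    exact ht' (by linarith)
  exact tendsto_nhds_unique h1 (tendsto_const_nhds.congr' (h2.mono fun t ht => ht.symm))

include hm in
/-- Unique continuation: a nontrivial solution has positive height on every pseudo-sphere. -/
theorem IsWeakSol.pairing_self_pos {R : ℝ} {u : Space m k → ℝ}
    {g : Fin m ⊕ Fin k → Space m k → ℝ} (hu : IsWeakSol α (ball α R) u g)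
    (hu0 : ∃ x ∈ ball α R, u x ≠ 0) {r : ℝ} (hr : r ∈ Ioo 0 R) : 0 < pairing α u u r r := by
  refine lt_of_le_of_ne (pairing_self_nonneg u r) fun h0 => ?_
  have hmono := hu.monotoneOn_pairing_self hα hm
  have hdown : ∀ a b, a ∈ Ioo 0 R → b ∈ Ioo 0 R → a ≤ b → pairing α u u b b = 0 →
      pairing α u u a a = 0 := fun a b ha hb hab h =>
    le_antisymm ((hmono ha hb hab).trans_eq h) (pairing_self_nonneg u a)
  set S : Set ℝ := {s | s ∈ Ioo 0 R ∧ pairing α u u s s = 0}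
  have hrS : r ∈ S := ⟨hr, h0.symm⟩
  have hbdd : BddAbove S := ⟨R, fun s hs => hs.1.2.le⟩
  have hT : sSup S = R := by
    refine le_antisymm (csSup_le ⟨r, hrS⟩ fun s hs => hs.1.2.le) (not_lt.1 fun hlt => ?_)
    obtain ⟨b, hTb, hbR⟩ := exists_between hlt
    have hT0 : 0 < sSup S := hr.1.trans_le (le_csSup hbdd hrS)
    have hb0 := hT0.trans hTb
    -- With T the supremum of the zeros and T < b < R, a zero a > T²/b makes √(ab) > T, and the
    -- three-spheres inequality makes it a zero too, contradicting the choice of T.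
    obtain ⟨a, haS, ha⟩ := exists_lt_of_lt_csSup ⟨r, hrS⟩
      (show sSup S ^ 2 / b < sSup S by rw [div_lt_iff₀ hb0]; nlinarith)
    have hab : 0 < a * b := mul_pos haS.1.1 hb0
    have haT := le_csSup hbdd haS
    have hc2 : Real.sqrt (a * b) * Real.sqrt (a * b) = a * b := Real.mul_self_sqrt hab.le
    have hc0 : 0 < Real.sqrt (a * b) := Real.sqrt_pos.2 hab
    have hcT : sSup S < Real.sqrt (a * b) := by
      refine Real.lt_sqrt_of_sq_lt ?_
      rwa [div_lt_iff₀ hb0] at ha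
    have hcR : Real.sqrt (a * b) < R := by
      rw [Real.sqrt_lt' (hb0.trans hbR)]
      nlinarith [haS.1.1]
    have h1 := hu.pairing_self_sq_le hα hm haS.1 ⟨hb0, hbR⟩ ⟨hc0, hcR⟩ hc2
    rw [haS.2, zero_mul] at h1
    have hcS : Real.sqrt (a * b) ∈ S :=
      ⟨⟨hc0, hcR⟩, pow_eq_zero_iff two_ne_zero |>.1 (le_antisymm h1 (sq_nonneg _))⟩
    exact absurd (le_csSup hbdd hcS) (not_le.2 hcT)
  have hall : ∀ s ∈ Ioo 0 R, pairing α u u s s = 0 := fun s hs => by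
    obtain ⟨b, hbS, hb⟩ := exists_lt_of_lt_csSup ⟨r, hrS⟩ (hs.2.trans_eq hT.symm)
    exact hdown s b hs hbS.1 hb.le hbS.2
  obtain ⟨x, hx, hux⟩ := hu0
  obtain ⟨d, hxd, hdR⟩ := exists_between (show rho α x < R from hx)
  exact hux (eq_zero_of_pairing_self_eq_zero hα hm hu.continuousOn hdR
    (fun s hs => hall s ⟨hs.1, hs.2.trans hdR⟩) x hxd)

end

/-! ### From weak to pointwise homogeneity. -/

section

variable {m k : ℕ} {α : ℝ}

theorem Z_apply (x : Space m k) (i : Fin m ⊕ Fin k) : Z α x i = weight α i * x i := by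
  cases i with
  | inl i => simp [Z, weight, Pi.single_apply]
  | inr j => simp [Z, weight, Pi.single_apply]

theorem Z_eq (x : Space m k) : Z α x = diagMap (weight α) x := by
  ext i
  rw [Z_apply]
  rfl

theorem dil_Z (s : ℝ) (x : Space m k) : dil α s (Z α x) = Z α (dil α s x) := by
  ext i
  simp only [dil_apply, Z_apply]
  ring

theorem hasDerivAt_comp_dil_smooth {φ : Space m k → ℝ} (hφ : ContDiff ℝ ∞ φ) {s : ℝ} (hs : 0 < s)
    (y : Space m k) :
    HasDerivAt (fun s => φ (dil α s y)) (s⁻¹ * fderiv ℝ φ (dil α s y) (Z α (dil α s y))) s := by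
  have h1 : HasFDerivAt φ (fderiv ℝ φ (dil α s y)) (dil α s y) :=
    (hφ.differentiable (by simp) _).hasFDerivAt
  refine (h1.comp_hasDerivAt s (hasDerivAt_dil (α := α) hs y)).congr_deriv ?_
  rw [← smul_eq_mul, ← map_smul]
  congr 1
  ext i
  change weight α i * s ^ (weight α i - 1) * y i = s⁻¹ * Z α (dil α s y) i
  rw [Z_apply, dil_apply, Real.rpow_sub_one hs.ne']
  ring

theorem fderiv_comp_dil {φ : Space m k → ℝ} (hφ : ContDiff ℝ ∞ φ) (s : ℝ) (y : Space m k) :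
    fderiv ℝ (φ ∘ dil α s) y (Z α y) = fderiv ℝ φ (dil α s y) (Z α (dil α s y)) := by
  have h1 : HasFDerivAt φ (fderiv ℝ φ (dil α s y)) (dil α s y) :=
    (hφ.differentiable (by simp) _).hasFDerivAt
  rw [(h1.comp y (dil α s).hasFDerivAt).fderiv, ContinuousLinearMap.comp_apply, dil_Z]

variable (hα : 0 < α) (hm : 0 < m)
include hα

theorem tsupport_comp_dil_subset {φ : Space m k → ℝ} {d s c : ℝ} (hs : 0 < s)
    (hφd : ∀ x ∈ tsupport φ, rho α x ≤ d) (hd : d ≤ s * c) :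
    tsupport (φ ∘ dil α s) ⊆ {x | rho α x ≤ c} := by
  refine closure_minimal (fun x hx => ?_) (isCompact_rho_le hα _).isClosed
  have h1 := hφd _ (subset_tsupport φ hx)
  rw [rho_dil hα hs.le] at h1
  exact le_of_mul_le_mul_left (h1.trans hd) hs

/-- The moments of a weakly homogeneous function against dilated test functions. -/
theorem IsHomogeneous.hasDerivAt_moment {R κ : ℝ} (hR : 0 < R) {P : Space m k → ℝ}
    (hP : ContinuousOn P (ball α R)) (h : IsHomogeneous α κ (ball α R) P) {φ : Space m k → ℝ}
    (hφ : ContDiff ℝ ∞ φ) {d : ℝ} (hd : 0 ≤ d)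
    (hφd : ∀ x ∈ tsupport φ, rho α x ≤ d) {s : ℝ} (hs : d / R < s) :
    HasDerivAt (fun s => ∫ x in ball α R, P x * φ (dil α s x))
      (-(homDim m k α + κ) * s⁻¹ * ∫ x in ball α R, P x * φ (dil α s x)) s := by
  -- For all r > s₁ the functions φ∘δ_r are supported in the one compact set ρ ≤ d/s₁ inside the
  -- pseudo-ball, so differentiation under the integral takes place on a fixed compact set.
  obtain ⟨s₁, hds₁, hs₁⟩ := exists_between hs
  have hs₁0 : 0 < s₁ := (div_nonneg hd hR.le).trans_lt hds₁
  have hs0 : 0 < s := hs₁0.trans hs₁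
  set K : Set (Space m k) := {x | rho α x ≤ d / s₁}
  have hK : IsCompact K := isCompact_rho_le hα _
  have hKR : K ⊆ ball α R := fun x hx => lt_of_le_of_lt (show rho α x ≤ d / s₁ from hx)
    ((div_lt_comm₀ hs₁0 hR).2 hds₁)
  have hsupp : ∀ s, s₁ < s → tsupport (φ ∘ dil α s) ⊆ K := fun s hs =>
    tsupport_comp_dil_subset hα (hs₁0.trans hs) hφd
      (by rw [← mul_div_assoc, le_div_iff₀ hs₁0, mul_comm]; gcongr)
  have hz : ∀ s, s₁ < s → ∀ x, x ∉ K → φ (dil α s x) = 0 := fun s hs x hx =>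
    image_eq_zero_of_notMem_tsupport (f := φ ∘ dil α s) fun hn => hx (hsupp s hs hn)
  have hz' : ∀ s, s₁ < s → ∀ x, x ∉ K → fderiv ℝ (φ ∘ dil α s) x = 0 := fun s hs x hx =>
    image_eq_zero_of_notMem_tsupport fun hn => hx (hsupp s hs (tsupport_fderiv_subset ℝ hn))
  have hms := (isOpen_ball (m := m) (k := k) hα R).measurableSet
  have hKint : ∀ s, s₁ < s → ∫ x in ball α R, P x * φ (dil α s x) =
      ∫ x in K, P x * φ (dil α s x) := fun s hs =>
    setIntegral_eq_of_subset_of_forall_sdiff_eq_zero hms hKR fun x hx => by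
      rw [hz s hs x hx.2, mul_zero]
  have hdc : ContinuousOn (fun q : ℝ × Space m k => dil α q.1 q.2) (Ioi s₁ ×ˢ K) :=
    continuousOn_dil.mono (prod_mono (Ioi_subset_Ioi hs₁0.le) (subset_univ _))
  have hPc : ContinuousOn (fun q : ℝ × Space m k => P q.2) (Ioi s₁ ×ˢ K) :=
    (hP.mono hKR).comp continuousOn_snd fun q hq => hq.2
  have hφ' : Continuous fun x => fderiv ℝ φ x (Z α x) := by
    refine (hφ.continuous_fderiv (by simp)).clm_apply ?_
    rw [show (Z α : Space m k → Space m k) = diagMap (weight α) from funext Z_eq]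
    exact (diagMap (weight α)).continuous
  have key := hasDerivAt_setIntegral_of_isCompact (μ := volume) hK (isOpen_Ioi (a := s₁))
    (H := fun s y => P y * φ (dil α s y))
    (H' := fun s y => P y * (s⁻¹ * fderiv ℝ φ (dil α s y) (Z α (dil α s y))))
    (hPc.mul (hφ.continuous.comp_continuousOn hdc))
    (hPc.mul ((continuousOn_fst.inv₀ fun q hq => (hs₁0.trans hq.1).ne').mul
      (hφ'.comp_continuousOn hdc)))
    (fun r hr y _ => (hasDerivAt_comp_dil_smooth hφ (hs₁0.trans hr) y).const_mul (P y)) hs₁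
  refine (key.congr_of_eventuallyEq ?_).congr_deriv ?_
  · filter_upwards [lt_mem_nhds hs₁] with r hr using hKint r hr
  · have hφs : ContDiff ℝ ∞ (φ ∘ dil α s) := hφ.comp (dil α s).contDiff
    have hφc : HasCompactSupport (φ ∘ dil α s) :=
      HasCompactSupport.of_support_subset_isCompact hK ((subset_tsupport _).trans (hsupp s hs₁))
    have hw := h _ hφs hφc ((hsupp s hs₁).trans hKR)
    have hcont : Continuous fun x => fderiv ℝ (φ ∘ dil α s) x (Z α x) := by
      simp only [fderiv_comp_dil hφ]
      exact hφ'.comp (dil α s).continuous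
    have i1 : IntegrableOn (fun x => P x * fderiv ℝ (φ ∘ dil α s) x (Z α x)) (ball α R) := by
      have hsub : Function.support (fun x => fderiv ℝ (φ ∘ dil α s) x (Z α x)) ⊆ K := fun x hx =>
        by_contra fun hn => hx (by simp [hz' s hs₁ x hn])
      exact (integrable_mul_of_tsupport_subset (μ := volume) hP hcont
        (HasCompactSupport.of_support_subset_isCompact hK hsub)
        ((closure_minimal hsub hK.isClosed).trans hKR)).integrableOn
    have i2 : IntegrableOn (fun x => P x * φ (dil α s x)) (ball α R) :=
      (integrable_mul_of_tsupport_subset (μ := volume) hP hφs.continuous hφc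
        ((hsupp s hs₁).trans hKR)).integrableOn
    -- Weak homogeneity tested with φ∘δ_s: the adjoint of Z contributes -Q and the eigenvalue
    -- contributes -κ.
    have h1 : ∫ x in ball α R, P x * fderiv ℝ (φ ∘ dil α s) x (Z α x) =
        -(homDim m k α + κ) * ∫ x in ball α R, P x * φ (dil α s x) := by
      simp only [mul_add, Function.comp_apply, mul_left_comm (P _) (homDim m k α),
        mul_assoc] at hw
      rw [integral_add i1 (i2.const_mul _), integral_const_mul, integral_const_mul] at hw
      linear_combination hw
    have h2 : ∫ x in K, P x * (s⁻¹ * fderiv ℝ φ (dil α s x) (Z α (dil α s x))) =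
        ∫ x in ball α R, s⁻¹ * (P x * fderiv ℝ (φ ∘ dil α s) x (Z α x)) := by
      rw [setIntegral_eq_of_subset_of_forall_sdiff_eq_zero hms hKR fun x hx => by
        simp [hz' s hs₁ x hx.2]]
      congr 1
      funext x
      rw [fderiv_comp_dil hφ]
      ring
    rw [h2, integral_const_mul, h1]
    ring

/-- The moment M satisfies the Euler equation s M' = -(Q+κ) M, so s^{Q+κ} M(s) is constant on the
interval s > d/R, which contains 1 because d < R. -/
theorem IsHomogeneous.moment_eq {R κ : ℝ} (hR : 0 < R) {P : Space m k → ℝ}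
    (hP : ContinuousOn P (ball α R)) (h : IsHomogeneous α κ (ball α R) P) {φ : Space m k → ℝ}
    (hφ : ContDiff ℝ ∞ φ) {d : ℝ} (hd : 0 ≤ d) (hdR : d < R)
    (hφd : ∀ x ∈ tsupport φ, rho α x ≤ d) {s : ℝ} (hs : 1 ≤ s) :
    s ^ (homDim m k α + κ) * ∫ x in ball α R, P x * φ (dil α s x) =
      ∫ x in ball α R, P x * φ x := by
  have h1 : (1 : ℝ) ∈ Ioi (d / R) := (div_lt_one hR).2 hdR
  have hder : ∀ r ∈ Ioi (d / R), HasDerivAt (fun s => s ^ (homDim m k α + κ) *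
      ∫ x in ball α R, P x * φ (dil α s x)) 0 r := fun r hr => by
    have hr0 : 0 < r := (div_nonneg hd hR.le).trans_lt hr
    refine ((Real.hasDerivAt_rpow_const (Or.inl hr0.ne')).mul
      (h.hasDerivAt_moment hα hR hP hφ hd hφd hr)).congr_deriv ?_
    rw [Real.rpow_sub_one hr0.ne']
    ring
  have := isOpen_Ioi.is_const_of_deriv_eq_zero isPreconnected_Ioi
    (fun r hr => (hder r hr).differentiableAt.differentiableWithinAt)
    (fun r hr => (hder r hr).deriv) (lt_of_lt_of_le h1 hs : s ∈ Ioi (d / R)) h1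
  simpa [dil_one] using this

/-- Weak homogeneity implies pointwise homogeneity. -/
theorem IsHomogeneous.apply_dil {R κ : ℝ} {P : Space m k → ℝ}
    (hP : ContinuousOn P (ball α R)) (h : IsHomogeneous α κ (ball α R) P) {t : ℝ} (ht : 0 < t)
    (ht1 : t ≤ 1) : ∀ x ∈ ball α R, P (dil α t x) = t ^ κ * P x := by
  intro x₀ hx₀
  have hR : 0 < R := (rho_nonneg hα x₀).trans_lt hx₀
  have hΩ := isOpen_ball (m := m) (k := k) hα R
  have hmaps : MapsTo (dil α t) (ball α R : Set (Space m k)) (ball α R) := fun x hx => by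
    change rho α _ < R
    rw [rho_dil hα ht.le]
    have : t * rho α x ≤ 1 * rho α x := mul_le_mul_of_nonneg_right ht1 (rho_nonneg hα x)
    rw [one_mul] at this
    exact this.trans_lt hx
  have hPt : ContinuousOn (fun x => P (dil α t x)) (ball α R) :=
    hP.comp (dil α t).continuous.continuousOn hmaps
  have hκ : ContinuousOn (fun x => t ^ κ * P x) (ball α R) := continuousOn_const.mul hP
  have hae := hΩ.ae_eq_zero_of_integral_contDiff_smul_eq_zero (μ := volume)
    (f := fun x => P (dil α t x) - t ^ κ * P x)
    ((hPt.sub hκ).locallyIntegrableOn hΩ.measurableSet) (fun φ hφ hφc hφR => by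
      obtain ⟨d, hd, hdR, hφd⟩ : ∃ d, 0 ≤ d ∧ d < R ∧ ∀ x ∈ tsupport φ, rho α x ≤ d := by
        rcases (tsupport φ).eq_empty_or_nonempty with he | hne
        · exact ⟨0, le_rfl, hR, by simp [he]⟩
        · obtain ⟨y, hy, hmax⟩ := IsCompact.exists_isMaxOn hφc hne
            (continuous_rho hα).continuousOn
          exact ⟨rho α y, rho_nonneg hα y, hφR hy, fun x hx => hmax hx⟩
      -- Taking s = 1/t, the change of variables moves the dilation from the test function to P. Its
      -- Jacobian cancels the power Q and leaves t^κ.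
      have h1 := h.moment_eq hα hR hP hφ hd hdR hφd (one_le_inv_iff₀.2 ⟨ht, ht1⟩)
      have ht' : 0 < t⁻¹ := inv_pos.2 ht
      have h2 := setIntegral_comp_dil (R := R * t⁻¹) hα ht' fun x => P (dil α t x) * φ x
      simp only [mul_div_cancel_right₀ R ht'.ne', dil_dil_inv ht] at h2
      have hsub : (ball α R : Set (Space m k)) ⊆ ball α (R * t⁻¹) := fun x hx =>
        lt_of_lt_of_le hx (le_mul_of_one_le_right hR.le (one_le_inv_iff₀.2 ⟨ht, ht1⟩))
      rw [setIntegral_eq_of_subset_of_forall_sdiff_eq_zero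
        (isOpen_ball hα _).measurableSet hsub fun x hx => by
          rw [image_eq_zero_of_notMem_tsupport fun hn => hx.2 (hφR hn), mul_zero]] at h2
      rw [h2, Real.rpow_add ht', Real.inv_rpow ht.le κ] at h1
      have h3 : ((t⁻¹) ^ homDim m k α) * ((t⁻¹) ^ homDim m k α)⁻¹ = 1 :=
        mul_inv_cancel₀ (Real.rpow_pos_of_pos ht' _).ne'
      have h4 : t ^ κ * (t ^ κ)⁻¹ = 1 := mul_inv_cancel₀ (Real.rpow_pos_of_pos ht _).ne'
      have h5 : ∫ x in ball α R, P (dil α t x) * φ x =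
          t ^ κ * ∫ x in ball α R, P x * φ x := by
        rw [← h1]
        linear_combination (-(∫ x in ball α R, P (dil α t x) * φ x) *
          (t ^ κ * (t ^ κ)⁻¹)) * h3 - (∫ x in ball α R, P (dil α t x) * φ x) * h4
      have i1 := integrable_mul_of_tsupport_subset (μ := volume) hPt hφ.continuous hφc hφR
      have i2 := integrable_mul_of_tsupport_subset (μ := volume) hP hφ.continuous hφc hφR
      have hz : ∀ f : Space m k → ℝ, ∫ x in ball α R, f x * φ x = ∫ x, f x * φ x := fun f =>
        setIntegral_eq_integral_of_forall_compl_eq_zero fun x hx => by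
          rw [image_eq_zero_of_notMem_tsupport fun hn => hx (hφR hn), mul_zero]
      rw [hz, hz, ← integral_const_mul] at h5
      have h6 : ∀ x, φ x • (P (dil α t x) - t ^ κ * P x) =
          P (dil α t x) * φ x - t ^ κ * (P x * φ x) := fun x => by
        rw [smul_eq_mul]
        ring
      simp only [h6]
      rw [integral_sub i1 (i2.const_mul _), h5, sub_self])
  have heq : (fun x => P (dil α t x)) =ᵐ[volume.restrict (ball α R)] fun x => t ^ κ * P x := by
    rw [EventuallyEq, ae_restrict_iff' hΩ.measurableSet]
    filter_upwards [hae] with x hx hxr using sub_eq_zero.1 (hx hxr)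
  exact Measure.eqOn_open_of_ae_eq heq hΩ hPt hκ hx₀

end

/-! ### Monotonicity of the frequency, and the Weiss and Monneau functionals. -/

section

variable {m k : ℕ} {α : ℝ}

theorem energy_nonneg (α R : ℝ) (u : Space m k → ℝ) (r : ℝ) : 0 ≤ energy α R u r :=
  integral_nonneg fun _ => Finset.sum_nonneg fun _ _ => sq_nonneg _

variable (hα : 0 < α) (hm : 0 < m)
include hα hm

theorem IsSolution.height_pos {R : ℝ} {u : Space m k → ℝ} (hu : IsSolution α (ball α R) u)
    (hu0 : ∃ x ∈ ball α R, u x ≠ 0) {r : ℝ} (hr : r ∈ Ioo 0 R) : 0 < height α u r := by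
  rw [height_eq hα hm hr.1]
  exact mul_pos (Real.rpow_pos_of_pos hr.1 _) ((hu.isWeakSol hα).pairing_self_pos hα hm hu0 hr)

/-- The frequency is half the logarithmic derivative of the normalized height. -/
theorem IsSolution.hasDerivAt_log_pairing_exp {R : ℝ} {u : Space m k → ℝ}
    (hu : IsSolution α (ball α R) u) (hu0 : ∃ x ∈ ball α R, u x ≠ 0) {s : ℝ}
    (hs : Real.exp s < R) :
    HasDerivAt (fun s => Real.log (pairing α u u (Real.exp s) (Real.exp s)))
      (2 * frequency α R u (Real.exp s)) s := by
  have hr : Real.exp s ∈ Ioo 0 R := ⟨Real.exp_pos s, hs⟩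
  have hpos := (hu.isWeakSol hα).pairing_self_pos hα hm hu0 hr
  have h1 : HasDerivAt (fun s => pairing α u u (Real.exp s) (Real.exp s))
      (2 * Real.exp s ^ (1 - homDim m k α) * energy α R u (Real.exp s) * Real.exp s) s :=
    ((hu.isWeakSol hα).hasDerivAt_pairing_self hα hm hr).comp s (Real.hasDerivAt_exp s)
  refine (h1.log hpos.ne').congr_deriv ?_
  have h2 : Real.exp s ^ (1 - homDim m k α) = (Real.exp s ^ (homDim m k α - 1))⁻¹ := by
    rw [← Real.rpow_neg hr.1.le, neg_sub]
  have h3 : Real.exp s ^ (homDim m k α - 1) ≠ 0 := (Real.rpow_pos_of_pos hr.1 _).ne'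
  rw [frequency, height_eq hα hm hr.1, h2]
  field_simp

/-- At the radii e^x, e^y and e^{(x+y)/2}, the three-spheres inequality is midpoint convexity of the
logarithm of the normalized height, whose derivative is twice the frequency. -/
theorem IsSolution.monotoneOn_frequency {R : ℝ} {u : Space m k → ℝ}
    (hu : IsSolution α (ball α R) u) (hu0 : ∃ x ∈ ball α R, u x ≠ 0) :
    MonotoneOn (frequency α R u) (Ioo 0 R) := by
  intro a ha b hb hab
  have hR : 0 < R := ha.1.trans ha.2
  rcases hab.eq_or_lt with rfl | hab
  · exact le_rfl
  have hmem : ∀ x, x < Real.log R → Real.exp x ∈ Ioo 0 R := fun x hx =>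
    ⟨Real.exp_pos x, (Real.lt_log_iff_exp_lt hR).1 hx⟩
  have hpos := fun r hr => (hu.isWeakSol hα).pairing_self_pos hα hm hu0 (r := r) hr
  have key := deriv_le_of_midpoint_convex (b := Real.log R)
    (F := fun s => Real.log (pairing α u u (Real.exp s) (Real.exp s)))
    (F' := fun s => 2 * frequency α R u (Real.exp s))
    (fun x y hx hy => by
      have hz : (x + y) / 2 < Real.log R := by linarith
      have h1 := (hu.isWeakSol hα).pairing_self_sq_le hα hm (hmem x hx) (hmem y hy) (hmem _ hz)
        (by rw [← Real.exp_add, ← Real.exp_add]; congr 1; ring)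
      have h2 := Real.log_le_log (pow_pos (hpos _ (hmem _ hz)) 2) h1
      rwa [Real.log_pow, Real.log_mul (hpos _ (hmem x hx)).ne' (hpos _ (hmem y hy)).ne'] at h2)
    (fun x hx => hu.hasDerivAt_log_pairing_exp hα hm hu0 (hmem x hx).2)
    (Real.log_lt_log ha.1 hab) (Real.log_lt_log hb.1 hb.2)
  simp only [Real.exp_log ha.1, Real.exp_log hb.1] at key
  linarith

/-- A nondecreasing function bounded below by 0 has its infimum as limit at the left end. The lower
bound κ ≤ N is what the sign of the Weiss functional rests on. -/
theorem IsSolution.exists_tendsto_frequency {R : ℝ} (hR : 0 < R) {u : Space m k → ℝ}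
    (hu : IsSolution α (ball α R) u) (hu0 : ∃ x ∈ ball α R, u x ≠ 0) :
    ∃ κ, Tendsto (frequency α R u) (𝓝[>] 0) (𝓝 κ) ∧ ∀ r ∈ Ioo 0 R, κ ≤ frequency α R u r := by
  have hbdd : BddBelow (frequency α R u '' Ioo 0 R) := by
    refine ⟨0, ?_⟩
    rintro _ ⟨r, hr, rfl⟩
    exact div_nonneg (mul_nonneg hr.1.le (energy_nonneg α R u r))
      (hu.height_pos hα hm hu0 hr).le
  exact ⟨_, (hu.monotoneOn_frequency hα hm hu0).tendsto_nhdsWithin_Ioo_right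
    (nonempty_Ioo.2 hR) hbdd, fun r hr => csInf_le hbdd (mem_image_of_mem _ hr)⟩

/-- The functional is rD - κH divided by the positive number r^{Q-1+2κ}, and rD ≥ κH restates κ ≤ N
because H > 0. -/
theorem IsSolution.weiss_nonneg {R κ : ℝ} {u : Space m k → ℝ}
    (hu : IsSolution α (ball α R) u) (hu0 : ∃ x ∈ ball α R, u x ≠ 0) {r : ℝ} (hr : r ∈ Ioo 0 R)
    (hκ : κ ≤ frequency α R u r) : 0 ≤ weiss α R κ u r := by
  have hH := hu.height_pos hα hm hu0 hr
  rw [frequency, le_div_iff₀ hH] at hκ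
  have h1 : r ^ (homDim m k α - 1 + 2 * κ) = r * r ^ (homDim m k α - 2 + 2 * κ) := by
    rw [mul_comm r, ← Real.rpow_add_one hr.1.ne']
    congr 1
    ring
  have h2 := Real.rpow_pos_of_pos hr.1 (homDim m k α - 2 + 2 * κ)
  have hr0 := hr.1
  have h3 : weiss α R κ u r = (r * energy α R u r - κ * height α u r) /
      (r * r ^ (homDim m k α - 2 + 2 * κ)) := by
    rw [weiss, h1]
    field_simp
  rw [h3]
  exact div_nonneg (by linarith) (by positivity)

omit hm in
theorem IsHomogeneous.pairing_eq_mul {R κ : ℝ} {P : Space m k → ℝ}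
    (hP : ContinuousOn P (ball α R)) (h : IsHomogeneous α κ (ball α R) P) (v : Space m k → ℝ)
    (a : ℝ) {b c : ℝ} (hb : 0 < b) (hbc : b ≤ c) (hc : c < R) :
    pairing α v P a b = (b / c) ^ κ * pairing α v P a c := by
  have hc0 : 0 < c := hb.trans_le hbc
  unfold pairing
  rw [← integral_const_mul]
  refine integral_congr_ae ?_
  filter_upwards [ae_mem_sphere] with y hy
  have h1 := h.apply_dil hα hP (div_pos hb hc0) ((div_le_one hc0).2 hbc) _
    (dil_mem_punctured hα ⟨hc0, hc⟩ hy).1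
  rw [dil_dil (div_pos hb hc0).le hc0.le, div_mul_cancel₀ b hc0.ne'] at h1
  rw [h1]
  ring

/-- The normalized pairing of a solution with a homogeneous solution does not depend on the
radius. -/
theorem IsWeakSol.pairing_homogeneous {R κ : ℝ} {u P : Space m k → ℝ}
    {gu gP : Fin m ⊕ Fin k → Space m k → ℝ} (hu : IsWeakSol α (ball α R) u gu)
    (hP : IsWeakSol α (ball α R) P gP) (h : IsHomogeneous α κ (ball α R) P) {r s : ℝ}
    (hr : 0 < r) (hrs : r ≤ s) (hs : s < R) :
    pairing α u P r r = (r / s) ^ (2 * κ) * pairing α u P s s := by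
  have hs0 : 0 < s := hr.trans_le hrs
  have h1 : r ^ 2 / s ≤ r := by
    rw [div_le_iff₀ hs0, pow_two]
    exact mul_le_mul_of_nonneg_left hrs hr.le
  have h2 : 0 < r ^ 2 / s := by positivity
  -- The pair (r,r) is traded for (s, r²/s), which has the same product. Homogeneity of `P` then
  -- acts in the second slot alone, with ratio (r²/s)/s = (r/s)².
  rw [hu.pairing_eq hα hm hP ⟨hr, hrs.trans_lt hs⟩ ⟨hr, hrs.trans_lt hs⟩ ⟨hs0, hs⟩
      ⟨h2, (h1.trans hrs).trans_lt hs⟩ (by field_simp),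
    h.pairing_eq_mul hα hP.continuousOn u s h2 (h1.trans hrs) hs,
    Real.rpow_mul (by positivity)]
  congr 2
  rw [Real.rpow_two, div_pow]
  field_simp

theorem monneau_eq {R κ : ℝ} {u P : Space m k → ℝ} (hu : ContinuousOn u (ball α R))
    (hP : ContinuousOn P (ball α R)) {r : ℝ} (hr : r ∈ Ioo 0 R) :
    monneau α κ u P r = r ^ (-(2 * κ)) *
      (pairing α u u r r - 2 * pairing α u P r r + pairing α P P r r) := by
  have h1 := integral_psi_mul_sq hα hm hu hP hr hr (-1)
  have h2 : ∀ y : Space m k, u (dil α r y) + -1 * P (dil α r y) =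
      u (dil α r y) - P (dil α r y) := fun y => by ring
  simp only [h2] at h1
  rw [monneau, integral_sphere_eq hα hm hr.1 fun x => (u x - P x) ^ 2, h1,
    Real.rpow_add hr.1, Real.rpow_neg hr.1.le]
  have h3 := (Real.rpow_pos_of_pos hr.1 (homDim m k α - 1)).ne'
  field_simp
  ring

/-- In the expanded square, the cross term and the term quadratic in `P` scale exactly like r^{2κ},
so after normalization only r^{-2κ} times the self-pairing of `u` varies. Its derivative combines D
and H into the Weiss functional. -/
theorem IsSolution.hasDerivAt_monneau {R κ : ℝ} {u P : Space m k → ℝ}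
    (hu : IsSolution α (ball α R) u) (hP : IsSolution α (ball α R) P)
    (h : IsHomogeneous α κ (ball α R) P) {r : ℝ} (hr : r ∈ Ioo 0 R) :
    HasDerivAt (monneau α κ u P) (2 / r * weiss α R κ u r) r := by
  have hu' := hu.isWeakSol hα
  have hP' := hP.isWeakSol hα
  obtain ⟨s, hrs, hsR⟩ := exists_between hr.2
  have hs0 : 0 < s := hr.1.trans hrs
  -- The constant is the normalized contribution of the two terms involving `P`, evaluated at an
  -- auxiliary radius s between r and R.
  set C := s ^ (-(2 * κ)) * (pairing α P P s s - 2 * pairing α u P s s)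
  have heq : monneau α κ u P =ᶠ[𝓝 r] fun r => r ^ (-(2 * κ)) * pairing α u u r r + C := by
    filter_upwards [Ioo_mem_nhds hr.1 hrs] with t ht
    rw [monneau_eq hα hm hu'.continuousOn hP'.continuousOn ⟨ht.1, ht.2.trans hsR⟩,
      hu'.pairing_homogeneous hα hm hP' h ht.1 ht.2.le hsR,
      hP'.pairing_homogeneous hα hm hP' h ht.1 ht.2.le hsR, Real.div_rpow ht.1.le hs0.le]
    have h1 := (Real.rpow_pos_of_pos ht.1 (2 * κ)).ne'
    have h2 := (Real.rpow_pos_of_pos hs0 (2 * κ)).ne'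
    simp only [C, Real.rpow_neg ht.1.le, Real.rpow_neg hs0.le]
    field_simp
    ring
  have hd := ((Real.hasDerivAt_rpow_const (p := -(2 * κ)) (Or.inl hr.1.ne')).mul
    (hu'.hasDerivAt_pairing_self hα hm hr)).add_const C
  refine (hd.congr_of_eventuallyEq heq).congr_deriv ?_
  have h1 := (Real.rpow_pos_of_pos hr.1 (homDim m k α)).ne'
  have h2 := (Real.rpow_pos_of_pos hr.1 (2 * κ)).ne'
  have hr0 := hr.1.ne'
  rw [weiss, height_eq hα hm hr.1, Real.rpow_add hr.1 (homDim m k α - 2),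
    Real.rpow_add hr.1 (homDim m k α - 1), Real.rpow_sub_one hr0, Real.rpow_sub_one hr0,
    Real.rpow_sub hr.1 1, Real.rpow_sub hr.1 _ 2, Real.rpow_one, Real.rpow_neg hr.1.le,
    Real.rpow_two, energy]
  field_simp
  ring

theorem IsSolution.monotoneOn_monneau {R κ : ℝ} {u P : Space m k → ℝ}
    (hu : IsSolution α (ball α R) u) (hP : IsSolution α (ball α R) P)
    (h : IsHomogeneous α κ (ball α R) P)
    (hW : ∀ r ∈ Ioo 0 R, 0 ≤ 2 / r * weiss α R κ u r) :
    MonotoneOn (monneau α κ u P) (Ioo 0 R) := by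
  have hd := fun r hr => hu.hasDerivAt_monneau hα hm hP h (r := r) hr
  refine monotoneOn_of_deriv_nonneg (convex_Ioo 0 R)
    (fun r hr => (hd r hr).continuousAt.continuousWithinAt) ?_ ?_
  · rw [interior_Ioo]
    exact fun r hr => (hd r hr).differentiableAt.differentiableWithinAt
  · rw [interior_Ioo]
    intro r hr
    rw [(hd r hr).deriv]
    exact hW r hr

end

end Baouendi

end

theorem theoremT (m k : ℕ) (hm : 0 < m) (hk : 0 < k) (α : ℝ) (hα : 0 < α) (R : ℝ) (hR : 0 < R)
    (u : Baouendi.Space m k → ℝ)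
    (hu : Baouendi.IsSolution α (Baouendi.ball α R) u)
    (hu0 : ∃ x ∈ Baouendi.ball α R, u x ≠ 0) :
    (∀ r ∈ Set.Ioo 0 R, 0 < Baouendi.height α u r) ∧
    ∃ κ : ℝ, Tendsto (Baouendi.frequency α R u) (𝓝[>] 0) (𝓝 κ) ∧
      ∀ P : Baouendi.Space m k → ℝ,
        Baouendi.IsSolution α (Baouendi.ball α R) P →
        Baouendi.IsHomogeneous α κ (Baouendi.ball α R) P →
        (∀ r ∈ Set.Ioo 0 R,
          HasDerivAt (Baouendi.monneau α κ u P) (2 / r * Baouendi.weiss α R κ u r) r ∧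
          0 ≤ 2 / r * Baouendi.weiss α R κ u r) ∧
        MonotoneOn (Baouendi.monneau α κ u P) (Set.Ioo 0 R) := by
  obtain ⟨κ, hκ, hle⟩ := hu.exists_tendsto_frequency hα hm hR hu0
  refine ⟨fun r hr => hu.height_pos hα hm hu0 hr, κ, hκ, fun P hP hPκ => ?_⟩
  have hW : ∀ r ∈ Set.Ioo 0 R, 0 ≤ 2 / r * Baouendi.weiss α R κ u r := fun r hr =>
    mul_nonneg (div_nonneg zero_le_two hr.1.le) (hu.weiss_nonneg hα hm hu0 hr (hle r hr))
  exact ⟨fun r hr => ⟨hu.hasDerivAt_monneau hα hm hP hPκ hr, hW r hr⟩,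
    hu.monotoneOn_monneau hα hm hP hPκ hW⟩
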